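/- Let $1\le \ell\le k$ be integers. All families below are germs at $(\epsilon,z)=(0,0)\in\mathbb C^{\ell}\times\mathbb C$ of holomorphic families, with $\epsilon=(\epsilon_{\ell-1},\dots,\epsilon_0)$. A generic $\ell$-parameter unfolding is a germ of analytic family of vector fields $\dot z=\omega_\epsilon(z)=\sum_{n\ge 0}c_n(\epsilon)z^n$ with $\omega_0(z)=z^{k+1}+O(z^{k+2})$ and $$\det\frac{\partial(c_{\ell-1},\dots,c_0)}{\partial(\epsilon_{\ell-1},\dots,\epsilon_0)}(0)\ne 0 .$$ A change of coordinate and parameter is a germ of analytic map $(z,\epsilon)\mapsto(\varphi_\epsilon(z),h(\epsilon))$ with $\varphi_0(0)=0$, $h(0)=0$, $\varphi_0'(0)\neq0$ and $Dh(0)$ invertible; it conjugates $X_\epsilon$ to $Y_{h(\epsilon)}$ if $\varphi_\epsilon'(z)X_\epsilon(z)=Y_{h(\epsilon)}(\varphi_\epsilon(z))$ near the origin. A family in normal form is a family $$\dot z=\frac{P_\epsilon(z)}{1+A(\epsilon)z^k},\qquad P_\epsilon(z)=z^{k+1}+b_{k-1}(\epsilon)z^{k-1}+\dots+b_1(\epsilon)z+b_0(\epsilon),$$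 with $A$ and all $b_j$ analytic near $\epsilon=0$, $b_j(0)=0$ for all $j$, and $b_j(\epsilon)=\epsilon_j$ for $j\le \ell-1$. 1. Every generic $\ell$-parameter unfolding $\omega_\epsilon$ is conjugate, by a change of coordinate and parameter $(z,\epsilon)\mapsto(\tilde z,\tilde\epsilon)=(\varphi_\epsilon(z),h(\epsilon))$, to a family in normal form $P_{\tilde\epsilon}(\tilde z)/(1+A(\tilde\epsilon)\tilde z^k)$, where $A(\tilde\epsilon)$ is the sum of the inverses $1/\omega_\epsilon'(z_i)$ of the eigenvalues at the zeros $z_i$ of $\omega_\epsilon$ close to $0$, for all small $\epsilon$ for which these zeros are simple. 2. Let $P_{\tilde\epsilon}(\tilde z)/(1+A(\tilde\epsilon)\tilde z^k)$ and $\widehat P_{\hat\epsilon}(\hat z)/(1+\widehat A(\hat\epsilon)\hat z^k)$ be two $\ell$-parameter families in normal form which are conjugate through a change of coordinate and parameter $(\hat z,\hat\epsilon)=(\varphi_{\tilde\epsilon}(\tilde z),h(\tilde\epsilon))$. Then there exist $\mu\in\mathbb C$ with $\mu^k=1$ and a germ of analytic function $T(\tilde\epsilon)$ such that, near the origin, $$h(\tilde\epsilon)=(\mu^{-(\ell-2)}\tilde\epsilon_{\ell-1},\dots,\tilde\epsilon_1,\mu\tilde\epsilon_0),\quad\text{i.e.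 } h_j(\tilde\epsilon)=\mu^{1-j}\tilde\epsilon_j,\qquad \varphi_{\tilde\epsilon}(\tilde z)=\Phi^{T(\tilde\epsilon)}_{h(\tilde\epsilon)}(\mu\tilde z),$$ where $\Phi^{t}_{\hat\epsilon}$ is the flow of $\widehat P_{\hat\epsilon}(\hat z)/(1+\widehat A(\hat\epsilon)\hat z^k)$ at the complex time $t$. Moreover $A(\tilde\epsilon)=\widehat A(h(\tilde\epsilon))$ and $\widehat P_{h(\tilde\epsilon)}(\mu\tilde z)=\mu P_{\tilde\epsilon}(\tilde z)$ for $\tilde\epsilon$ near $0$. In particular, the parameters are canonical: if $h_1$ and $h_2$ are the parameter parts of two changes of coordinate and parameter bringing the same generic unfolding to normal forms, then there is $\mu$ with $\mu^k=1$ such that $(h_2)_j=\mu^{1-j}(h_1)_j$ near $0$ for all $j\le\ell-1$. -/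

import Mathlib

open Filter Topology

namespace ParabolicUnfolding

/-- The Taylor coefficient `c_j(ε)` at `z = 0` of the family
`ω_ε(z) = ∑ c_j(ε) z ^ j`. -/
noncomputable def coeffFn {ℓ : ℕ} (ω : (Fin ℓ → ℂ) → ℂ → ℂ) (j : ℕ) (ε : Fin ℓ → ℂ) : ℂ :=
  iteratedDeriv j (ω ε) 0 / (j.factorial : ℂ)

/-- A germ at `(ε, z) = (0, 0)` of generic analytic `ℓ`-parameter unfolding of a
parabolic singularity `z ^ (k + 1) + O(z ^ (k + 2))`. The coordinate `ε j` is the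
parameter `ε_j`, for `0 ≤ j ≤ ℓ - 1`. -/
structure IsGenericUnfolding (k ℓ : ℕ) (ω : (Fin ℓ → ℂ) → ℂ → ℂ) : Prop where
  analytic : AnalyticAt ℂ (fun p : (Fin ℓ → ℂ) × ℂ => ω p.1 p.2) (0, 0)
  parabolic : (fun z : ℂ => ω 0 z - z ^ (k + 1)) =O[𝓝 0] (fun z : ℂ => z ^ (k + 2))
  generic : (Matrix.of fun i j : Fin ℓ =>
    fderiv ℂ (coeffFn ω (i : ℕ)) 0 (Pi.single j 1)).det ≠ 0

/-- The polynomial function `z ^ (k + 1) + b_{k-1} z ^ (k - 1) + ... + b_1 z + b_0`. -/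
noncomputable def nfPoly {k : ℕ} (b : Fin k → ℂ) (z : ℂ) : ℂ :=
  z ^ (k + 1) + ∑ j : Fin k, b j * z ^ (j : ℕ)

/-- The family of vector fields `P_ε(z) / (1 + A(ε) z ^ k)`. -/
noncomputable def nfField {k ℓ : ℕ} (b : (Fin ℓ → ℂ) → Fin k → ℂ) (A : (Fin ℓ → ℂ) → ℂ)
    (ε : Fin ℓ → ℂ) (z : ℂ) : ℂ :=
  nfPoly (b ε) z / (1 + A ε * z ^ k)

/-- The data `b, A` define a family in normal form: the coefficients and `A` are germs of
analytic functions of `ε`, `b_i(0) = 0` for all `i`, and `b_j(ε) = ε_j` for `j ≤ ℓ - 1`. -/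
structure IsNormalForm {k ℓ : ℕ} (b : (Fin ℓ → ℂ) → Fin k → ℂ) (A : (Fin ℓ → ℂ) → ℂ) :
    Prop where
  analytic_coeff : ∀ i : Fin k, AnalyticAt ℂ (fun ε => b ε i) 0
  coeff_zero : ∀ i : Fin k, b 0 i = 0
  analytic_A : AnalyticAt ℂ A 0
  coeff_eq : ∀ (i : Fin k) (j : Fin ℓ), (i : ℕ) = (j : ℕ) → ∀ᶠ ε in 𝓝 (0 : Fin ℓ → ℂ), b ε i = ε j

/-- The germ of analytic change of coordinate and parameter `(z, ε) ↦ (φ_ε(z), h(ε))`,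
fixing the origin and invertible there, conjugates the family `X_ε` to the family `Y`:
`φ_ε'(z) X_ε(z) = Y_{h(ε)}(φ_ε(z))` near the origin. -/
structure IsConjugacy {ℓ : ℕ} (X Y : (Fin ℓ → ℂ) → ℂ → ℂ)
    (φ : (Fin ℓ → ℂ) → ℂ → ℂ) (h : (Fin ℓ → ℂ) → (Fin ℓ → ℂ)) : Prop where
  analytic_coord : AnalyticAt ℂ (fun p : (Fin ℓ → ℂ) × ℂ => φ p.1 p.2) (0, 0)
  coord_zero : φ 0 0 = 0
  deriv_coord_ne : deriv (φ 0) 0 ≠ 0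
  analytic_param : AnalyticAt ℂ h 0
  param_zero : h 0 = 0
  param_bijective : Function.Bijective (fderiv ℂ h 0)
  conj : ∀ᶠ p : (Fin ℓ → ℂ) × ℂ in 𝓝 (0, 0),
    deriv (φ p.1) p.2 * X p.1 p.2 = Y (h p.1) (φ p.1 p.2)

/-- `w = Φ^t(z)`, where `Φ^t` is the flow at the complex time `t` of the holomorphic vector
field `X`. The complex time runs along the segment from `0` to `t`, parametrized by
`s ↦ s t` with `s ∈ [0, 1]`, and the trajectory stays where `X` is holomorphic (so that it is
unique). -/
def FlowsTo (X : ℂ → ℂ) (t z w : ℂ) : Prop :=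
  ∃ γ : ℝ → ℂ, γ 0 = z ∧ γ 1 = w ∧ ∀ s ∈ Set.Icc (0 : ℝ) 1,
    AnalyticAt ℂ X (γ s) ∧ HasDerivWithinAt γ (t * X (γ s)) (Set.Icc 0 1) s

/-- `A(h(ε))` is the sum of the inverses of the eigenvalues `ω_ε'(z)` at the small zeros `z`
of `ω_ε`, for all small `ε` for which these zeros are simple. -/
def IsSumInvEigenvalues {ℓ : ℕ} (ω : (Fin ℓ → ℂ) → ℂ → ℂ) (h : (Fin ℓ → ℂ) → (Fin ℓ → ℂ))
    (A : (Fin ℓ → ℂ) → ℂ) : Prop :=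
  ∃ r₀ > (0 : ℝ), ∀ r : ℝ, 0 < r → r < r₀ → ∀ᶠ ε in 𝓝 (0 : Fin ℓ → ℂ),
    (∀ z : ℂ, ‖z‖ < r → ω ε z = 0 → deriv (ω ε) z ≠ 0) →
      ∃ Z : Finset ℂ, (∀ z : ℂ, z ∈ Z ↔ ‖z‖ < r ∧ ω ε z = 0) ∧
        A (h ε) = ∑ z ∈ Z, (deriv (ω ε) z)⁻¹

end ParabolicUnfolding

/-! A vector field X is studied through its dual form dz/X: a coordinate φ conjugates X to Y exactly
when φ pulls dw/Y back to dz/X. After a rescaling every field is a small perturbation of z^(k+1) on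
the disk of radius 2. Its zeros near the origin lie inside the unit circle, and the dual form is
tested there by its moments, the integrals of ζ^n dζ / (2πi X(ζ)).

Existence. To first order at z^(-(k+1)), moving the coordinate by u_j z^j (j ≤ k), moving b_j and
moving A change the dual form by multiples of pairwise distinct powers among z^(-1), ...,
z^(-(2k+2)). So (u, b, A) are local analytic coordinates on the space of the first 2k+2 moments
(`exists_momentMap_inverse`). For F near z^(k+1), take (u, b, A) for which 1/F and the pull-back of
(1 + A w^k) dw / P_b(w) by g = `idPoly u` have the same first 2k+2 moments. Their difference becomes
holomorphic when multiplied by a function close to z^(2k+2), so a contraction kills all further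
moments (`circleResidue_pow_mul_eq_zero`) and the difference extends holomorphically to the disk. If
Q is a primitive of the extension, flowing g(z) for the time Q(z) along the normal form adds dQ to
the pulled-back form and produces the conjugacy (`exists_universal_normalization`). The whole
construction is analytic in the restriction of F to the circle, an element of a Banach space, hence
in ε. Genericity serves to take b_0, ..., b_(ℓ-1) as new parameters (`fderiv_coeff_injective`), and
A is identified by the residue theorem on the sphere (`sum_roots_eq`).

Uniqueness. Let φ, close to the identity, conjugate (b, A) to (β, α). Division by P_b gives φ =
`idPoly u` + P_b v. The term P_b v can be removed by a linear homotopy along which the moments do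
not change, because the form varies by the differential of a function holomorphic in the disk. Hence
(u, β, α) and (0, b, A) have the same moments and are equal (`exists_eq_of_conj_near_id`). A
coordinate that preserves a normal form is the flow map whose time is read off at one nonsingular
point (`exists_flowTime`). In general φ_0'(0) is a k-th root of unity μ, and composing with a
rotation by μ⁻¹ reduces to maps tangent to the identity. -/

namespace ParabolicUnfolding

/-! ### Superposition operators on Banach spaces of continuous functions -/

section Nemytskii

variable {K X Y : Type*} [TopologicalSpace K] [CompactSpace K]
  [NormedAddCommGroup X] [NormedSpace ℂ X] [NormedAddCommGroup Y] [NormedSpace ℂ Y]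

/-- A continuous multilinear map, applied pointwise to continuous functions. -/
noncomputable def pointwiseMultilinear {n : ℕ} (m : X [×n]→L[ℂ] Y) :
    C(K, X) [×n]→L[ℂ] C(K, Y) :=
  MultilinearMap.mkContinuous
    { toFun := fun g => ⟨fun t => m (fun i => g i t), by fun_prop⟩
      map_update_add' := by
        intro _ g i x y
        ext t
        have h : ∀ z : C(K, X), (fun j => Function.update g i z j t)
            = Function.update (fun j => g j t) i (z t) := by
          intro z; ext j; by_cases hj : j = i
          · subst hj; simp
          · simp [hj]
        simp [h]
      map_update_smul' := by
        intro _ g i c x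
        ext t
        have h : ∀ z : C(K, X), (fun j => Function.update g i z j t)
            = Function.update (fun j => g j t) i (z t) := by
          intro z; ext j; by_cases hj : j = i
          · subst hj; simp
          · simp [hj]
        simp [h] } ‖m‖ (by
      intro g
      refine (ContinuousMap.norm_le _ (by positivity)).2 fun t => ?_
      refine (m.le_opNorm _).trans ?_
      gcongr with i
      exact ContinuousMap.norm_coe_le_norm (g i) t)

theorem norm_pointwiseMultilinear_le {n : ℕ} (m : X [×n]→L[ℂ] Y) :
    ‖(pointwiseMultilinear m : C(K, X) [×n]→L[ℂ] C(K, Y))‖ ≤ ‖m‖ :=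
  MultilinearMap.mkContinuous_norm_le _ (norm_nonneg _) _

open Classical in
/-- The superposition operator `g ↦ f ∘ g` on continuous functions. -/
noncomputable def superposition (K : Type*) [TopologicalSpace K] (f : X → Y) (g : C(K, X)) :
    C(K, Y) :=
  -- The value 0 is never used: the operator is only evaluated at `g` with values in a ball where
  -- `f` is analytic.
  if h : Continuous (f ∘ g) then ⟨f ∘ g, h⟩ else 0

theorem superposition_apply {K X Y : Type*} [TopologicalSpace K] [NormedAddCommGroup X]
    [NormedAddCommGroup Y] {f : X → Y} {g : C(K, X)} (h : Continuous (f ∘ g)) (t : K) :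
    superposition K f g t = f (g t) := by
  simp [superposition, h]

/-- The Taylor series of `f` at `x₀`, applied pointwise, is a power series on C(K, X) whose terms
have no larger norms. It therefore converges on a ball of the same radius around the constant
function `x₀`. Compactness of `K` turns the pointwise bound on `g` into a bound in the sup norm. -/
theorem exists_analyticAt_superposition [CompleteSpace Y] {f : X → Y} {x₀ : X}
    (hf : AnalyticAt ℂ f x₀) :
    ∃ r > 0, ∀ g : C(K, X), (∀ t, dist (g t) x₀ < r) →
      AnalyticAt ℂ (superposition K f) g ∧ ∀ t, superposition K f g t = f (g t) := by
  obtain ⟨p, R, hp⟩ := hf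
  -- A radius strictly below `R` makes ‖p n‖ r^n bounded, which is the bound that passes to the
  -- pointwise series.
  obtain ⟨r, hr0, hrR⟩ := ENNReal.lt_iff_exists_nnreal_btwn.1 hp.r_pos
  have hp' : HasFPowerSeriesOnBall f p x₀ r := hp.mono hr0 hrR.le
  let q : FormalMultilinearSeries ℂ C(K, X) C(K, Y) := fun n => pointwiseMultilinear (p n)
  have hq : (r : ENNReal) ≤ q.radius := by
    obtain ⟨C, hC⟩ := (p.norm_mul_pow_le_of_lt_radius (hrR.trans_le hp.r_le))
    refine q.le_radius_of_bound C fun n => le_trans ?_ (hC.2 n)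
    gcongr
    exact norm_pointwiseMultilinear_le _
  have hcont : ∀ g : C(K, X), (∀ t, dist (g t) x₀ < r) → Continuous (f ∘ g) := by
    intro g hg
    refine continuous_iff_continuousAt.2 fun t => ?_
    refine ContinuousAt.comp ?_ g.continuous.continuousAt
    refine hp'.continuousOn.continuousAt ?_
    refine (Metric.isOpen_eball).mem_nhds ?_
    simpa [edist_dist, ENNReal.ofReal_lt_coe_iff] using hg t
  have key : HasFPowerSeriesOnBall (superposition K f) q (ContinuousMap.const K x₀) r := by
    refine ⟨hq, hr0, ?_⟩
    intro y hy
    have hsum := q.hasSum (x := y) (Metric.eball_subset_eball hq hy)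
    have hy' : ‖y‖ < r := by
      simpa [edist_zero_right, enorm_eq_nnnorm] using hy
    have hyt : ∀ t, ‖y t‖ < r := fun t => (ContinuousMap.norm_coe_le_norm y t).trans_lt hy'
    convert hsum using 1
    ext t
    have h1 : HasSum (fun n => q n (fun _ => y) t) (q.sum y t) :=
      hsum.mapL (ContinuousMap.evalCLM ℂ t)
    have h2 := hp'.hasSum (y := y t) (by
      simpa [edist_zero_right, enorm_eq_nnnorm] using hyt t)
    rw [superposition_apply (hcont _ (by intro t; simpa using hyt t))]
    exact h2.unique h1
  refine ⟨r, by exact_mod_cast hr0, fun g hg => ⟨?_, superposition_apply (hcont g hg)⟩⟩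
  refine key.analyticAt_of_mem ?_
  rcases isEmpty_or_nonempty K with hK | hK
  · have : g = ContinuousMap.const K x₀ := by ext t; exact hK.elim t
    simpa [this] using hr0
  · have : dist g (ContinuousMap.const K x₀) < r :=
      (ContinuousMap.dist_lt_iff_of_nonempty).2 hg
    simpa [edist_dist, ENNReal.ofReal_lt_coe_iff] using this

end Nemytskii

/-! ### Integration of continuous functions on the unit interval -/

section Volterra

/-- The operator `g ↦ (t ↦ ∫_0^t g)` on continuous functions on the unit interval. -/
noncomputable def volterra : C(unitInterval, ℂ) →L[ℂ] C(unitInterval, ℂ) :=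
  LinearMap.mkContinuous
    { toFun := fun g => ⟨fun t => ∫ s in (0 : ℝ)..t, Set.IccExtend zero_le_one g s, by
          have h : Continuous fun t : ℝ => ∫ s in (0 : ℝ)..t, Set.IccExtend zero_le_one g s :=
            intervalIntegral.continuous_primitive
              (fun a b => (g.continuous.Icc_extend').intervalIntegrable a b) 0
          exact h.comp continuous_subtype_val⟩
      map_add' := by
        intro f g
        ext t
        have := intervalIntegral.integral_add (μ := MeasureTheory.volume)
          ((f.continuous.Icc_extend' (h := zero_le_one' ℝ)).intervalIntegrable 0 t)
          ((g.continuous.Icc_extend' (h := zero_le_one' ℝ)).intervalIntegrable 0 t)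
        simpa [Set.IccExtend] using this
      map_smul' := by
        intro c g
        ext t
        simp [Set.IccExtend] } 1 (by
    intro g
    refine (ContinuousMap.norm_le _ (by positivity)).2 fun t => ?_
    have := intervalIntegral.norm_integral_le_of_norm_le_const (a := 0) (b := (t : ℝ))
      (f := Set.IccExtend zero_le_one g) (C := ‖g‖)
      (fun x _ => ContinuousMap.norm_coe_le_norm g _)
    refine this.trans ?_
    rw [sub_zero, abs_of_nonneg t.2.1, one_mul]
    exact mul_le_of_le_one_right (norm_nonneg _) t.2.2)

theorem volterra_apply (g : C(unitInterval, ℂ)) (t : unitInterval) :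
    volterra g t = ∫ s in (0 : ℝ)..t, Set.IccExtend zero_le_one g s := rfl

/-- If `γ' = c · g` on `[0, 1]` then `γ(t) = γ(0) + c ∫_0^t g`. -/
theorem eq_add_smul_volterra {γ : ℝ → ℂ} {c : ℂ} (g : C(unitInterval, ℂ))
    (h : ∀ s : unitInterval, HasDerivWithinAt γ (c * g s) (Set.Icc 0 1) s) (t : unitInterval) :
    γ t = γ 0 + c * volterra g t := by
  have hc : Continuous fun s => c * Set.IccExtend zero_le_one g s :=
    continuous_const.mul g.continuous.Icc_extend'
  have := intervalIntegral.integral_eq_sub_of_hasDeriv_right (a := 0) (b := (t : ℝ)) (f := γ)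
    (f' := fun s => c * Set.IccExtend zero_le_one g s) ?_ ?_ (hc.intervalIntegrable _ _)
  · rw [volterra_apply, ← intervalIntegral.integral_const_mul, this]; ring
  · intro s hs
    rw [Set.uIcc_of_le t.2.1] at hs
    have hs1 : s ∈ Set.Icc (0 : ℝ) 1 := ⟨hs.1, hs.2.trans t.2.2⟩
    exact ((h ⟨s, hs1⟩).continuousWithinAt).mono
      (by rw [Set.uIcc_of_le t.2.1]; exact Set.Icc_subset_Icc_right t.2.2)
  · intro s hs
    rw [min_eq_left t.2.1, max_eq_right t.2.1] at hs
    have hs1 : s ∈ Set.Icc (0 : ℝ) 1 := ⟨hs.1.le, hs.2.le.trans t.2.2⟩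
    rw [Set.IccExtend_of_mem _ _ hs1]
    exact ((h ⟨s, hs1⟩).mono_of_mem_nhdsWithin (mem_of_superset
      (Ioo_mem_nhdsGT (hs.2.trans_le t.2.2)) fun x hx => ⟨hs.1.le.trans hx.1.le, hx.2.le⟩))

theorem hasDerivWithinAt_add_smul_volterra (x c : ℂ) (g : C(unitInterval, ℂ))
    (t : unitInterval) :
    HasDerivWithinAt (fun s : ℝ => x + c * ∫ s in (0 : ℝ)..s, Set.IccExtend zero_le_one g s)
      (c * g t) (Set.Icc 0 1) t := by
  have hc : Continuous (Set.IccExtend zero_le_one g : ℝ → ℂ) := g.continuous.Icc_extend'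
  have h := (hc.integral_hasStrictDerivAt 0 (t : ℝ)).hasDerivAt
  have h2 := ((h.const_mul c).const_add x).hasDerivWithinAt (s := Set.Icc (0 : ℝ) 1)
  rwa [Set.IccExtend_of_mem _ _ t.2] at h2

end Volterra

/-- Pairing of continuous functions, as a continuous linear map. -/
noncomputable def pairCLM (K X Y : Type*) [TopologicalSpace K] [CompactSpace K]
    [NormedAddCommGroup X] [NormedSpace ℂ X] [NormedAddCommGroup Y] [NormedSpace ℂ Y] :
    C(K, X) × C(K, Y) →L[ℂ] C(K, X × Y) :=
  LinearMap.mkContinuous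
    { toFun := fun g => g.1.prodMk g.2
      map_add' := fun _ _ => rfl
      map_smul' := fun _ _ => rfl } 1 (by
    intro g
    refine (ContinuousMap.norm_le _ (by positivity)).2 fun t => ?_
    rw [one_mul]
    exact max_le ((ContinuousMap.norm_coe_le_norm g.1 t).trans (le_max_left _ _))
      ((ContinuousMap.norm_coe_le_norm g.2 t).trans (le_max_right _ _)))

@[simp] theorem pairCLM_apply {K X Y : Type*} [TopologicalSpace K] [CompactSpace K]
    [NormedAddCommGroup X] [NormedSpace ℂ X] [NormedAddCommGroup Y] [NormedSpace ℂ Y]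
    (g : C(K, X) × C(K, Y)) (t : K) : pairCLM K X Y g t = (g.1 t, g.2 t) := rfl

/-- Constant functions, as a continuous linear map. -/
noncomputable def constCLM (K X : Type*) [TopologicalSpace K] [CompactSpace K]
    [NormedAddCommGroup X] [NormedSpace ℂ X] : X →L[ℂ] C(K, X) :=
  LinearMap.mkContinuous
    { toFun := fun x => ContinuousMap.const K x
      map_add' := fun _ _ => rfl
      map_smul' := fun _ _ => rfl } 1 (by
    intro g
    refine (ContinuousMap.norm_le _ (by positivity)).2 fun t => ?_
    rw [one_mul]
    exact le_refl ‖g‖)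

@[simp] theorem constCLM_apply {K X : Type*} [TopologicalSpace K] [CompactSpace K]
    [NormedAddCommGroup X] [NormedSpace ℂ X] (x : X) (t : K) : constCLM K X x t = x := rfl

/-! ### Analytic dependence of the flow on time, parameter and initial point -/

section Flow

variable {P : Type*} [NormedAddCommGroup P] [NormedSpace ℂ P] [CompleteSpace P]
  {F : P × ℂ → ℂ} {p₀ : P} {x₀ : ℂ}

/-- The complex time τ is turned into a parameter: on [0, 1] the curve solves γ' = τ F(p, γ), that
is y = x + τ ∫ F(p, y). This is an analytic equation in C([0,1]) whose partial derivative in y is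
the identity at τ = 0, so the implicit function theorem gives both the analytic solution and its
local uniqueness. The uniqueness clause is what later yields the group law. -/
theorem exists_solution_family (hF : AnalyticAt ℂ F (p₀, x₀)) :
    ∃ (y : ℂ × P × ℂ → C(unitInterval, ℂ)) (r : ℝ), 0 < r ∧ AnalyticAt ℂ y (0, p₀, x₀) ∧
      y (0, p₀, x₀) = constCLM _ _ x₀ ∧
      (∀ w ∈ Metric.ball ((0 : ℂ), p₀, x₀) r, y w 0 = w.2.2 ∧
        ∀ t : unitInterval, HasDerivWithinAt (Set.IccExtend zero_le_one (y w))
          (w.1 * F (w.2.1, y w t)) (Set.Icc 0 1) t) ∧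
      (∀ w ∈ Metric.ball ((0 : ℂ), p₀, x₀) r, ∀ γ : ℝ → ℂ, γ 0 = w.2.2 →
        (∀ s ∈ Set.Icc (0 : ℝ) 1, dist (γ s) x₀ < r ∧
          HasDerivWithinAt γ (w.1 * F (w.2.1, γ s)) (Set.Icc 0 1) s) →
        ∀ t : unitInterval, γ t = y w t) := by
  obtain ⟨ρ, hρ, hsup⟩ := exists_analyticAt_superposition (K := unitInterval) hF
  let pr : (ℂ × P × ℂ) × C(unitInterval, ℂ) → C(unitInterval, P × ℂ) :=
    fun u => pairCLM _ _ _ (constCLM _ _ u.1.2.1, u.2)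
  let Ψ : (ℂ × P × ℂ) × C(unitInterval, ℂ) → C(unitInterval, ℂ) := fun u =>
    u.2 - constCLM _ _ u.1.2.2 - u.1.1 • volterra (superposition _ F (pr u))
  let u₀ : (ℂ × P × ℂ) × C(unitInterval, ℂ) := ((0, p₀, x₀), constCLM _ _ x₀)
  have hpr : AnalyticAt ℂ pr u₀ := by
    have h1 : AnalyticAt ℂ (fun u : (ℂ × P × ℂ) × C(unitInterval, ℂ) =>
        ((constCLM unitInterval P u.1.2.1, u.2) : C(unitInterval, P) × C(unitInterval, ℂ))) u₀ := by
      refine AnalyticAt.prod ?_ analyticAt_snd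
      exact ((constCLM unitInterval P).analyticAt _).comp
        (analyticAt_fst.comp (analyticAt_snd.comp analyticAt_fst))
    exact ((pairCLM unitInterval P ℂ).analyticAt _).comp h1
  have hsup₀ : AnalyticAt ℂ (superposition unitInterval F) (pr u₀) :=
    (hsup _ (by intro t; simpa [pr, u₀] using hρ)).1
  have hΨ : AnalyticAt ℂ Ψ u₀ := by
    refine (analyticAt_snd.sub ?_).sub ?_
    · exact ((constCLM unitInterval ℂ).analyticAt _).comp
        (analyticAt_snd.comp (analyticAt_snd.comp analyticAt_fst))
    · refine AnalyticAt.smul (analyticAt_fst.comp analyticAt_fst) ?_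
      exact (volterra.analyticAt _).comp (hsup₀.comp hpr)
  have hΨ' : ContDiffAt ℂ ⊤ Ψ u₀ := hΨ.contDiffAt
  have hder : fderiv ℂ Ψ u₀ ∘L .inr ℂ (ℂ × P × ℂ) C(unitInterval, ℂ)
      = ContinuousLinearMap.id ℂ _ := by
    have h1 : HasFDerivAt (fun y => Ψ (u₀.1, y))
        (fderiv ℂ Ψ u₀ ∘L .inr ℂ (ℂ × P × ℂ) C(unitInterval, ℂ)) u₀.2 :=
      HasFDerivAt.comp (f := fun y => (u₀.1, y)) u₀.2
        (hΨ.differentiableAt.hasFDerivAt (x := u₀)) (hasFDerivAt_prodMk_right _ _)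
    have h2 : HasFDerivAt (fun y => Ψ (u₀.1, y)) (ContinuousLinearMap.id ℂ _) u₀.2 := by
      have : (fun y => Ψ (u₀.1, y)) = fun y => y - constCLM _ _ x₀ := by
        ext y t; simp [Ψ, u₀]
      rw [this]
      exact (hasFDerivAt_id _).sub_const _
    exact h1.unique h2
  have hinv : (fderiv ℂ Ψ u₀ ∘L .inr ℂ (ℂ × P × ℂ) C(unitInterval, ℂ)).IsInvertible := by
    rw [hder]; exact ⟨ContinuousLinearEquiv.refl ℂ _, rfl⟩
  have hn : (⊤ : WithTop ℕ∞) ≠ 0 := by simp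
  let y := hΨ'.implicitFunction hn hinv
  have hy : AnalyticAt ℂ y (0, p₀, x₀) := by
    have := (hΨ'.contDiffAt_implicitFunction hn hinv)
    exact this.analyticAt
  have hy₀ : y (0, p₀, x₀) = constCLM _ _ x₀ := hΨ'.implicitFunction_apply_self hn hinv
  have hΨ₀ : Ψ u₀ = 0 := by
    ext t
    simp [Ψ, u₀]
  have hev1 := hΨ'.eventually_apply_implicitFunction hn hinv
  have hev2 := hΨ'.eventually_apply_eq_iff_implicitFunction hn hinv
  rw [hΨ₀] at hev1 hev2
  have hev3 : ∀ᶠ w in 𝓝 ((0 : ℂ), p₀, x₀), dist (y w) (constCLM _ _ x₀) < ρ := by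
    have := hy.continuousAt.tendsto
    rw [hy₀] at this
    exact this (Metric.ball_mem_nhds _ hρ)
  obtain ⟨r1, hr1, H1⟩ := Metric.eventually_nhds_iff.1 (hev1.and hev3)
  obtain ⟨r2, hr2, H2⟩ := Metric.eventually_nhds_iff.1 hev2
  let r := min (min r1 r2) ρ
  have hr : 0 < r := lt_min (lt_min hr1 hr2) hρ
  have hrr1 : r ≤ r1 := (min_le_left _ _).trans (min_le_left _ _)
  have hrr2 : r ≤ r2 := (min_le_left _ _).trans (min_le_right _ _)
  have hrρ : r ≤ ρ := min_le_right _ _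
  have hw : ∀ w ∈ Metric.ball ((0 : ℂ), p₀, x₀) r,
      dist w.1 0 < r ∧ dist w.2.1 p₀ < r ∧ dist w.2.2 x₀ < r := by
    intro w hw
    simpa [Prod.dist_eq] using hw
  refine ⟨y, r, hr, hy, hy₀, ?_, ?_⟩
  · intro w hwr
    obtain ⟨h1, h2⟩ := H1 ((Metric.mem_ball.1 hwr).trans_le hrr1)
    have hsupw : ∀ t, superposition unitInterval F (pr (w, y w)) t = F (w.2.1, y w t) := by
      refine (hsup _ fun t => ?_).2
      rw [Prod.dist_eq]
      exact max_lt ((hw w hwr).2.1.trans_le hrρ)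
        ((ContinuousMap.dist_lt_iff hρ).1 h2 t)
    have heq : ∀ t : unitInterval, y w t = w.2.2 + w.1 *
        ∫ s in (0 : ℝ)..t, Set.IccExtend zero_le_one (superposition _ F (pr (w, y w))) s := by
      intro t
      have h3 : Ψ (w, y w) t = 0 := by
        have h1' : Ψ (w, y w) = 0 := h1
        rw [h1']; rfl
      have h4 : y w t - w.2.2 - w.1 * volterra (superposition _ F (pr (w, y w))) t = 0 := h3
      rw [volterra_apply] at h4
      linear_combination h4
    refine ⟨by simpa using heq 0, fun t => ?_⟩
    have h5 := hasDerivWithinAt_add_smul_volterra w.2.2 w.1 (superposition _ F (pr (w, y w))) t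
    rw [hsupw] at h5
    refine h5.congr_of_mem ?_ t.2
    intro s hs
    rw [Set.IccExtend_of_mem _ _ hs, heq]
  · intro w hwr γ hγ0 hγ t
    have hγc : ContinuousOn γ (Set.Icc 0 1) := fun s hs => (hγ s hs).2.continuousWithinAt
    let g : C(unitInterval, ℂ) := ⟨fun s => γ s, hγc.domRestrict⟩
    have hg : ∀ s, dist (g s) x₀ < r := fun s => (hγ s s.2).1
    have hsupw : ∀ t, superposition unitInterval F (pr (w, g)) t = F (w.2.1, g t) := by
      refine (hsup _ fun t => ?_).2
      rw [Prod.dist_eq]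
      exact max_lt ((hw w hwr).2.1.trans_le hrρ) ((hg t).trans_le hrρ)
    have hd : dist (w, g) u₀ < r2 := by
      rw [Prod.dist_eq]
      refine max_lt ((Metric.mem_ball.1 hwr).trans_le hrr2) ?_
      refine (ContinuousMap.dist_lt_iff hr2).2 fun t => (hg t).trans_le hrr2
    have h0 : Ψ (w, g) = 0 := by
      ext t
      have := eq_add_smul_volterra (γ := γ) (c := w.1) (superposition _ F (pr (w, g)))
        (fun s => by rw [hsupw]; exact (hγ s s.2).2) t
      change γ t - w.2.2 - w.1 * volterra (superposition _ F (pr (w, g))) t = 0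
      rw [this, hγ0]; ring
    have h1 : y w = g := (H2 hd).1 h0
    rw [h1]; rfl

end Flow

section Flow

variable {P : Type*} [NormedAddCommGroup P] [NormedSpace ℂ P] [CompleteSpace P]
  {F : P × ℂ → ℂ} {p₀ : P} {x₀ : ℂ}

/-- The local flow of an analytic family of one-dimensional vector fields. -/
theorem exists_local_flow (hF : AnalyticAt ℂ F (p₀, x₀)) :
    ∃ Φ : ℂ × P × ℂ → ℂ, AnalyticAt ℂ Φ (0, p₀, x₀) ∧
      (∀ᶠ w in 𝓝 ((0 : ℂ), p₀, x₀), Φ (0, w.2) = w.2.2) ∧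
      (∀ᶠ w in 𝓝 ((0 : ℂ), p₀, x₀),
        HasDerivAt (fun τ => Φ (τ, w.2)) (F (w.2.1, Φ w)) w.1) ∧
      (∀ᶠ w in 𝓝 ((0 : ℂ), p₀, x₀),
        deriv (fun x => Φ (w.1, w.2.1, x)) w.2.2 * F w.2 = F (w.2.1, Φ w)) := by
  obtain ⟨y, r, hr, hy, hy₀, hsol, huniq⟩ := exists_solution_family hF
  -- The end point of the rescaled trajectory is the flow at the complex time `w.1`.
  let Φ : ℂ × P × ℂ → ℂ := fun w => y w 1
  have hΦ : AnalyticAt ℂ Φ (0, p₀, x₀) :=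
    ((ContinuousMap.evalCLM ℂ (1 : unitInterval) : C(unitInterval, ℂ) →L[ℂ] ℂ).analyticAt _).comp hy
  have hΦ₀ : Φ (0, p₀, x₀) = x₀ := by simp [Φ, hy₀]
  have hFev : ∀ᶠ q in 𝓝 (p₀, x₀), AnalyticAt ℂ F q := hF.eventually_analyticAt
  have hpΦ : Tendsto (fun w : ℂ × P × ℂ => (w.2.1, Φ w)) (𝓝 (0, p₀, x₀)) (𝓝 (p₀, x₀)) := by
    have h1 : ContinuousAt (fun w : ℂ × P × ℂ => (w.2.1, Φ w)) (0, p₀, x₀) :=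
      (continuous_fst.comp continuous_snd).continuousAt.prodMk hΦ.continuousAt
    simpa [ContinuousAt, hΦ₀] using h1
  -- a common radius
  have hclose : ∀ᶠ w in 𝓝 ((0 : ℂ), p₀, x₀), dist (y w) (constCLM _ _ x₀) < r := by
    have := hy.continuousAt.tendsto
    rw [hy₀] at this
    exact this (Metric.ball_mem_nhds _ hr)
  obtain ⟨r1, hr1, H1⟩ := Metric.eventually_nhds_iff.1
    ((hclose.and hΦ.eventually_analyticAt).and (hpΦ.eventually hFev))
  set ρ := min r r1 with hρdef
  have hρ : 0 < ρ := lt_min hr hr1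
  have Hb : ∀ w : ℂ × P × ℂ, dist w (0, p₀, x₀) < ρ → w ∈ Metric.ball ((0 : ℂ), p₀, x₀) r ∧
      dist (y w) (constCLM _ _ x₀) < r ∧ AnalyticAt ℂ Φ w ∧ AnalyticAt ℂ F (w.2.1, Φ w) :=
    fun w hw => ⟨hw.trans_le (min_le_left _ _), (H1 (hw.trans_le (min_le_right _ _))).1.1,
      (H1 (hw.trans_le (min_le_right _ _))).1.2, (H1 (hw.trans_le (min_le_right _ _))).2⟩
  have hdist : ∀ (τ : ℂ) (q : P × ℂ), dist (τ, q) ((0 : ℂ), p₀, x₀) = max ‖τ‖ (dist q (p₀, x₀)) := by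
    intro τ q; rw [Prod.dist_eq]; simp
  have hzero : ∀ w ∈ Metric.ball ((0 : ℂ), p₀, x₀) r, Φ (0, w.2) = w.2.2 := by
    intro w hw
    have hw' := Metric.mem_ball.1 hw
    rw [show w = (w.1, w.2) from rfl, hdist, max_lt_iff] at hw'
    refine (huniq (0, w.2) ?_ (fun _ => w.2.2) rfl ?_ 1).symm
    · rw [Metric.mem_ball, hdist]; simpa [hr] using hw'.2
    · intro s _
      refine ⟨?_, by simpa using hasDerivWithinAt_const s _ w.2.2⟩
      have := hw'.2
      rw [Prod.dist_eq, max_lt_iff] at this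
      exact this.2
  -- Running the time-τ trajectory up to the fraction t is running the time-tτ trajectory
  -- completely, by uniqueness.
  have hscale : ∀ w, dist w ((0 : ℂ), p₀, x₀) < ρ → ∀ t : unitInterval,
      Φ ((t : ℝ) * w.1, w.2) = y w t := by
    intro w hw t
    obtain ⟨hwr, hyr, -, -⟩ := Hb w hw
    have hw' := hw
    rw [show w = (w.1, w.2) from rfl, hdist, max_lt_iff] at hw'
    have h1 : dist (((t : ℝ) : ℂ) * w.1, w.2) ((0 : ℂ), p₀, x₀) < r := by
      rw [hdist]
      refine max_lt ?_ (hw'.2.trans_le (min_le_left _ _))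
      refine lt_of_le_of_lt ?_ (hw'.1.trans_le (min_le_left _ _))
      rw [norm_mul, Complex.norm_real, Real.norm_of_nonneg t.2.1]
      exact mul_le_of_le_one_left (norm_nonneg _) t.2.2
    have h2 := huniq _ h1 (fun s => Set.IccExtend zero_le_one (y w) ((t : ℝ) * s)) ?_ ?_ 1
    · change y _ 1 = _
      rw [← h2]; simp
    · simpa using (hsol w hwr).1
    · intro s hs
      have hts : (t : ℝ) * s ∈ Set.Icc (0 : ℝ) 1 :=
        ⟨mul_nonneg t.2.1 hs.1, mul_le_one₀ t.2.2 hs.1 hs.2⟩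
      have h3 := (hsol w hwr).2 ⟨_, hts⟩
      refine ⟨?_, ?_⟩
      · rw [Set.IccExtend_of_mem _ _ hts]
        exact (ContinuousMap.dist_lt_iff hr).1 hyr _
      · rw [Set.IccExtend_of_mem _ _ hts]
        have h4 : HasDerivWithinAt (fun s : ℝ => (t : ℝ) * s) (t : ℝ) (Set.Icc 0 1) s := by
          simpa using ((hasDerivAt_id s).const_mul (t : ℝ)).hasDerivWithinAt
        have h5 := h3.scomp s h4 (fun s hs => ⟨mul_nonneg t.2.1 hs.1, mul_le_one₀ t.2.2 hs.1 hs.2⟩)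
        convert! h5 using 1
        simp only [Complex.real_smul]
        ring
  have hslice : ∀ w : ℂ × P × ℂ, AnalyticAt ℂ Φ w → AnalyticAt ℂ (fun τ => Φ (τ, w.2)) w.1 := by
    intro w hw
    exact AnalyticAt.comp_of_eq (f := fun τ : ℂ => (τ, w.2)) hw
      (analyticAt_id.prod analyticAt_const) rfl
  -- `Φ` is analytic in τ, so its complex derivative can be computed along the segment from 0 to τ.
  -- The ODE gives it multiplied by τ, whence the restriction τ ≠ 0; the value at τ = 0 is recovered
  -- afterwards by continuity.
  have hderiv₁ : ∀ w : ℂ × P × ℂ, dist w (0, p₀, x₀) < ρ → w.1 ≠ 0 →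
      HasDerivAt (fun τ => Φ (τ, w.2)) (F (w.2.1, Φ w)) w.1 := by
    intro w hw hw0
    obtain ⟨hwr, hyr, hΦw, -⟩ := Hb w hw
    have h1 := (hslice w hΦw).differentiableAt.hasDerivAt
    have h2 : HasDerivWithinAt (fun s : ℝ => Φ ((s : ℂ) * w.1, w.2))
        (w.1 * deriv (fun τ => Φ (τ, w.2)) w.1) (Set.Icc 0 1) 1 := by
      have h3 : HasDerivAt (fun s : ℝ => (s : ℂ) * w.1) w.1 1 := by
        simpa using (Complex.ofRealCLM.hasDerivAt (x := 1)).mul_const w.1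
      have h4 := HasDerivAt.comp (𝕜 := ℝ) (h₂ := fun τ => Φ (τ, w.2)) (h := fun s : ℝ => (s : ℂ) * w.1)
        (1 : ℝ) (h₂' := deriv (fun τ => Φ (τ, w.2)) w.1) (by simpa using h1) h3
      rw [mul_comm]
      exact h4.hasDerivWithinAt
    have h5 := (hsol w hwr).2 1
    have h6 : HasDerivWithinAt (fun s : ℝ => Φ ((s : ℂ) * w.1, w.2)) (w.1 * F (w.2.1, y w 1))
        (Set.Icc 0 1) 1 := by
      refine h5.congr_of_mem ?_ (by simp)
      intro s hs
      rw [Set.IccExtend_of_mem _ _ hs]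
      exact hscale w hw ⟨s, hs⟩
    have h7 := ((uniqueDiffOn_Icc (zero_lt_one' ℝ)) 1 (by simp)).eq_deriv _ h2 h6
    have h8 := mul_left_cancel₀ hw0 h7
    rw [h8] at h1
    exact h1
  have hderiv : ∀ w : ℂ × P × ℂ, dist w (0, p₀, x₀) < ρ →
      HasDerivAt (fun τ => Φ (τ, w.2)) (F (w.2.1, Φ w)) w.1 := by
    intro w hw
    by_cases hw0 : w.1 = 0
    · obtain ⟨hwr, hyr, hΦw, hFw⟩ := Hb w hw
      have hsl := hslice w hΦw
      have h1 := hsl.differentiableAt.hasDerivAt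
      have hc1 : ContinuousAt (deriv fun τ => Φ (τ, w.2)) w.1 := hsl.deriv.continuousAt
      have hc2 : ContinuousAt (fun τ => F (w.2.1, Φ (τ, w.2))) w.1 := by
        refine ContinuousAt.comp (g := F) (f := fun τ => (w.2.1, Φ (τ, w.2))) hFw.continuousAt ?_
        exact continuousAt_const.prodMk hsl.continuousAt
      have hev : (deriv fun τ => Φ (τ, w.2)) =ᶠ[𝓝[≠] w.1] fun τ => F (w.2.1, Φ (τ, w.2)) := by
        have : ∀ᶠ τ in 𝓝[≠] w.1, dist (τ, w.2) ((0 : ℂ), p₀, x₀) < ρ :=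
          nhdsWithin_le_nhds ((continuous_id.prodMk continuous_const).dist
            continuous_const |>.continuousAt.eventually_lt continuousAt_const hw)
        filter_upwards [this, self_mem_nhdsWithin] with τ h2 h3
        exact (hderiv₁ (τ, w.2) h2 (by simpa [hw0] using h3)).deriv
      have h2 : deriv (fun τ => Φ (τ, w.2)) w.1 = F (w.2.1, Φ w) :=
        tendsto_nhds_unique (hc1.tendsto.mono_left nhdsWithin_le_nhds)
          ((hc2.tendsto.mono_left nhdsWithin_le_nhds).congr' hev.symm)
      rw [h2] at h1
      exact h1
    · exact hderiv₁ w hw hw0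
  have hball : ∀ᶠ w in 𝓝 ((0 : ℂ), p₀, x₀), dist w (0, p₀, x₀) < ρ := Metric.ball_mem_nhds _ hρ
  refine ⟨Φ, hΦ, ?_, ?_, ?_⟩
  · filter_upwards [hball] with w hw using hzero w (Hb w hw).1
  · filter_upwards [hball] with w hw using hderiv w hw
  · have hsm2 : ∀ᶠ q : ℂ × (P × ℂ) in 𝓝 ((0 : ℂ), p₀, x₀), dist (y q) (constCLM _ _ x₀) < r ∧
        dist (Φ q) x₀ < ρ := by
      refine hclose.and ?_
      have := hΦ.continuousAt.tendsto
      rw [hΦ₀] at this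
      exact this (Metric.ball_mem_nhds _ hρ)
    obtain ⟨r3, hr3, H3⟩ := Metric.eventually_nhds_iff.1 hsm2
    have hsm3 : ∀ᶠ w : ℂ × P × ℂ in 𝓝 ((0 : ℂ), p₀, x₀), dist w (0, p₀, x₀) < min ρ r3 / 2 :=
      Metric.ball_mem_nhds _ (by positivity)
    filter_upwards [hsm3] with w hw
    set m := min ρ r3 with hm
    have hm0 : 0 < m := lt_min hρ hr3
    have hmρ : m ≤ ρ := min_le_left _ _
    have hmr : m ≤ r3 := min_le_right _ _
    have hw' := hw
    rw [show w = (w.1, w.2) from rfl, hdist, max_lt_iff] at hw'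
    have hq : ∀ σ : ℂ, ‖σ‖ < m → dist (σ, w.2) ((0 : ℂ), p₀, x₀) < m := by
      intro σ hσ
      rw [hdist]; exact max_lt hσ (by linarith [hw'.2])
    -- Group law, from uniqueness applied to s ↦ Φ(σ + sτ). Differentiating it at σ = 0 in two ways
    -- gives the invariance of the field under its own flow.
    have hgroup : ∀ᶠ σ in 𝓝 (0 : ℂ), Φ (σ + w.1, w.2) = Φ (w.1, w.2.1, Φ (σ, w.2)) := by
      filter_upwards [Metric.ball_mem_nhds (0 : ℂ) (half_pos hm0)] with σ hσ
      rw [mem_ball_zero_iff] at hσ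
      have hστ : ∀ s ∈ Set.Icc (0 : ℝ) 1, ‖σ + s * w.1‖ < m := by
        intro s hs
        have h1 : ‖(s : ℂ) * w.1‖ ≤ ‖w.1‖ := by
          rw [norm_mul, Complex.norm_real, Real.norm_of_nonneg hs.1]
          exact mul_le_of_le_one_left (norm_nonneg _) hs.2
        linarith [norm_add_le σ ((s : ℂ) * w.1), hw'.1]
      have h2 := huniq (w.1, w.2.1, Φ (σ, w.2)) ?_ (fun s => Φ (σ + s * w.1, w.2)) (by simp) ?_ 1
      · rw [← show y (w.1, w.2.1, Φ (σ, w.2)) 1 = Φ (w.1, w.2.1, Φ (σ, w.2)) from rfl, ← h2]; simp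
      · rw [Metric.mem_ball, hdist]
        have h3 := hw'.2
        rw [Prod.dist_eq, max_lt_iff] at h3
        have h4 : ρ ≤ r := min_le_left _ _
        refine max_lt (by linarith [hw'.1]) ?_
        rw [Prod.dist_eq]
        refine max_lt (by linarith [h3.1]) ?_
        exact (H3 ((hq σ (by linarith)).trans_le hmr)).2.trans_le h4
      · intro s hs
        have h5 := hq _ (hστ s hs)
        refine ⟨(H3 (h5.trans_le hmr)).2.trans_le (min_le_left _ _), ?_⟩
        have h6 := hderiv _ (h5.trans_le hmρ)
        have h7 : HasDerivAt (fun s : ℝ => σ + (s : ℂ) * w.1) w.1 s := by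
          simpa using ((Complex.ofRealCLM.hasDerivAt (x := s)).mul_const w.1).const_add σ
        have h8 := HasDerivAt.comp (𝕜 := ℝ) (h₂ := fun τ => Φ (τ, w.2))
          (h := fun s : ℝ => σ + (s : ℂ) * w.1) s h6 h7
        rw [mul_comm]
        exact h8.hasDerivWithinAt
    have hwρ : dist w (0, p₀, x₀) < ρ := by linarith
    have hd1 : HasDerivAt (fun σ : ℂ => Φ (σ + w.1, w.2)) (F (w.2.1, Φ w)) 0 := by
      have := hderiv w hwρ
      have h9 : HasDerivAt (fun σ : ℂ => σ + w.1) 1 0 := (hasDerivAt_id _).add_const _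
      have h10 := HasDerivAt.comp (h₂ := fun τ => Φ (τ, w.2)) (h := fun σ : ℂ => σ + w.1) (0 : ℂ)
        (by simpa using this) h9
      simpa using! h10
    have h0 : Φ (0, w.2) = w.2.2 := hzero w (Hb w hwρ).1
    have hd2 : HasDerivAt (fun σ : ℂ => Φ (w.1, w.2.1, Φ (σ, w.2)))
        (deriv (fun x => Φ (w.1, w.2.1, x)) w.2.2 * F w.2) 0 := by
      have h11 : HasDerivAt (fun σ => Φ (σ, w.2)) (F w.2) 0 := by
        have := hderiv (0, w.2) ((hq 0 (by simpa using hm0)).trans_le hmρ)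
        simpa [h0] using this
      have h12 : AnalyticAt ℂ (fun x => Φ (w.1, w.2.1, x)) w.2.2 :=
        AnalyticAt.comp_of_eq (f := fun x : ℂ => (w.1, w.2.1, x)) (Hb w hwρ).2.2.1
          (analyticAt_const.prod (analyticAt_const.prod analyticAt_id)) rfl
      have h13 := h12.differentiableAt.hasDerivAt
      exact HasDerivAt.comp (h₂ := fun x => Φ (w.1, w.2.1, x)) (h := fun σ => Φ (σ, w.2)) (0 : ℂ)
        (by rw [h0]; exact h13) h11
    exact (hd2.congr_of_eventuallyEq hgroup).unique hd1

end Flow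

/-! ### Primitives of analytic families -/

/-- An analytic family of functions has an analytic family of primitives. -/
theorem exists_analyticAt_primitive {P : Type*} [NormedAddCommGroup P] [NormedSpace ℂ P]
    {f : P × ℂ → ℂ} {p₀ : P} (hf : AnalyticAt ℂ f (p₀, 0)) :
    ∃ Q : P × ℂ → ℂ, AnalyticAt ℂ Q (p₀, 0) ∧ (∀ p, Q (p, 0) = 0) ∧
      ∀ᶠ w in 𝓝 (p₀, (0 : ℂ)), HasDerivAt (fun z => Q (w.1, z)) (f w) w.2 := by
  obtain ⟨ρ, hρ, hsup⟩ := exists_analyticAt_superposition (K := unitInterval) hf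
  let idI : C(unitInterval, ℂ) := ⟨fun t => ((t : ℝ) : ℂ), by fun_prop⟩
  let g : P × ℂ → C(unitInterval, P × ℂ) := fun w => pairCLM _ _ _ (constCLM _ _ w.1, w.2 • idI)
  -- Q(p, z) = z ∫_0^1 f(p, sz) ds: the integral along the segment, written with operators already
  -- known to be analytic.
  let Q : P × ℂ → ℂ := fun w => w.2 * volterra (superposition _ f (g w)) 1
  have hgt : ∀ w t, g w t = (w.1, w.2 * (t : ℝ)) := fun w t => rfl
  have hg : ∀ w, dist w (p₀, 0) < ρ → ∀ t, dist (g w t) (p₀, 0) < ρ := by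
    intro w hw t
    rw [hgt]
    rw [Prod.dist_eq, max_lt_iff] at hw ⊢
    refine ⟨hw.1, lt_of_le_of_lt ?_ hw.2⟩
    simp only [dist_zero_right, norm_mul, Complex.norm_real, Real.norm_of_nonneg t.2.1]
    exact mul_le_of_le_one_right (norm_nonneg _) t.2.2
  refine ⟨Q, ?_, fun p => by simp [Q], ?_⟩
  · refine analyticAt_snd.mul ?_
    have h1 : AnalyticAt ℂ g (p₀, 0) := by
      refine ((pairCLM unitInterval P ℂ).analyticAt _).comp (AnalyticAt.prod ?_ ?_)
      · exact ((constCLM unitInterval P).analyticAt _).comp analyticAt_fst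
      · exact analyticAt_snd.smul analyticAt_const
    have h2 := (hsup (g (p₀, 0)) (hg _ (by simpa using hρ))).1.comp h1
    exact ((ContinuousMap.evalCLM ℂ (1 : unitInterval)).analyticAt _).comp
      ((volterra.analyticAt _).comp h2)
  · obtain ⟨r1, hr1, H1⟩ := Metric.eventually_nhds_iff.1 hf.eventually_analyticAt
    set r := min ρ r1
    have hr : 0 < r := lt_min hρ hr1
    filter_upwards [Metric.ball_mem_nhds (p₀, (0 : ℂ)) hr] with w hw
    rw [Metric.mem_ball, Prod.dist_eq, max_lt_iff] at hw
    have hdiff : DifferentiableOn ℂ (fun z => f (w.1, z)) (Metric.ball 0 r) := by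
      intro z hz
      have : AnalyticAt ℂ f (w.1, z) := H1 (by
        rw [Prod.dist_eq]
        exact max_lt (hw.1.trans_le (min_le_right _ _))
          ((Metric.mem_ball.1 hz).trans_le (min_le_right _ _)))
      exact (AnalyticAt.comp_of_eq (f := fun x : ℂ => (w.1, x)) this
        (analyticAt_const.prod analyticAt_id) rfl).differentiableAt.differentiableWithinAt
    -- For a fixed parameter, a primitive `G` exists on the disk. `Q` is `G - G 0` by integration
    -- along segments, and so inherits its derivative.
    obtain ⟨G, hG⟩ := hdiff.isExactOn_ball
    have hQ : ∀ z ∈ Metric.ball (0 : ℂ) r, Q (w.1, z) = G z - G 0 := by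
      intro z hz
      have hz' : ‖z‖ < r := by simpa using hz
      have h3 : ∀ s ∈ Set.Icc (0 : ℝ) 1, z * s ∈ Metric.ball (0 : ℂ) r := by
        intro s hs
        simp only [mem_ball_zero_iff, norm_mul, Complex.norm_real, Real.norm_of_nonneg hs.1]
        exact lt_of_le_of_lt (mul_le_of_le_one_right (norm_nonneg _) hs.2) hz'
      have h4 := eq_add_smul_volterra (γ := fun s : ℝ => G (z * s)) (c := z)
        (superposition _ f (g (w.1, z))) (fun s => ?_) 1
      · simp only [Set.Icc.coe_one, Complex.ofReal_one, mul_one, Complex.ofReal_zero,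
          mul_zero] at h4
        rw [h4]; simp [Q]
      · rw [(hsup (g (w.1, z)) (hg _ (by
          rw [Prod.dist_eq]
          exact max_lt (hw.1.trans_le (min_le_left _ _)) (by
            simpa using hz'.trans_le (min_le_left _ _))))).2, hgt]
        have h5 := hG _ (h3 s s.2)
        have h6 : HasDerivAt (fun s : ℝ => z * (s : ℂ)) z s := by
          simpa using (Complex.ofRealCLM.hasDerivAt (x := (s : ℝ))).const_mul z
        rw [mul_comm]
        exact (HasDerivAt.comp (𝕜 := ℝ) (h₂ := G) (s : ℝ) h5 h6).hasDerivWithinAt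
    have hw2 : w.2 ∈ Metric.ball (0 : ℂ) r := hw.2
    refine ((hG _ hw2).sub_const (G 0)).congr_of_eventuallyEq ?_
    filter_upwards [Metric.isOpen_ball.mem_nhds hw2] with z hz using hQ z hz

/-! ### Residues, moments and Cauchy transforms on the unit circle -/

/-- Continuous functions on the unit circle. -/
abbrev CircleFun := C(Metric.sphere (0 : ℂ) 1, ℂ)

/-- The inclusion of the unit circle in the plane. -/
def circleId : CircleFun := ⟨Subtype.val, continuous_subtype_val⟩

@[simp] theorem circleId_apply (ζ : Metric.sphere (0 : ℂ) 1) : circleId ζ = ζ := rfl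

theorem norm_coe_circle (ζ : Metric.sphere (0 : ℂ) 1) : ‖(ζ : ℂ)‖ = 1 := mem_sphere_zero_iff_norm.1 ζ.2

theorem coe_circle_ne_zero (ζ : Metric.sphere (0 : ℂ) 1) : (ζ : ℂ) ≠ 0 := by
  rw [← norm_pos_iff, norm_coe_circle]; exact one_pos

/-- The parametrization of the unit circle by the angle. -/
noncomputable def circlePoint (θ : ℝ) : Metric.sphere (0 : ℂ) 1 :=
  ⟨circleMap 0 1 θ, by simp⟩

theorem continuous_circlePoint : Continuous circlePoint :=
  (continuous_circleMap 0 1).subtype_mk _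

/-- The functional `f ↦ (2πi)⁻¹ ∮ f(ζ) dζ` on the unit circle. -/
noncomputable def circleResidue : CircleFun →L[ℂ] ℂ :=
  LinearMap.mkContinuous
    { toFun := fun f => (2 * Real.pi : ℂ)⁻¹ *
        ∫ θ in (0 : ℝ)..2 * Real.pi, circleMap 0 1 θ * f (circlePoint θ)
      map_add' := by
        intro f g
        have hf : ∀ f : CircleFun, IntervalIntegrable
            (fun θ => circleMap 0 1 θ * f (circlePoint θ)) MeasureTheory.volume 0 (2 * Real.pi) :=
          fun f => ((continuous_circleMap 0 1).mul
            (f.continuous.comp continuous_circlePoint)).intervalIntegrable _ _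
        rw [← mul_add, ← intervalIntegral.integral_add (hf f) (hf g)]
        simp [mul_add]
      map_smul' := by
        intro c f
        simp only [ContinuousMap.coe_smul, Pi.smul_apply, smul_eq_mul, RingHom.id_apply]
        have h : (fun θ => circleMap 0 1 θ * (c * f (circlePoint θ)))
            = fun θ => c * (circleMap 0 1 θ * f (circlePoint θ)) := by
          funext θ; ring
        rw [h, intervalIntegral.integral_const_mul]
        ring } 1 (by
    intro f
    have h1 := intervalIntegral.norm_integral_le_of_norm_le_const (a := 0) (b := 2 * Real.pi)
      (f := fun θ => circleMap 0 1 θ * f (circlePoint θ)) (C := ‖f‖)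
      (fun θ _ => by
        rw [norm_mul, norm_circleMap_zero, abs_one, one_mul]
        exact ContinuousMap.norm_coe_le_norm f _)
    have hpi : (0 : ℝ) < 2 * Real.pi := by positivity
    rw [sub_zero, abs_of_pos hpi] at h1
    change ‖(2 * Real.pi : ℂ)⁻¹ * _‖ ≤ _
    rw [norm_mul, one_mul]
    have h2 : ‖(2 * Real.pi : ℂ)⁻¹‖ = (2 * Real.pi)⁻¹ := by
      rw [norm_inv, show (2 * Real.pi : ℂ) = ((2 * Real.pi : ℝ) : ℂ) by push_cast; rfl,
        Complex.norm_real, Real.norm_of_nonneg hpi.le]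
    rw [h2, inv_mul_le_iff₀ hpi, mul_comm (2 * Real.pi)]
    exact h1)

theorem norm_circleResidue_le (f : CircleFun) : ‖circleResidue f‖ ≤ ‖f‖ := by
  have := circleResidue.le_of_opNorm_le (LinearMap.mkContinuous_norm_le _ zero_le_one _) f
  simpa using this

theorem circleResidue_eq {f : CircleFun} {g : ℂ → ℂ} (h : ∀ ζ, f ζ = g ζ) :
    circleResidue f = (2 * Real.pi * Complex.I)⁻¹ * ∮ z in C(0, 1), g z := by
  change (2 * Real.pi : ℂ)⁻¹ * _ = _
  have h1 : ∀ θ : ℝ, deriv (circleMap 0 1) θ • g (circleMap 0 1 θ)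
      = Complex.I * (circleMap 0 1 θ * f (circlePoint θ)) := by
    intro θ
    rw [h, deriv_circleMap]
    simp only [circlePoint, smul_eq_mul]
    ring
  rw [circleIntegral]
  simp_rw [h1]
  rw [intervalIntegral.integral_const_mul, mul_inv]
  field_simp

theorem circleResidue_eq_zero {f : CircleFun} {g : ℂ → ℂ} (h : ∀ ζ, f ζ = g ζ)
    (hg : DiffContOnCl ℂ g (Metric.ball 0 1)) : circleResidue f = 0 := by
  rw [circleResidue_eq h, hg.circleIntegral_eq_zero zero_le_one, mul_zero]

theorem circleResidue_cauchy {f : CircleFun} {g : ℂ → ℂ} {z : ℂ} (hz : ‖z‖ < 1)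
    (h : ∀ ζ : Metric.sphere (0 : ℂ) 1, f ζ = ((ζ : ℂ) - z)⁻¹ * g ζ)
    (hg : DiffContOnCl ℂ g (Metric.ball 0 1)) : circleResidue f = g z := by
  rw [circleResidue_eq (g := fun ζ => (ζ - z)⁻¹ • g ζ) h]
  have := hg.two_pi_i_inv_smul_circleIntegral_sub_inv_smul (w := z) (by simpa using hz)
  simpa using this

theorem circleFun_isUnit {f : CircleFun} (h : ∀ ζ, f ζ ≠ 0) : IsUnit f :=
  (ContinuousMap.isUnit_iff_forall_ne_zero f).2 h

theorem circleFun_inverse_apply {f : CircleFun} (h : ∀ ζ, f ζ ≠ 0)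
    (ζ : Metric.sphere (0 : ℂ) 1) : Ring.inverse f ζ = (f ζ)⁻¹ := by
  have h1 : f * Ring.inverse f = 1 := Ring.mul_inverse_cancel _ (circleFun_isUnit h)
  have h2 := congrArg (fun g : CircleFun => g ζ) h1
  simp only [ContinuousMap.mul_apply, ContinuousMap.one_apply] at h2
  exact eq_inv_of_mul_eq_one_right h2

theorem circleId_isUnit : IsUnit circleId := circleFun_isUnit coe_circle_ne_zero

theorem norm_circleId_pow_le (n : ℕ) : ‖circleId ^ n‖ ≤ 1 := by
  refine (ContinuousMap.norm_le _ zero_le_one).2 fun ζ => ?_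
  simp

theorem diffContOnCl_of_differentiableOn {g : ℂ → ℂ}
    (hg : DifferentiableOn ℂ g (Metric.ball 0 2)) : DiffContOnCl ℂ g (Metric.ball 0 1) := by
  refine DifferentiableOn.diffContOnCl_ball (U := Metric.ball 0 2) hg ?_
  exact Metric.closedBall_subset_ball (by norm_num)

/-- The Taylor expansion of a function holomorphic on a disk of radius `2` converges on the
unit circle. -/
theorem exists_hasSum_circle {K : ℂ → ℂ} (hK : DifferentiableOn ℂ K (Metric.ball 0 2))
    {f : CircleFun} (hf : ∀ ζ, f ζ = K ζ) {M : ℝ}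
    (hM : ∀ z ∈ Metric.sphere (0 : ℂ) (3 / 2), ‖K z‖ ≤ M) :
    ∃ a : ℕ → ℂ, HasSum (fun n => a n • circleId ^ n) f ∧ ∀ n, ‖a n‖ ≤ M * (2 / 3) ^ n := by
  let a : ℕ → ℂ := fun n => (n.factorial : ℂ)⁻¹ * iteratedDeriv n K 0
  have ha : ∀ n, ‖a n‖ ≤ M * (2 / 3) ^ n := by
    intro n
    have h1 := Complex.norm_iteratedDeriv_le_of_forall_mem_sphere_norm_le (c := (0 : ℂ))
      (R := 3 / 2) (C := M) (f := K) n (by norm_num)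
      (DifferentiableOn.diffContOnCl_ball hK (Metric.closedBall_subset_ball (by norm_num))) hM
    simp only [a, norm_mul, norm_inv, Complex.norm_natCast]
    have hfac : (0 : ℝ) < n.factorial := by exact_mod_cast n.factorial_pos
    rw [inv_mul_le_iff₀ hfac]
    refine h1.trans (le_of_eq ?_)
    rw [div_eq_mul_inv, ← inv_pow, show ((3 : ℝ) / 2)⁻¹ = 2 / 3 by norm_num]
    ring
  refine ⟨a, ?_, ha⟩
  have hs : Summable fun n => a n • circleId ^ n := by
    refine Summable.of_norm_bounded (g := fun n => M * (2 / 3) ^ n)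
      ((summable_geometric_of_lt_one (by norm_num) (by norm_num)).mul_left M) fun n => ?_
    rw [norm_smul]
    exact (mul_le_of_le_one_right (norm_nonneg _) (norm_circleId_pow_le n)).trans (ha n)
  convert hs.hasSum using 1
  ext ζ
  have h1 : HasSum (fun n => (a n • circleId ^ n) ζ) ((∑' n, a n • circleId ^ n) ζ) :=
    hs.hasSum.mapL (ContinuousMap.evalCLM ℂ ζ : CircleFun →L[ℂ] ℂ)
  have h2 := Complex.hasSum_taylorSeries_on_ball (f := K) (c := 0) (r := 2) hK (z := ζ)
    (by rw [mem_ball_zero_iff, norm_coe_circle]; norm_num)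
  rw [hf]
  have h3 : (fun n => (a n • circleId ^ n) ζ)
      = fun n => (n.factorial : ℂ)⁻¹ • ((ζ : ℂ) - 0) ^ n • iteratedDeriv n K 0 := by
    ext n
    simp [a]
    ring
  rw [h3] at h1
  exact h2.unique h1

/-- A function whose low order moments vanish and which becomes holomorphic after multiplication
by a function close to `z ^ n₀` has only vanishing moments. -/
theorem circleResidue_pow_mul_eq_zero {D : CircleFun} {H N : ℂ → ℂ} {n₀ : ℕ}
    (hH : DifferentiableOn ℂ H (Metric.ball 0 2)) (hN : DifferentiableOn ℂ N (Metric.ball 0 2))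
    (hD : ∀ ζ, D ζ * H ζ = N ζ)
    (hclose : ∀ z ∈ Metric.sphere (0 : ℂ) (3 / 2), ‖H z - z ^ n₀‖ ≤ 1 / 4)
    (hm : ∀ n < n₀, circleResidue (circleId ^ n * D) = 0) (n : ℕ) :
    circleResidue (circleId ^ n * D) = 0 := by
  have hHc : ContinuousOn H (Metric.sphere 0 1) :=
    hH.continuousOn.mono fun z hz => by
      rw [mem_sphere_zero_iff_norm] at hz; rw [mem_ball_zero_iff, hz]; norm_num
  let G : CircleFun := ⟨fun ζ => H ζ - (ζ : ℂ) ^ n₀, by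
    have : Continuous fun ζ : Metric.sphere (0 : ℂ) 1 => H ζ := hHc.domRestrict
    exact this.sub (by fun_prop)⟩
  -- Being at most 1/4 on the circle of radius 3/2, H - z^n₀ has Taylor coefficients at most
  -- (1/4)(2/3)^n.
  obtain ⟨a, ha, hab⟩ := exists_hasSum_circle (K := fun z => H z - z ^ n₀)
    (hH.sub (by fun_prop)) (f := G) (fun _ => rfl) hclose
  -- The integral of ζ^j D H = ζ^j N vanishes by Cauchy. Expanding H around z^n₀ expresses the
  -- moment of order j + n₀ through all moments of order at least j.
  have hrec : ∀ j, circleResidue (circleId ^ (j + n₀) * D)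
      = -∑' n, a n * circleResidue (circleId ^ (j + n) * D) := by
    intro j
    have h1 : HasSum (fun n => a n * circleResidue (circleId ^ (j + n) * D))
        (circleResidue (circleId ^ j * D * G)) := by
      have h2 := (ha.mul_left (circleId ^ j * D)).mapL circleResidue
      convert h2 using 2 with n
      rw [mul_smul_comm, map_smul, smul_eq_mul, pow_add, mul_right_comm]
    rw [h1.tsum_eq]
    have h3 : circleResidue (circleId ^ (j + n₀) * D + circleId ^ j * D * G) = 0 := by
      refine circleResidue_eq_zero (g := fun z => z ^ j * N z) ?_ ?_
      · intro ζ
        have : G ζ = H ζ - (ζ : ℂ) ^ n₀ := rfl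
        simp only [ContinuousMap.add_apply, ContinuousMap.mul_apply, ContinuousMap.pow_apply,
          circleId_apply, this, ← hD, pow_add]
        ring
      · exact diffContOnCl_of_differentiableOn (DifferentiableOn.mul (by fun_prop) hN)
    rw [map_add] at h3
    exact eq_neg_of_add_eq_zero_left h3
  -- Contraction: since (1/4) Σ (2/3)^n = 3/4, each use of the recursion improves a bound valid for
  -- all moments by the factor 3/4. Moments of order below n₀ are zero by hypothesis.
  have hbound : ∀ i : ℕ, ∀ n, ‖circleResidue (circleId ^ n * D)‖ ≤ (3 / 4) ^ i * ‖D‖ := by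
    intro i
    induction i with
    | zero =>
      intro n
      rw [pow_zero, one_mul]
      refine (norm_circleResidue_le _).trans ((norm_mul_le _ _).trans ?_)
      exact mul_le_of_le_one_left (norm_nonneg _) (norm_circleId_pow_le n)
    | succ i ih =>
      intro n
      rcases lt_or_ge n n₀ with h | h
      · rw [hm n h, norm_zero]; positivity
      · obtain ⟨j, rfl⟩ := Nat.exists_eq_add_of_le' h
        rw [hrec, norm_neg]
        have hg : HasSum (fun n : ℕ => 1 / 4 * (2 / 3 : ℝ) ^ n * ((3 / 4) ^ i * ‖D‖))
            ((3 / 4) ^ (i + 1) * ‖D‖) := by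
          have := ((hasSum_geometric_of_lt_one (r := (2 / 3 : ℝ)) (by norm_num)
            (by norm_num)).mul_left (1 / 4)).mul_right ((3 / 4) ^ i * ‖D‖)
          have e : (3 / 4 : ℝ) ^ (i + 1) * ‖D‖
              = 1 / 4 * (1 - 2 / 3)⁻¹ * ((3 / 4) ^ i * ‖D‖) := by
            rw [show (1 - 2 / 3 : ℝ)⁻¹ = 3 by norm_num]
            ring
          rw [e]
          exact this
        refine tsum_of_norm_bounded hg fun n => ?_
        rw [norm_mul]
        gcongr
        · exact hab n
        · exact ih _
  have hlim : Tendsto (fun i : ℕ => (3 / 4 : ℝ) ^ i * ‖D‖) atTop (𝓝 0) := by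
    simpa using (tendsto_pow_atTop_nhds_zero_of_lt_one (r := (3 / 4 : ℝ)) (by norm_num)
      (by norm_num)).mul_const ‖D‖
  have := ge_of_tendsto' hlim fun i => hbound i n
  simpa using this

/-- The Cauchy transform of a function on the circle. -/
noncomputable def cauchyTransform (D : CircleFun) (z : ℂ) : ℂ :=
  circleResidue (D * Ring.inverse (circleId - constCLM _ _ z))

theorem circleId_sub_ne_zero {z : ℂ} (hz : ‖z‖ < 1) (ζ : Metric.sphere (0 : ℂ) 1) :
    (circleId - constCLM _ ℂ z : CircleFun) ζ ≠ 0 := by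
  intro h
  have h1 : (ζ : ℂ) = z := sub_eq_zero.1 h
  rw [← h1, norm_coe_circle] at hz
  exact lt_irrefl _ hz

/-- Write H(ζ) = H(z) + (ζ - z) K(ζ). Then H(z) D/(ζ - z) + K D = N/(ζ - z), whose residue is N(z)
by Cauchy. The term K D contributes nothing, because K is a power series on the circle and all
moments of D vanish. Thus the Cauchy transform solves H q = N in the disk and plays the role of a
holomorphic extension of D. -/
theorem mul_cauchyTransform {D : CircleFun} {H N : ℂ → ℂ} 
    (hH : DifferentiableOn ℂ H (Metric.ball 0 2)) (hN : DifferentiableOn ℂ N (Metric.ball 0 2))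
    (hD : ∀ ζ, D ζ * H ζ = N ζ) (hm : ∀ n, circleResidue (circleId ^ n * D) = 0)
    {z : ℂ} (hz : ‖z‖ < 1) : H z * cauchyTransform D z = N z := by
  have hzb : Metric.ball (0 : ℂ) 2 ∈ 𝓝 z :=
    Metric.isOpen_ball.mem_nhds (by rw [mem_ball_zero_iff]; linarith)
  have hK : DifferentiableOn ℂ (dslope H z) (Metric.ball 0 2) :=
    (Complex.differentiableOn_dslope hzb).2 hH
  have hKc : ContinuousOn (dslope H z) (Metric.sphere 0 1) :=
    hK.continuousOn.mono fun z hz => by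
      rw [mem_sphere_zero_iff_norm] at hz; rw [mem_ball_zero_iff, hz]; norm_num
  let K : CircleFun := ⟨fun ζ => dslope H z ζ, hKc.domRestrict⟩
  obtain ⟨M, hM⟩ := (isCompact_sphere (0 : ℂ) (3 / 2)).exists_bound_of_continuousOn
    (hK.continuousOn.mono (s := Metric.ball 0 2) fun z hz => by
      rw [mem_sphere_zero_iff_norm] at hz; rw [mem_ball_zero_iff, hz]; norm_num)
  obtain ⟨a, ha, -⟩ := exists_hasSum_circle hK (f := K) (fun _ => rfl) hM
  have h1 : circleResidue (K * D) = 0 := by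
    have h2 := (ha.mul_right D).mapL circleResidue
    refine h2.unique ?_
    convert hasSum_zero using 2 with n
    rw [smul_mul_assoc, map_smul, hm, smul_zero]
  have h4 : circleResidue (K * D + H z • (D * Ring.inverse (circleId - constCLM _ _ z))) = N z := by
    refine circleResidue_cauchy (g := N) hz ?_ (diffContOnCl_of_differentiableOn hN)
    intro ζ
    have h5 := circleId_sub_ne_zero hz ζ
    have h6 : (ζ : ℂ) - z ≠ 0 := h5
    have h7 : K ζ = ((ζ : ℂ) - z)⁻¹ * (H ζ - H z) := by
      change dslope H z ζ = _
      rw [dslope_of_ne _ (sub_ne_zero.1 h6), slope_def_field]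
      ring
    simp only [ContinuousMap.add_apply, ContinuousMap.mul_apply, ContinuousMap.smul_apply,
      smul_eq_mul, circleFun_inverse_apply (circleId_sub_ne_zero hz), h7, ← hD]
    simp only [ContinuousMap.sub_apply, circleId_apply, constCLM_apply]
    ring
  rw [map_add, h1, zero_add, map_smul, smul_eq_mul] at h4
  exact h4

theorem analyticAt_ringInverse {f : CircleFun} (h : ∀ ζ, f ζ ≠ 0) :
    AnalyticAt ℂ Ring.inverse f := by
  obtain ⟨u, rfl⟩ := circleFun_isUnit h
  exact analyticAt_inverse u

theorem analyticAt_cauchyTransform (D : CircleFun) {z : ℂ} (hz : ‖z‖ < 1) :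
    AnalyticAt ℂ (fun w : CircleFun × ℂ => cauchyTransform w.1 w.2) (D, z) := by
  refine (circleResidue.analyticAt _).comp (analyticAt_fst.mul ?_)
  refine AnalyticAt.comp (g := Ring.inverse)
    (f := fun w : CircleFun × ℂ => circleId - constCLM _ _ w.2)
    (analyticAt_ringInverse (circleId_sub_ne_zero hz)) ?_
  exact analyticAt_const.sub (((constCLM (Metric.sphere (0 : ℂ) 1) ℂ).analyticAt _).comp analyticAt_snd)

/-- The moments of `ζ ^ (-m - 1)`. -/
theorem circleResidue_pow_mul_inverse (n m : ℕ) :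
    circleResidue (circleId ^ n * Ring.inverse circleId ^ (m + 1)) = if n = m then 1 else 0 := by
  have h1 : ∀ ζ : Metric.sphere (0 : ℂ) 1, (circleId ^ n * Ring.inverse circleId ^ (m + 1)) ζ
      = ((ζ : ℂ) - 0) ^ ((n : ℤ) - m - 1) := by
    intro ζ
    have := coe_circle_ne_zero ζ
    simp only [ContinuousMap.mul_apply, ContinuousMap.pow_apply,
      circleFun_inverse_apply (f := circleId) coe_circle_ne_zero, circleId_apply, sub_zero]
    rw [show (n : ℤ) - m - 1 = n - (m + 1 : ℕ) by push_cast; ring, zpow_sub₀ this, zpow_natCast,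
      zpow_natCast, div_eq_mul_inv, inv_pow]
  rw [circleResidue_eq (g := fun z => (z - 0) ^ ((n : ℤ) - m - 1)) h1]
  split_ifs with h
  · subst h
    rw [show (n : ℤ) - n - 1 = -1 by ring]
    simp only [zpow_neg_one]
    rw [circleIntegral.integral_sub_center_inv _ one_ne_zero]
    exact inv_mul_cancel₀ Complex.two_pi_I_ne_zero
  · rw [circleIntegral.integral_sub_zpow_of_ne (by omega), mul_zero]

/-! ### Dual forms of the normal forms and their moments -/

section Algebra
variable {R : Type*} [CommRing R] [Algebra ℂ R] {k : ℕ}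

/-- The polynomial `x ^ (k + 1) + ∑ b_j x ^ j` in a complex algebra. -/
noncomputable def nfPolyAlg (b : Fin k → ℂ) (x : R) : R := x ^ (k + 1) + ∑ j, b j • x ^ (j : ℕ)

/-- The polynomial deformation `x + ∑ u_j x ^ j` of the identity. -/
noncomputable def idPoly (u : Fin (k + 1) → ℂ) (x : R) : R := x + ∑ j, u j • x ^ (j : ℕ)

/-- The derivative of `idPoly u`. -/
noncomputable def idPolyDeriv (u : Fin (k + 1) → ℂ) (x : R) : R :=
  1 + ∑ j, u j • (((j : ℕ) : ℂ) • x ^ ((j : ℕ) - 1))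

end Algebra

theorem nfPolyAlg_eq {k : ℕ} (b : Fin k → ℂ) (z : ℂ) : nfPolyAlg b z = nfPoly b z := by
  simp [nfPolyAlg, nfPoly]

/-- The parameters: coefficients `u` of a deformation of the identity, and coefficients `b, A`
of a normal form. -/
abbrev NFParam (k : ℕ) := (Fin (k + 1) → ℂ) × (Fin k → ℂ) × ℂ

/-- The form `g_u^* (1 + A z ^ k) dz / P_b(z)` with `g_u = idPoly u`, restricted to the unit
circle. -/
noncomputable def pulledForm {k : ℕ} (p : NFParam k) : CircleFun :=
  idPolyDeriv p.1 circleId * (1 + p.2.2 • idPoly p.1 circleId ^ k) *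
    Ring.inverse (nfPolyAlg p.2.1 (idPoly p.1 circleId))

/-- The first `n` moments on the unit circle. -/
noncomputable def moments (n : ℕ) : CircleFun →L[ℂ] (Fin n → ℂ) :=
  ContinuousLinearMap.pi fun i =>
    circleResidue ∘L (ContinuousLinearMap.mul ℂ CircleFun (circleId ^ (i : ℕ)))

@[simp] theorem moments_apply (n : ℕ) (f : CircleFun) (i : Fin n) :
    moments n f i = circleResidue (circleId ^ (i : ℕ) * f) := rfl

section Analytic
variable {E R : Type*} [NormedAddCommGroup E] [NormedSpace ℂ E] [NormedCommRing R]
  [NormedAlgebra ℂ R] {k : ℕ} {e : E}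

theorem AnalyticAt.nfPolyAlg {b : E → Fin k → ℂ} {x : E → R} (hb : AnalyticAt ℂ b e)
    (hx : AnalyticAt ℂ x e) : AnalyticAt ℂ (fun e => nfPolyAlg (b e) (x e)) e := by
  have hb' : ∀ j, AnalyticAt ℂ (fun e => b e j) e := fun j =>
    ((ContinuousLinearMap.proj (R := ℂ) (φ := fun _ : Fin k => ℂ) j).analyticAt _).comp hb
  exact (hx.pow _).add (Finset.analyticAt_fun_sum _ fun j _ => (hb' j).smul (hx.pow _))

theorem AnalyticAt.idPoly {b : E → Fin (k + 1) → ℂ} {x : E → R} (hb : AnalyticAt ℂ b e)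
    (hx : AnalyticAt ℂ x e) : AnalyticAt ℂ (fun e => idPoly (b e) (x e)) e := by
  have hb' : ∀ j, AnalyticAt ℂ (fun e => b e j) e := fun j =>
    ((ContinuousLinearMap.proj (R := ℂ) (φ := fun _ : Fin (k + 1) => ℂ) j).analyticAt _).comp hb
  exact hx.add (Finset.analyticAt_fun_sum _ fun j _ => (hb' j).smul (hx.pow _))

theorem AnalyticAt.idPolyDeriv {b : E → Fin (k + 1) → ℂ} {x : E → R} (hb : AnalyticAt ℂ b e)
    (hx : AnalyticAt ℂ x e) : AnalyticAt ℂ (fun e => idPolyDeriv (b e) (x e)) e := by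
  have hb' : ∀ j, AnalyticAt ℂ (fun e => b e j) e := fun j =>
    ((ContinuousLinearMap.proj (R := ℂ) (φ := fun _ : Fin (k + 1) => ℂ) j).analyticAt _).comp hb
  exact analyticAt_const.add (Finset.analyticAt_fun_sum _ fun j _ =>
    (hb' j).smul (AnalyticAt.fun_const_smul (hx.pow _)))

end Analytic

theorem idPoly_zero {k : ℕ} {R : Type*} [CommRing R] [Algebra ℂ R] (x : R) :
    idPoly (0 : Fin (k + 1) → ℂ) x = x := by simp [idPoly]

theorem idPolyDeriv_zero {k : ℕ} {R : Type*} [CommRing R] [Algebra ℂ R] (x : R) :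
    idPolyDeriv (0 : Fin (k + 1) → ℂ) x = 1 := by simp [idPolyDeriv]

theorem nfPolyAlg_zero {k : ℕ} {R : Type*} [CommRing R] [Algebra ℂ R] (x : R) :
    nfPolyAlg (0 : Fin k → ℂ) x = x ^ (k + 1) := by simp [nfPolyAlg]

theorem circleId_pow_ne_zero (n : ℕ) (ζ : Metric.sphere (0 : ℂ) 1) : (circleId ^ n) ζ ≠ 0 :=
  pow_ne_zero n (coe_circle_ne_zero ζ)

theorem pulledForm_zero {k : ℕ} : pulledForm (0 : NFParam k) = Ring.inverse (circleId ^ (k + 1)) := by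
  simp [pulledForm, idPoly_zero, idPolyDeriv_zero, nfPolyAlg_zero]

theorem analyticAt_pulledForm (k : ℕ) : AnalyticAt ℂ (pulledForm (k := k)) 0 := by
  have hg : AnalyticAt ℂ (fun p : NFParam k => idPoly p.1 circleId) 0 :=
    AnalyticAt.idPoly analyticAt_fst analyticAt_const
  have hA : AnalyticAt ℂ (fun p : NFParam k => p.2.2) 0 := analyticAt_snd.comp analyticAt_snd
  have hb : AnalyticAt ℂ (fun p : NFParam k => p.2.1) 0 := analyticAt_fst.comp analyticAt_snd
  refine ((AnalyticAt.idPolyDeriv analyticAt_fst analyticAt_const).mul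
    (analyticAt_const.add (hA.smul (hg.pow k)))).mul ?_
  refine AnalyticAt.comp (g := Ring.inverse)
    (f := fun p : NFParam k => nfPolyAlg p.2.1 (idPoly p.1 circleId)) (analyticAt_ringInverse ?_)
    (AnalyticAt.nfPolyAlg hb hg)
  intro ζ
  simpa [idPoly_zero, nfPolyAlg_zero] using coe_circle_ne_zero ζ

/-- The derivative of `pulledForm` at the origin. -/
theorem hasDerivAt_pulledForm {k : ℕ} (x : NFParam k) :
    HasDerivAt (fun t : ℂ => pulledForm (t • x))
      (∑ j : Fin (k + 1), ((((j : ℕ) : ℂ) - (k + 1)) * x.1 j) •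
          Ring.inverse circleId ^ (k + 1 - (j : ℕ) + 1)
        + x.2.2 • Ring.inverse circleId ^ (0 + 1)
        - ∑ j : Fin k, x.2.1 j • Ring.inverse circleId ^ (2 * k + 1 - (j : ℕ) + 1)) 0 := by
  obtain ⟨v, c, a⟩ := x
  set I := Ring.inverse circleId with hI
  have hmulI : circleId * I = 1 := Ring.mul_inverse_cancel _ circleId_isUnit
  set V : CircleFun := ∑ j, v j • circleId ^ (j : ℕ) with hV
  set V' : CircleFun := ∑ j, v j • (((j : ℕ) : ℂ) • circleId ^ ((j : ℕ) - 1)) with hV'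
  have hg : HasDerivAt (fun t : ℂ => idPoly (t • v) circleId) V 0 := by
    have h1 : (fun t : ℂ => idPoly (t • v) circleId) = fun t : ℂ => circleId + t • V := by
      funext t; simp [idPoly, hV, Finset.smul_sum, mul_smul]
    rw [h1]
    simpa using ((hasDerivAt_id (0 : ℂ)).smul_const V).const_add circleId
  have hg' : HasDerivAt (fun t : ℂ => idPolyDeriv (t • v) circleId) V' 0 := by
    have h1 : (fun t : ℂ => idPolyDeriv (t • v) circleId) = fun t : ℂ => 1 + t • V' := by
      funext t; simp [idPolyDeriv, hV', Finset.smul_sum, mul_smul]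
    rw [h1]
    simpa using ((hasDerivAt_id (0 : ℂ)).smul_const V').const_add (1 : CircleFun)
  have hg0 : idPoly ((0 : ℂ) • v) circleId = circleId := by simp [idPoly_zero]
  have hg0' : idPolyDeriv ((0 : ℂ) • v) circleId = 1 := by simp [idPolyDeriv_zero]
  have hA : HasDerivAt (fun t : ℂ => (1 : CircleFun) + (t • a) • idPoly (t • v) circleId ^ k)
      (a • circleId ^ k) 0 := by
    have h2 := (((hasDerivAt_id (0 : ℂ)).smul_const a).smul (hg.pow k)).const_add (1 : CircleFun)
    simpa [idPoly_zero, Pi.pow_def] using! h2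
  have hP : HasDerivAt (fun t : ℂ => nfPolyAlg (t • c) (idPoly (t • v) circleId))
      ((k + 1 : ℂ) • (circleId ^ k * V) + ∑ j, c j • circleId ^ (j : ℕ)) 0 := by
    have h3 := hg.pow (k + 1)
    have h4 : ∀ j ∈ (Finset.univ : Finset (Fin k)),
        HasDerivAt (fun t : ℂ => (t • c) j • idPoly (t • v) circleId ^ (j : ℕ))
          (c j • circleId ^ (j : ℕ)) 0 := by
      intro j _
      have h5 := ((hasDerivAt_id (0 : ℂ)).smul_const (c j)).fun_smul (hg.fun_pow (j : ℕ))
      simpa [idPoly_zero] using! h5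
    have h6 := h3.add (HasDerivAt.fun_sum h4)
    convert! h6 using 1
    rw [hg0]
    congr 1
    rw [Nat.add_sub_cancel]
    ext ζ
    simp
    ring
  have hP0 : nfPolyAlg ((0 : ℂ) • c) (idPoly ((0 : ℂ) • v) circleId) = circleId ^ (k + 1) := by
    rw [hg0, zero_smul, nfPolyAlg_zero]
  have hinvu : Ring.inverse (circleId ^ (k + 1)) = I ^ (k + 1) := by
    rw [hI, Ring.inverse_pow]
  obtain ⟨w, hw⟩ := circleId_isUnit.pow (k + 1)
  have hwinv : ((w⁻¹ : CircleFunˣ) : CircleFun) = I ^ (k + 1) := by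
    rw [← hinvu, ← hw, Ring.inverse_unit]
  have hinv : HasDerivAt (fun t : ℂ => Ring.inverse (nfPolyAlg (t • c) (idPoly (t • v) circleId)))
      (-(I ^ (k + 1) * ((k + 1 : ℂ) • (circleId ^ k * V) + ∑ j, c j • circleId ^ (j : ℕ))
        * I ^ (k + 1))) 0 := by
    have h7 := hasFDerivAt_ringInverse (𝕜 := ℂ) w
    have h8 := HasFDerivAt.comp_hasDerivAt_of_eq (0 : ℂ) h7 hP (by rw [hP0, hw])
    rw [hwinv] at h8
    convert! h8 using 1
  have hmul := (hg'.fun_mul hA).fun_mul hinv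
  convert! hmul using 1
  have hcan : ∀ m n : ℕ, circleId ^ m * I ^ (m + n) = I ^ n := by
    intro m n
    rw [pow_add, ← mul_assoc, ← mul_pow, hmulI, one_pow, one_mul]
  -- For the displacement v_j ζ^j, differentiating g' contributes j and differentiating 1/P
  -- contributes -(k + 1). The factor j - (k + 1) is nonzero for j ≤ k; it would vanish for j = k +
  -- 1, the direction of the field z^(k+1) itself.
  have e1 : V' * I ^ (k + 1) - (k + 1 : ℂ) • (circleId ^ k * V) * (I ^ (k + 1) * I ^ (k + 1))
      = ∑ j : Fin (k + 1), ((((j : ℕ) : ℂ) - (k + 1)) * v j) • I ^ (k + 1 - (j : ℕ) + 1) := by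
    rw [hV, hV', Finset.mul_sum, Finset.smul_sum, Finset.sum_mul, Finset.sum_mul,
      ← Finset.sum_sub_distrib]
    refine Finset.sum_congr rfl fun j _ => ?_
    have hj : (j : ℕ) ≤ k := Nat.lt_succ_iff.1 j.2
    have h1 : circleId ^ k * circleId ^ (j : ℕ) * (I ^ (k + 1) * I ^ (k + 1))
        = I ^ (k + 1 - (j : ℕ) + 1) := by
      rw [← pow_add, ← pow_add, ← hcan (k + j) (k + 1 - j + 1)]
      congr 2; omega
    -- The truncated exponent j - 1 is wrong for j = 0, but there the factor j kills the term.
    have h2 : ((j : ℕ) : ℂ) • (circleId ^ ((j : ℕ) - 1) * I ^ (k + 1))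
        = ((j : ℕ) : ℂ) • I ^ (k + 1 - (j : ℕ) + 1) := by
      rcases Nat.eq_zero_or_pos (j : ℕ) with h | h
      · simp [h]
      · rw [← hcan (j - 1) (k + 1 - j + 1)]
        congr 3; omega
    rw [smul_mul_assoc, smul_mul_assoc, h2, mul_smul_comm, smul_smul, smul_mul_assoc,
      smul_mul_assoc, h1, smul_smul, ← sub_smul]
    congr 1; ring
  have e2 : circleId ^ k * I ^ (k + 1) = I ^ (0 + 1) := by
    rw [← hcan k (0 + 1)]
  have e3 : (∑ j, c j • circleId ^ (j : ℕ)) * (I ^ (k + 1) * I ^ (k + 1))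
      = ∑ j : Fin k, c j • I ^ (2 * k + 1 - (j : ℕ) + 1) := by
    rw [Finset.sum_mul]
    refine Finset.sum_congr rfl fun j _ => ?_
    rw [smul_mul_assoc, ← pow_add, ← hcan j (2 * k + 1 - j + 1)]
    congr 3; omega
  rw [hP0, hinvu, hg0, hg0', zero_smul ℂ a, zero_smul ℂ (circleId ^ k), add_zero, mul_one]
  rw [← e1, ← e2, ← e3]
  simp only [smul_mul_assoc, mul_smul_comm, mul_add, add_mul, one_mul]
  ring_nf

/-- The moments of the pulled back form. -/
noncomputable def momentMap (k : ℕ) (p : NFParam k) : Fin (2 * k + 2) → ℂ :=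
  moments (2 * k + 2) (pulledForm p)

theorem analyticAt_momentMap (k : ℕ) : AnalyticAt ℂ (momentMap k) 0 :=
  ((moments (2 * k + 2)).analyticAt _).comp (analyticAt_pulledForm k)

/-- The moment of order m sees only ζ^(-(m+1)). In the derivative at the origin this power comes
from A for m = 0, from u_j for m = k + 1 - j in 1, ..., k + 1, and from b_j for m = 2k + 1 - j in k
+ 2, ..., 2k + 1. Each of the 2k + 2 moments thus determines exactly one coordinate. -/
theorem fderiv_momentMap_injective (k : ℕ) : Function.Injective (fderiv ℂ (momentMap k) 0) := by
  rw [injective_iff_map_eq_zero]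
  intro x hx
  have h1 : HasDerivAt (fun t : ℂ => momentMap k (t • x)) (fderiv ℂ (momentMap k) 0 x) 0 := by
    have h2 : HasDerivAt (fun t : ℂ => t • x) x 0 := by
      simpa using (hasDerivAt_id (0 : ℂ)).smul_const x
    exact HasFDerivAt.comp_hasDerivAt_of_eq (0 : ℂ)
      (analyticAt_momentMap k).differentiableAt.hasFDerivAt h2 (by simp)
  have h2 := ((moments (2 * k + 2)).hasFDerivAt.comp_hasDerivAt (0 : ℂ) (hasDerivAt_pulledForm x))
  have h3 := h1.unique h2
  rw [hx] at h3
  have h4 : ∀ n : ℕ, n < 2 * k + 2 →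
      (∑ j : Fin (k + 1), ((((j : ℕ) : ℂ) - (k + 1)) * x.1 j) *
          (if n = k + 1 - (j : ℕ) then 1 else 0) + x.2.2 * (if n = 0 then 1 else 0)
        - ∑ j : Fin k, x.2.1 j * (if n = 2 * k + 1 - (j : ℕ) then 1 else 0)) = 0 := by
    intro n hn
    have h5 := congrFun h3 ⟨n, hn⟩
    rw [moments_apply, mul_sub, mul_add, Finset.mul_sum, Finset.mul_sum, map_sub, map_add,
      map_sum, map_sum] at h5
    simp only [mul_smul_comm, map_smul, circleResidue_pow_mul_inverse, smul_eq_mul] at h5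
    exact h5.symm
  have hv : ∀ j : Fin (k + 1), x.1 j = 0 := by
    intro i
    have hi : (i : ℕ) ≤ k := Nat.lt_succ_iff.1 i.2
    have h5 := h4 (k + 1 - i) (by omega)
    rw [Finset.sum_eq_single i, Finset.sum_eq_zero, if_pos rfl, if_neg (by omega)] at h5
    · simp only [mul_one, mul_zero, add_zero, sub_zero, mul_eq_zero] at h5
      refine h5.resolve_left fun h => ?_
      have h6 : ((i : ℕ) : ℂ) = ((k + 1 : ℕ) : ℂ) := by push_cast; exact sub_eq_zero.1 h
      have h7 := Nat.cast_injective h6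
      omega
    · intro j _
      rw [if_neg (by have := j.2; omega), mul_zero]
    · intro j _ hj
      have : (j : ℕ) ≠ i := fun h => hj (Fin.ext h)
      rw [if_neg (by have := j.2; omega), mul_zero]
    · simp
  have hc : ∀ j : Fin k, x.2.1 j = 0 := by
    intro i
    have h5 := h4 (2 * k + 1 - i) (by omega)
    rw [Finset.sum_eq_zero, Finset.sum_eq_single i, if_pos rfl, if_neg (by omega)] at h5
    · simpa using h5
    · intro j _ hj
      have : (j : ℕ) ≠ i := fun h => hj (Fin.ext h)
      rw [if_neg (by have := j.2; have := i.2; omega), mul_zero]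
    · simp
    · intro j _
      rw [hv, mul_zero, zero_mul]
  have ha : x.2.2 = 0 := by
    have h5 := h4 0 (by omega)
    rw [Finset.sum_eq_zero, Finset.sum_eq_zero] at h5
    · simpa using h5
    · intro j _
      rw [hc, zero_mul]
    · intro j _
      rw [hv, mul_zero, zero_mul]
  exact Prod.ext (funext hv) (Prod.ext (funext hc) ha)

/-- The inverse function theorem for analytic maps between finite dimensional spaces. -/
theorem exists_analyticAt_localInverse {E F : Type*} [NormedAddCommGroup E] [NormedSpace ℂ E]
    [FiniteDimensional ℂ E] [NormedAddCommGroup F] [NormedSpace ℂ F] [FiniteDimensional ℂ F]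
    {f : E → F} {a : E} (hf : AnalyticAt ℂ f a) (hinj : Function.Injective (fderiv ℂ f a))
    (hfr : Module.finrank ℂ E = Module.finrank ℂ F) :
    ∃ g : F → E, AnalyticAt ℂ g (f a) ∧ g (f a) = a ∧ (∀ᶠ y in 𝓝 (f a), f (g y) = y) ∧
      ∀ᶠ x in 𝓝 a, g (f x) = x := by
  have : CompleteSpace E := FiniteDimensional.complete ℂ E
  have : CompleteSpace F := FiniteDimensional.complete ℂ F
  let e : E ≃L[ℂ] F := (LinearEquiv.ofInjectiveOfFinrankEq (fderiv ℂ f a : E →ₗ[ℂ] F)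
    hinj hfr).toContinuousLinearEquiv
  have he : (e : E →L[ℂ] F) = fderiv ℂ f a := ContinuousLinearMap.ext fun x => rfl
  have hs : HasStrictFDerivAt f (e : E →L[ℂ] F) a := by
    rw [he]; exact hf.hasStrictFDerivAt
  have hcd : ContDiffAt ℂ ⊤ f a := hf.contDiffAt
  refine ⟨hs.localInverse _ _ _, ?_, hs.localInverse_apply_image, hs.eventually_right_inverse,
    hs.eventually_left_inverse⟩
  exact (hcd.to_localInverse hs.hasFDerivAt (by simp)).analyticAt

/-- The moment map is a local analytic diffeomorphism at the origin. -/
theorem exists_momentMap_inverse (k : ℕ) :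
    ∃ Θ : (Fin (2 * k + 2) → ℂ) → NFParam k, AnalyticAt ℂ Θ (momentMap k 0) ∧
      Θ (momentMap k 0) = 0 ∧ (∀ᶠ m in 𝓝 (momentMap k 0), momentMap k (Θ m) = m) ∧
      ∀ᶠ p in 𝓝 0, Θ (momentMap k p) = p :=
  exists_analyticAt_localInverse (analyticAt_momentMap k) (fderiv_momentMap_injective k)
    (by simp; ring)

/-! ### Existence of the normal form near z^(k+1) -/

/-- The normal form vector field with coefficients `b, A`. -/
noncomputable def nfVal {k : ℕ} (b : Fin k → ℂ) (A z : ℂ) : ℂ := nfPoly b z / (1 + A * z ^ k)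

theorem nfField_eq {k ℓ : ℕ} (b : (Fin ℓ → ℂ) → Fin k → ℂ) (A : (Fin ℓ → ℂ) → ℂ)
    (ε : Fin ℓ → ℂ) (z : ℂ) : nfField b A ε z = nfVal (b ε) (A ε) z := rfl

section Analytic
variable {E : Type*} [NormedAddCommGroup E] [NormedSpace ℂ E] {k : ℕ} {e : E}

theorem AnalyticAt.nfPoly {b : E → Fin k → ℂ} {x : E → ℂ} (hb : AnalyticAt ℂ b e)
    (hx : AnalyticAt ℂ x e) : AnalyticAt ℂ (fun e => nfPoly (b e) (x e)) e := by
  simpa only [nfPolyAlg_eq] using AnalyticAt.nfPolyAlg hb hx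

theorem AnalyticAt.nfVal {b : E → Fin k → ℂ} {A x : E → ℂ} (hb : AnalyticAt ℂ b e)
    (hA : AnalyticAt ℂ A e) (hx : AnalyticAt ℂ x e) (h : 1 + A e * x e ^ k ≠ 0) :
    AnalyticAt ℂ (fun e => nfVal (b e) (A e) (x e)) e :=
  (AnalyticAt.nfPoly hb hx).div (analyticAt_const.add (hA.mul (hx.pow k))) h

end Analytic

theorem nfPoly_zero {k : ℕ} (z : ℂ) : nfPoly (0 : Fin k → ℂ) z = z ^ (k + 1) := by simp [nfPoly]

theorem differentiable_nfPoly {k : ℕ} (b : Fin k → ℂ) : Differentiable ℂ (nfPoly b) :=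
  fun _ => (AnalyticAt.nfPoly analyticAt_const analyticAt_id).differentiableAt

theorem hasDerivAt_idPoly {k : ℕ} (u : Fin (k + 1) → ℂ) (z : ℂ) :
    HasDerivAt (idPoly u) (idPolyDeriv u z) z := by
  refine (hasDerivAt_id z).add ?_
  refine HasDerivAt.fun_sum fun j _ => ?_
  simpa using! (hasDerivAt_pow (j : ℕ) z).const_smul (u j)

theorem idPoly_circleId_apply {k : ℕ} (u : Fin (k + 1) → ℂ) (ζ : Metric.sphere (0 : ℂ) 1) :
    idPoly u circleId ζ = idPoly u (ζ : ℂ) := by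
  simp [idPoly]

theorem idPolyDeriv_circleId_apply {k : ℕ} (u : Fin (k + 1) → ℂ) (ζ : Metric.sphere (0 : ℂ) 1) :
    idPolyDeriv u circleId ζ = idPolyDeriv u (ζ : ℂ) := by
  simp [idPolyDeriv]

theorem nfPolyAlg_apply {k : ℕ} (b : Fin k → ℂ) (f : CircleFun) (ζ : Metric.sphere (0 : ℂ) 1) :
    nfPolyAlg b f ζ = nfPoly b (f ζ) := by
  simp [nfPolyAlg, nfPoly]

theorem pulledForm_apply {k : ℕ} {p : NFParam k}
    (h : ∀ ζ : Metric.sphere (0 : ℂ) 1, nfPoly p.2.1 (idPoly p.1 (ζ : ℂ)) ≠ 0)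
    (ζ : Metric.sphere (0 : ℂ) 1) : pulledForm p ζ =
      idPolyDeriv p.1 (ζ : ℂ) * (1 + p.2.2 * idPoly p.1 (ζ : ℂ) ^ k) /
        nfPoly p.2.1 (idPoly p.1 (ζ : ℂ)) := by
  have h' : ∀ ζ, nfPolyAlg p.2.1 (idPoly p.1 circleId) ζ ≠ 0 := by
    intro ζ; rw [nfPolyAlg_apply, idPoly_circleId_apply]; exact h ζ
  simp only [pulledForm, ContinuousMap.mul_apply, circleFun_inverse_apply h', nfPolyAlg_apply,
    idPoly_circleId_apply, idPolyDeriv_circleId_apply, ContinuousMap.add_apply,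
    ContinuousMap.one_apply, ContinuousMap.smul_apply, ContinuousMap.pow_apply, smul_eq_mul,
    div_eq_mul_inv]

/-- Continuous functions vanishing on a compact fibre are small on nearby fibres. -/
theorem eventually_forall_norm_lt {X : Type*} [TopologicalSpace X] {G : X × ℂ → ℂ} {x₀ : X}
    {K : Set ℂ} (hK : IsCompact K) (hG : ∀ z ∈ K, ContinuousAt G (x₀, z))
    (h0 : ∀ z ∈ K, G (x₀, z) = 0) {η : ℝ} (hη : 0 < η) :
    ∀ᶠ x in 𝓝 x₀, ∀ z ∈ K, ‖G (x, z)‖ < η := by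
  refine hK.eventually_forall_of_forall_eventually fun z hz => ?_
  have := (hG z hz).norm
  exact this.eventually_lt continuousAt_const (by simpa [h0 z hz] using hη)

theorem continuous_nfPoly_idPoly {k : ℕ} : Continuous fun w : NFParam k × ℂ =>
    nfPoly w.1.2.1 (idPoly w.1.1 w.2) := by
  refine continuous_iff_continuousAt.2 fun w => AnalyticAt.continuousAt (𝕜 := ℂ) ?_
  refine AnalyticAt.nfPoly (analyticAt_fst.comp (analyticAt_snd.comp analyticAt_fst)) ?_
  exact AnalyticAt.idPoly (analyticAt_fst.comp analyticAt_fst) analyticAt_snd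

/-- The local flow of the normal forms. -/
theorem exists_nfFlow (k : ℕ) :
    ∃ Φ : ℂ × ((Fin k → ℂ) × ℂ) × ℂ → ℂ, AnalyticAt ℂ Φ (0, 0, 0) ∧
      ∀ᶠ w in 𝓝 ((0 : ℂ), (0 : (Fin k → ℂ) × ℂ), (0 : ℂ)), Φ (0, w.2) = w.2.2 ∧
        HasDerivAt (fun τ => Φ (τ, w.2)) (nfVal w.2.1.1 w.2.1.2 (Φ w)) w.1 ∧
        deriv (fun x => Φ (w.1, w.2.1, x)) w.2.2 * nfVal w.2.1.1 w.2.1.2 w.2.2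
          = nfVal w.2.1.1 w.2.1.2 (Φ w) := by
  have hF : AnalyticAt ℂ (fun q : ((Fin k → ℂ) × ℂ) × ℂ => nfVal q.1.1 q.1.2 q.2)
      ((0 : (Fin k → ℂ) × ℂ), (0 : ℂ)) :=
    AnalyticAt.nfVal (analyticAt_fst.comp analyticAt_fst) (analyticAt_snd.comp analyticAt_fst)
      analyticAt_snd (by simp)
  obtain ⟨Φ, h1, h2, h3, h4⟩ := exists_local_flow hF
  refine ⟨Φ, h1, ?_⟩
  filter_upwards [h2, h3, h4] with w h2 h3 h4 using ⟨h2, h3, h4⟩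

/-- The derivative of `z ↦ Φ (Q z, p, g z)`. -/
theorem hasDerivAt_comp_flow {P : Type*} [NormedAddCommGroup P] [NormedSpace ℂ P]
    {Φ : ℂ × P × ℂ → ℂ} {Q g : ℂ → ℂ} {p : P} {z Q' g' a : ℂ}
    (hΦ : AnalyticAt ℂ Φ (Q z, p, g z)) (hQ : HasDerivAt Q Q' z) (hg : HasDerivAt g g' z)
    (ha : HasDerivAt (fun τ => Φ (τ, p, g z)) a (Q z)) :
    HasDerivAt (fun z => Φ (Q z, p, g z))
      (a * Q' + deriv (fun x => Φ (Q z, p, x)) (g z) * g') z := by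
  have hd := hΦ.differentiableAt.hasFDerivAt
  have h1 : HasDerivAt (fun z => (Q z, p, g z)) (Q', 0, g') z :=
    hQ.prodMk ((hasDerivAt_const z p).prodMk hg)
  have h2 := hd.comp_hasDerivAt z h1
  have h3 : HasDerivAt (fun τ => Φ (τ, p, g z)) (fderiv ℂ Φ (Q z, p, g z) (1, 0, 0)) (Q z) := by
    have h : HasDerivAt (fun τ : ℂ => (τ, p, g z)) (1, 0, 0) (Q z) :=
      (hasDerivAt_id _).prodMk (hasDerivAt_const _ _)
    exact HasFDerivAt.comp_hasDerivAt (Q z) hd h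
  have h4 : HasDerivAt (fun x => Φ (Q z, p, x)) (fderiv ℂ Φ (Q z, p, g z) (0, 0, 1)) (g z) := by
    have h : HasDerivAt (fun x : ℂ => (Q z, p, x)) (0, 0, 1) (g z) :=
      (hasDerivAt_const _ _).prodMk ((hasDerivAt_const _ _).prodMk (hasDerivAt_id _))
    exact HasFDerivAt.comp_hasDerivAt (g z) hd h
  rw [ha.unique h3, h4.deriv]
  convert! h2 using 1
  have : ((Q', 0, g') : ℂ × P × ℂ) = Q' • (1, 0, 0) + g' • (0, 0, 1) := by simp
  rw [this, map_add, map_smul, map_smul]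
  simp only [smul_eq_mul]
  ring

/-- With (u, b, A) matching the first 2k + 2 moments, 1/F differs on the circle from the pull-back
of the normal form's dual form by g = `idPoly u` through a function q that extends to the disk. If
Q' = q, the map φ(z) = Φ(Q(z), g(z)) pulls the dual form back to the g-pull-back plus dQ, which is
dz/F. The data are attached to the circle function `f` so that analyticity is proved once, on a
Banach space, and every family is covered by composition. The constants δ, ρ do not depend on F. -/
theorem exists_universal_normalization (k : ℕ) :
    ∃ (φ : CircleFun × ℂ → ℂ) (b : CircleFun → Fin k → ℂ) (A : CircleFun → ℂ),
      AnalyticAt ℂ φ (circleId ^ (k + 1), 0) ∧ AnalyticAt ℂ b (circleId ^ (k + 1)) ∧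
      AnalyticAt ℂ A (circleId ^ (k + 1)) ∧
      ∃ δ > 0, ∃ ρ > 0, ∀ (F : ℂ → ℂ) (f : CircleFun), DifferentiableOn ℂ F (Metric.ball 0 2) →
        (∀ ζ, f ζ = F ζ) → (∀ z ∈ Metric.ball (0 : ℂ) 2, ‖F z - z ^ (k + 1)‖ ≤ δ) →
        AnalyticAt ℂ φ (f, 0) ∧ AnalyticAt ℂ b f ∧ AnalyticAt ℂ A f ∧
        ∀ z, ‖z‖ < ρ → deriv (fun z => φ (f, z)) z ≠ 0 ∧
          1 + A f * φ (f, z) ^ k ≠ 0 ∧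
          deriv (fun z => φ (f, z)) z * F z = nfVal (b f) (A f) (φ (f, z)) := by
  obtain ⟨Φ, hΦ, hΦev⟩ := exists_nfFlow k
  obtain ⟨Θ, hΘ, hΘ0, hΘinv, -⟩ := exists_momentMap_inverse k
  set f₀ : CircleFun := circleId ^ (k + 1) with hf₀
  have hInv : AnalyticAt ℂ (Ring.inverse : CircleFun → CircleFun) f₀ :=
    analyticAt_ringInverse (circleId_pow_ne_zero _)
  have hm0 : moments (2 * k + 2) (Ring.inverse f₀) = momentMap k 0 := by
    rw [momentMap, pulledForm_zero]
  let par : CircleFun → NFParam k := fun f => Θ (moments (2 * k + 2) (Ring.inverse f))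
  have hmom : AnalyticAt ℂ (fun f => moments (2 * k + 2) (Ring.inverse f)) f₀ :=
    ((moments (2 * k + 2)).analyticAt _).comp hInv
  have hpar : AnalyticAt ℂ par f₀ := AnalyticAt.comp_of_eq hΘ hmom hm0
  have hpar0 : par f₀ = 0 := by simp only [par]; rw [hm0, hΘ0]
  let D : CircleFun → CircleFun := fun f => Ring.inverse f - pulledForm (par f)
  have hD : AnalyticAt ℂ D f₀ :=
    hInv.sub (AnalyticAt.comp_of_eq (analyticAt_pulledForm k) hpar hpar0)
  have hq : AnalyticAt ℂ (fun w : CircleFun × ℂ => cauchyTransform (D w.1) w.2) (f₀, 0) := by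
    refine AnalyticAt.comp_of_eq (f := fun w : CircleFun × ℂ => (D w.1, w.2))
      (analyticAt_cauchyTransform (D f₀) (z := 0) (by simp)) ?_ rfl
    exact (AnalyticAt.comp_of_eq (f := fun w : CircleFun × ℂ => w.1) hD analyticAt_fst rfl).prod analyticAt_snd
  obtain ⟨Q, hQ, hQ0, hQd⟩ := exists_analyticAt_primitive hq
  let g : CircleFun × ℂ → ℂ := fun w => idPoly (par w.1).1 w.2
  have hparw : AnalyticAt ℂ (fun w : CircleFun × ℂ => par w.1) (f₀, 0) :=
    AnalyticAt.comp_of_eq (f := fun w : CircleFun × ℂ => w.1) hpar analyticAt_fst rfl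
  have hg : AnalyticAt ℂ g (f₀, 0) :=
    AnalyticAt.idPoly (analyticAt_fst.comp hparw) analyticAt_snd
  let ψ : CircleFun × ℂ → ℂ × ((Fin k → ℂ) × ℂ) × ℂ := fun w => (Q w, (par w.1).2, g w)
  have hψ : AnalyticAt ℂ ψ (f₀, 0) := hQ.prod ((analyticAt_snd.comp hparw).prod hg)
  have hψ0 : ψ (f₀, 0) = (0, 0, 0) := by simp [ψ, g, hQ0, hpar0, idPoly_zero]
  let φ : CircleFun × ℂ → ℂ := fun w => Φ (ψ w)
  have hφ : AnalyticAt ℂ φ (f₀, 0) := AnalyticAt.comp_of_eq hΦ hψ hψ0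
  have hb : AnalyticAt ℂ (fun f => (par f).2.1) f₀ :=
    analyticAt_fst.comp (analyticAt_snd.comp hpar)
  have hA : AnalyticAt ℂ (fun f => (par f).2.2) f₀ :=
    analyticAt_snd.comp (analyticAt_snd.comp hpar)
  have hAw : ContinuousAt (fun w : CircleFun × ℂ => (par w.1).2.2) (f₀, 0) :=
    (analyticAt_snd.comp (analyticAt_snd.comp hparw)).continuousAt
  refine ⟨φ, fun f => (par f).2.1, fun f => (par f).2.2, hφ, hb, hA, ?_⟩
  -- the derivative in `z` does not vanish
  have hslice : ∀ w : CircleFun × ℂ, AnalyticAt ℂ φ w → HasDerivAt (fun z => φ (w.1, z))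
      (fderiv ℂ φ w (0, 1)) w.2 := by
    intro w hw
    have h : HasDerivAt (fun z : ℂ => (w.1, z)) (0, 1) w.2 :=
      (hasDerivAt_const _ _).prodMk (hasDerivAt_id _)
    exact HasFDerivAt.comp_hasDerivAt w.2 hw.differentiableAt.hasFDerivAt h
  -- At z^(k+1) itself the parameters and q vanish, so φ is the identity to first order at 0.
  have hder0 : fderiv ℂ φ (f₀, 0) (0, 1) = 1 := by
    have h1 := hslice _ hφ
    have hqz : ∀ z, cauchyTransform (D f₀) z = 0 := by
      intro z
      have : D f₀ = 0 := by
        simp only [D]; rw [hpar0, pulledForm_zero, sub_self]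
      simp [cauchyTransform, this]
    have hQc : HasDerivAt (fun z => Q (f₀, z)) 0 0 := by
      simpa [hqz] using hQd.self_of_nhds
    have hgd : HasDerivAt (fun z => g (f₀, z)) 1 0 := by
      have := hasDerivAt_idPoly (par f₀).1 0
      rw [hpar0, Prod.fst_zero, idPolyDeriv_zero] at this
      exact this.congr_of_eventuallyEq (Eventually.of_forall fun z => by simp only [g]; rw [hpar0]; rfl)
    have h0 := hΦev.self_of_nhds
    have hQ00 : Q (f₀, 0) = 0 := hQ0 _
    have hg00 : g (f₀, 0) = 0 := by simp [g, hpar0, idPoly_zero]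
    have h2 := hasDerivAt_comp_flow (Φ := Φ) (Q := fun z => Q (f₀, z)) (g := fun z => g (f₀, z))
      (p := (par f₀).2) (z := 0) (by simpa [hQ00, hg00, hpar0] using hΦ) hQc hgd
      (by rw [hQ00, hg00, hpar0]; exact h0.2.1)
    have h3 : HasDerivAt (fun x => Φ (Q (f₀, 0), (par f₀).2, x)) 1 (g (f₀, 0)) := by
      rw [hQ00, hg00, hpar0]
      refine (hasDerivAt_id (0 : ℂ)).congr_of_eventuallyEq ?_
      have h4 : Tendsto (fun x : ℂ => ((0 : ℂ), (0 : (Fin k → ℂ) × ℂ), x)) (𝓝 0)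
          (𝓝 (0, 0, 0)) := by
        have : Continuous (fun x : ℂ => ((0 : ℂ), (0 : (Fin k → ℂ) × ℂ), x)) := by fun_prop
        simpa using this.tendsto 0
      filter_upwards [h4.eventually hΦev] with x hx using hx.1
    rw [h3.deriv] at h2
    simpa using h1.unique h2
  have hne : ∀ᶠ w in 𝓝 (f₀, (0 : ℂ)), fderiv ℂ φ w (0, 1) ≠ 0 := by
    have h1 : ContinuousAt (fun w => fderiv ℂ φ w (0, 1)) (f₀, 0) :=
      hφ.fderiv.continuousAt.clm_apply continuousAt_const
    exact h1.eventually_ne (by rw [hder0]; exact one_ne_zero)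
  have htψ : Tendsto ψ (𝓝 (f₀, 0)) (𝓝 (0, 0, 0)) := by
    have := hψ.continuousAt.tendsto; rwa [hψ0] at this
  have hone : ∀ᶠ w in 𝓝 (f₀, (0 : ℂ)), 1 + (par w.1).2.2 * φ w ^ k ≠ 0 := by
    have h1 : ContinuousAt (fun w : CircleFun × ℂ => 1 + (par w.1).2.2 * φ w ^ k) (f₀, 0) :=
      continuousAt_const.add (hAw.mul (hφ.continuousAt.pow k))
    exact h1.eventually_ne (by simp [hpar0])
  have hone' : ∀ᶠ w in 𝓝 (f₀, (0 : ℂ)), 1 + (par w.1).2.2 * g w ^ k ≠ 0 := by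
    have h1 : ContinuousAt (fun w : CircleFun × ℂ => 1 + (par w.1).2.2 * g w ^ k) (f₀, 0) :=
      continuousAt_const.add (hAw.mul (hg.continuousAt.pow k))
    exact h1.eventually_ne (by simp [hpar0])
  obtain ⟨r1, hr1, H1⟩ := Metric.eventually_nhds_iff.1
    (((((hφ.eventually_analyticAt.and hne).and (htψ.eventually hΦev)).and
      (htψ.eventually hΦ.eventually_analyticAt)).and (hone.and hone')).and hQd)
  set ρ := min r1 1 with hρ
  have hρ0 : 0 < ρ := lt_min hr1 one_pos
  have hρ1 : ρ ≤ 1 := min_le_right _ _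
  -- conditions on `f`
  have hparT : Tendsto par (𝓝 f₀) (𝓝 0) := by
    have := hpar.continuousAt.tendsto; rwa [hpar0] at this
  -- Nonvanishing at the single point ρ/2 shows that P∘g is not identically zero on the disk of
  -- radius ρ, which allows it to be cancelled at the end.
  have hc1 : ∀ᶠ f in 𝓝 f₀, nfPoly (par f).2.1 (idPoly (par f).1 ((ρ / 2 : ℝ) : ℂ)) ≠ 0 := by
    have h1 : Continuous fun p : NFParam k => nfPoly p.2.1 (idPoly p.1 ((ρ / 2 : ℝ) : ℂ)) :=
      continuous_nfPoly_idPoly.comp (continuous_id.prodMk continuous_const)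
    refine hparT.eventually (h1.continuousAt.eventually_ne ?_)
    simp only [Prod.fst_zero, Prod.snd_zero, idPoly_zero, nfPoly_zero]
    exact pow_ne_zero _ (by exact_mod_cast (half_pos hρ0).ne')
  have hpow : (0 : ℝ) < (3 / 2) ^ (k + 1) := by positivity
  -- On |z| = 3/2, two factors within η of z^(k+1) have a product within 1/16 + 1/16 + 1/256 < 1/4
  -- of z^(2k+2).
  set η : ℝ := (1 / 16) / (3 / 2) ^ (k + 1) with hη
  have hη0 : 0 < η := by positivity
  have hc2 : ∀ᶠ f in 𝓝 f₀, ∀ z ∈ Metric.closedBall (0 : ℂ) (3 / 2),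
      ‖nfPoly (par f).2.1 (idPoly (par f).1 z) - z ^ (k + 1)‖ < η := by
    refine hparT.eventually (eventually_forall_norm_lt
      (G := fun w : NFParam k × ℂ => nfPoly w.1.2.1 (idPoly w.1.1 w.2) - w.2 ^ (k + 1))
      (isCompact_closedBall _ _) ?_ ?_ hη0)
    · intro z _
      exact (continuous_nfPoly_idPoly.sub (by fun_prop)).continuousAt
    · intro z _
      simp [idPoly_zero, nfPoly_zero]
  have hc3 : ∀ᶠ f in 𝓝 f₀, momentMap k (par f) = moments (2 * k + 2) (Ring.inverse f) := by
    have h1 := hmom.continuousAt.tendsto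
    rw [hm0] at h1
    exact h1.eventually hΘinv
  obtain ⟨r2, hr2, H2⟩ := Metric.eventually_nhds_iff.1
    (((hc1.and hc2).and hc3).and (hb.eventually_analyticAt.and hA.eventually_analyticAt))
  have hη1 : η ≤ 1 / 16 := by
    rw [hη]
    exact div_le_self (by norm_num) (one_le_pow₀ (by norm_num))
  refine ⟨min (min (r1 / 2) (r2 / 2)) η, by positivity, ρ, hρ0, ?_⟩
  intro F f hF hfF hδ
  set δ := min (min (r1 / 2) (r2 / 2)) η with hδdef
  have hδ1 : δ < r1 := by
    have : δ ≤ r1 / 2 := (min_le_left _ _).trans (min_le_left _ _)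
    linarith
  have hδ2 : δ < r2 := by
    have : δ ≤ r2 / 2 := (min_le_left _ _).trans (min_le_right _ _)
    linarith
  have hδη : δ ≤ η := min_le_right _ _
  have hδ0 : 0 ≤ δ := by positivity
  have hsph : ∀ ζ : Metric.sphere (0 : ℂ) 1, (ζ : ℂ) ∈ Metric.ball (0 : ℂ) 2 := by
    intro ζ; rw [mem_ball_zero_iff, norm_coe_circle]; norm_num
  have hsph' : ∀ ζ : Metric.sphere (0 : ℂ) 1, (ζ : ℂ) ∈ Metric.closedBall (0 : ℂ) (3 / 2) := by
    intro ζ; rw [mem_closedBall_zero_iff, norm_coe_circle]; norm_num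
  have hff : dist f f₀ ≤ δ := by
    refine (ContinuousMap.dist_le hδ0).2 fun ζ => ?_
    rw [dist_eq_norm, hfF]
    exact hδ ζ (hsph ζ)
  obtain ⟨⟨⟨hP1, hP2⟩, hmm⟩, hbf, hAf⟩ := H2 (hff.trans_lt hδ2)
  have Hw : ∀ z : ℂ, ‖z‖ < ρ → dist (f, z) (f₀, (0 : ℂ)) < r1 := by
    intro z hz
    rw [Prod.dist_eq]
    exact max_lt (hff.trans_lt hδ1) (by simpa using hz.trans_le (min_le_left _ _))
  set u := (par f).1 with hu
  set b := (par f).2.1 with hbdef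
  set A := (par f).2.2 with hAdef
  -- `N` and `H` are the numerator and denominator of 1/F minus the pulled-back form; unlike the
  -- quotient, both are holomorphic in the whole disk.
  let N : ℂ → ℂ := fun z =>
    nfPoly b (idPoly u z) - F z * (idPolyDeriv u z * (1 + A * idPoly u z ^ k))
  let H : ℂ → ℂ := fun z => F z * nfPoly b (idPoly u z)
  have hgd : Differentiable ℂ (idPoly u : ℂ → ℂ) := fun z => (hasDerivAt_idPoly u z).differentiableAt
  have hgd' : Differentiable ℂ (idPolyDeriv u : ℂ → ℂ) := fun z =>
    (AnalyticAt.idPolyDeriv (R := ℂ) (b := fun _ : ℂ => u) analyticAt_const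
      analyticAt_id).differentiableAt
  have hPd : Differentiable ℂ (fun z => nfPoly b (idPoly u z)) :=
    (differentiable_nfPoly b).comp hgd
  have hNd : DifferentiableOn ℂ N (Metric.ball 0 2) :=
    hPd.differentiableOn.sub (hF.mul
      (hgd'.mul ((differentiable_const _).add ((differentiable_const _).mul
        (hgd.pow k)))).differentiableOn)
  have hHd : DifferentiableOn ℂ H (Metric.ball 0 2) := hF.mul hPd.differentiableOn
  have hnear : ∀ z w : ℂ, ‖z‖ = 1 → ‖w - z ^ (k + 1)‖ ≤ η → w ≠ 0 := by
    intro z w hz hw h0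
    rw [h0, zero_sub, norm_neg, norm_pow, hz, one_pow] at hw
    linarith
  have hF0 : ∀ ζ : Metric.sphere (0 : ℂ) 1, F ζ ≠ 0 := fun ζ =>
    hnear ζ _ (norm_coe_circle ζ) ((hδ ζ (hsph ζ)).trans hδη)
  have hP0 : ∀ ζ : Metric.sphere (0 : ℂ) 1, nfPoly b (idPoly u (ζ : ℂ)) ≠ 0 := fun ζ =>
    hnear ζ _ (norm_coe_circle ζ) (hP2 ζ (hsph' ζ)).le
  have hDH : ∀ ζ, D f ζ * H ζ = N ζ := by
    intro ζ
    have h1 : D f ζ = (F ζ)⁻¹ - idPolyDeriv u (ζ : ℂ) * (1 + A * idPoly u (ζ : ℂ) ^ k) /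
        nfPoly b (idPoly u (ζ : ℂ)) := by
      have h2 : ∀ ζ, f ζ ≠ 0 := fun ζ => by rw [hfF]; exact hF0 ζ
      rw [show D f = Ring.inverse f - pulledForm (par f) from rfl, ContinuousMap.sub_apply,
        circleFun_inverse_apply h2, hfF, pulledForm_apply hP0]
    rw [h1]
    have h2 := hF0 ζ
    have h3 := hP0 ζ
    simp only [H, N]
    field_simp
  have hclose : ∀ z ∈ Metric.sphere (0 : ℂ) (3 / 2), ‖H z - z ^ (2 * k + 2)‖ ≤ 1 / 4 := by
    intro z hz
    have hzn : ‖z‖ = 3 / 2 := mem_sphere_zero_iff_norm.1 hz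
    have h1 : ‖F z - z ^ (k + 1)‖ ≤ η :=
      (hδ z (by rw [mem_ball_zero_iff, hzn]; norm_num)).trans hδη
    have h2 : ‖nfPoly b (idPoly u z) - z ^ (k + 1)‖ ≤ η :=
      (hP2 z (by rw [mem_closedBall_zero_iff, hzn])).le
    have h3 : H z - z ^ (2 * k + 2) = (F z - z ^ (k + 1)) * (nfPoly b (idPoly u z) - z ^ (k + 1))
        + (F z - z ^ (k + 1)) * z ^ (k + 1) +
          z ^ (k + 1) * (nfPoly b (idPoly u z) - z ^ (k + 1)) := by
      simp only [H]; ring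
    have h4 : ‖z ^ (k + 1)‖ = (3 / 2) ^ (k + 1) := by rw [norm_pow, hzn]
    have h5 : η * (3 / 2) ^ (k + 1) = 1 / 16 := div_mul_cancel₀ _ hpow.ne'
    rw [h3]
    refine (norm_add₃_le).trans ?_
    rw [norm_mul, norm_mul, norm_mul, h4]
    have h6 : ‖F z - z ^ (k + 1)‖ * ‖nfPoly b (idPoly u z) - z ^ (k + 1)‖ ≤ 1 / 16 * (1 / 16) :=
      mul_le_mul (h1.trans hη1) (h2.trans hη1) (norm_nonneg _) (by norm_num)
    have h7 : ‖F z - z ^ (k + 1)‖ * (3 / 2) ^ (k + 1) ≤ 1 / 16 := by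
      rw [← h5]; gcongr
    have h8 : (3 / 2 : ℝ) ^ (k + 1) * ‖nfPoly b (idPoly u z) - z ^ (k + 1)‖ ≤ 1 / 16 := by
      rw [← h5, mul_comm]; gcongr
    linarith
  have hmz : ∀ n < 2 * k + 2, circleResidue (circleId ^ n * D f) = 0 := by
    intro n hn
    have h1 := congrFun hmm ⟨n, hn⟩
    simp only [momentMap, moments_apply] at h1
    rw [show D f = Ring.inverse f - pulledForm (par f) from rfl, mul_sub, map_sub, h1, sub_self]
  have hmz' := circleResidue_pow_mul_eq_zero hHd hNd hDH hclose hmz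
  have hHq : ∀ z : ℂ, ‖z‖ < 1 → H z * cauchyTransform (D f) z = N z := fun z hz =>
    mul_cauchyTransform hHd hNd hDH hmz' hz
  have hφz : ∀ z : ℂ, ‖z‖ < ρ → AnalyticAt ℂ (fun z => φ (f, z)) z := fun z hz =>
    AnalyticAt.comp_of_eq (f := fun z : ℂ => (f, z)) (H1 (Hw z hz)).1.1.1.1.1
      (analyticAt_const.prod analyticAt_id) rfl
  -- H q = N gives the conjugacy equation only after multiplication by P∘g, which may vanish inside
  -- the disk. The identity theorem removes this factor.
  have hprod : ∀ z : ℂ, ‖z‖ < ρ → nfPoly b (idPoly u z) *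
      (deriv (fun z => φ (f, z)) z * F z - nfVal b A (φ (f, z))) = 0 := by
    intro z hz
    obtain ⟨⟨⟨⟨-, -, hΦ1, hΦ2⟩, hΦa⟩, h1, h1'⟩, hQz⟩ := H1 (Hw z hz)
    have h2 := hasDerivAt_comp_flow (Φ := Φ) (Q := fun z => Q (f, z)) (g := fun z => g (f, z))
      (p := (par f).2) (z := z) hΦa hQz (hasDerivAt_idPoly u z) hΦ1
    have h3 : deriv (fun z => φ (f, z)) z = _ := h2.deriv
    rw [h3]
    have h4 := hHq z (hz.trans_le hρ1)
    set c := deriv (fun x => Φ (Q (f, z), (par f).2, x)) (g (f, z)) with hc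
    have h5 : c * nfVal b A (idPoly u z) = nfVal b A (φ (f, z)) := hΦ2
    have h6 : (1 + A * idPoly u z ^ k) * nfVal b A (idPoly u z) = nfPoly b (idPoly u z) :=
      mul_div_cancel₀ _ h1'
    simp only [H, N] at h4
    change nfPoly b (idPoly u z) * ((nfVal b A (φ (f, z)) * cauchyTransform (D f) z
      + c * idPolyDeriv u z) * F z - nfVal b A (φ (f, z))) = 0
    rw [← h5] at *
    linear_combination (c * nfVal b A (idPoly u z)) * h4
      - c * idPolyDeriv u z * F z * h6
  refine ⟨(H1 (Hw 0 (by simpa using hρ0))).1.1.1.1.1, hbf, hAf, fun z hz => ?_⟩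
  refine ⟨?_, (H1 (Hw z hz)).1.2.1, ?_⟩
  · rw [(hslice _ (H1 (Hw z hz)).1.1.1.1.1).deriv]
    exact (H1 (Hw z hz)).1.1.1.1.2
  · have hU : IsPreconnected (Metric.ball (0 : ℂ) ρ) := (convex_ball _ _).isPreconnected
    have ha1 : AnalyticOnNhd ℂ (fun z => nfPoly b (idPoly u z)) (Metric.ball 0 ρ) :=
      fun z _ => hPd.analyticAt z
    have ha2 : AnalyticOnNhd ℂ (fun z => deriv (fun z => φ (f, z)) z * F z
        - nfVal b A (φ (f, z))) (Metric.ball 0 ρ) := by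
      intro z hz
      rw [mem_ball_zero_iff] at hz
      refine ((hφz z hz).deriv.mul ?_).sub ?_
      · exact hF.analyticAt (Metric.isOpen_ball.mem_nhds (by rw [mem_ball_zero_iff]; linarith))
      · exact AnalyticAt.nfVal analyticAt_const analyticAt_const (hφz z hz) (H1 (Hw z hz)).1.2.1
    rcases ha1.eq_zero_or_eq_zero_of_mul_eq_zero ha2
      (fun z hz => hprod z (mem_ball_zero_iff.1 hz)) hU with h | h
    · exact absurd (h (ρ / 2 : ℝ) (by
        rw [mem_ball_zero_iff, Complex.norm_real, Real.norm_of_nonneg (half_pos hρ0).le]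
        linarith)) hP1
    · exact sub_eq_zero.1 (h z (mem_ball_zero_iff.2 hz))

/-! ### Division by a normal form polynomial -/

/-- The divided difference of `nfPolyAlg b` at the points `x, w`. -/
noncomputable def nfDivDiff {R : Type*} [CommRing R] [Algebra ℂ R] {k : ℕ} (b : Fin k → ℂ)
    (x w : R) : R :=
  ∑ i ∈ Finset.range (k + 1), w ^ i * x ^ (k - i) +
    ∑ j : Fin k, b j • ∑ i ∈ Finset.range (j : ℕ), w ^ i * x ^ ((j : ℕ) - 1 - i)

theorem sub_mul_nfDivDiff {R : Type*} [CommRing R] [Algebra ℂ R] {k : ℕ} (b : Fin k → ℂ)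
    (x w : R) : (w - x) * nfDivDiff b x w = nfPolyAlg b w - nfPolyAlg b x := by
  have h1 : ∀ n, (w - x) * ∑ i ∈ Finset.range n, w ^ i * x ^ (n - 1 - i) = w ^ n - x ^ n := by
    intro n; rw [mul_comm]; exact geom_sum₂_mul w x n
  have h2 := h1 (k + 1)
  rw [Nat.add_sub_cancel] at h2
  rw [nfDivDiff, mul_add, h2, Finset.mul_sum]
  simp only [mul_smul_comm, h1, smul_sub, Finset.sum_sub_distrib, nfPolyAlg]
  ring

/-- A constant bounding the polynomials of degree `k + 1` on the disk of radius `2`. -/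
noncomputable def polyBound (k : ℕ) : ℝ := (k + 1) ^ 2 * 2 ^ (k + 2)

theorem pow_le_polyBound (k : ℕ) : (2 : ℝ) ^ (k + 2) ≤ polyBound k := by
  unfold polyBound
  have : (1 : ℝ) ≤ ((k : ℝ) + 1) ^ 2 := one_le_pow₀ (by linarith [Nat.cast_nonneg (α := ℝ) k])
  exact le_mul_of_one_le_left (by positivity) this

theorem four_le_polyBound (k : ℕ) : (4 : ℝ) ≤ polyBound k := by
  refine le_trans ?_ (pow_le_polyBound k)
  rw [pow_add]
  have : (1 : ℝ) ≤ 2 ^ k := one_le_pow₀ (by norm_num)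
  linarith

theorem norm_nfPoly_sub_le {k : ℕ} {b : Fin k → ℂ} {δ : ℝ} (hb : ‖b‖ ≤ δ) {z : ℂ}
    (hz : ‖z‖ ≤ 2) : ‖nfPoly b z - z ^ (k + 1)‖ ≤ polyBound k * δ := by
  have hδ : 0 ≤ δ := (norm_nonneg b).trans hb
  rw [nfPoly, add_sub_cancel_left]
  have h1 : ∀ j ∈ (Finset.univ : Finset (Fin k)), ‖b j * z ^ (j : ℕ)‖ ≤ 2 ^ k * δ := by
    intro j _
    rw [norm_mul, norm_pow, mul_comm]
    gcongr
    · exact (pow_le_pow_left₀ (norm_nonneg z) hz _).trans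
        (pow_le_pow_right₀ (by norm_num) j.2.le)
    · exact (norm_le_pi_norm b j).trans hb
  refine (norm_sum_le_of_le _ h1).trans ?_
  rw [Finset.sum_const, Finset.card_univ, Fintype.card_fin, nsmul_eq_mul, polyBound, ← mul_assoc]
  gcongr
  · have : (0 : ℝ) ≤ k := Nat.cast_nonneg k
    nlinarith
  · norm_num
  · omega

theorem norm_nfDivDiff_le {k : ℕ} {b : Fin k → ℂ} (hb : ‖b‖ ≤ 1) {x w : ℂ} (hx : ‖x‖ ≤ 2)
    (hw : ‖w‖ ≤ 2) : ‖nfDivDiff b x w‖ ≤ polyBound k := by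
  have h0 : ∀ i m : ℕ, i + m ≤ k → ‖w ^ i * x ^ m‖ ≤ 2 ^ k := by
    intro i m h
    rw [norm_mul, norm_pow, norm_pow]
    calc ‖w‖ ^ i * ‖x‖ ^ m ≤ 2 ^ i * 2 ^ m := by gcongr
      _ = 2 ^ (i + m) := (pow_add _ _ _).symm
      _ ≤ 2 ^ k := pow_le_pow_right₀ (by norm_num) h
  have h1 : ‖∑ i ∈ Finset.range (k + 1), w ^ i * x ^ (k - i)‖ ≤ (k + 1) * 2 ^ k := by
    refine (norm_sum_le_of_le _ (fun i hi => h0 i (k - i) ?_)).trans (by simp)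
    have := Finset.mem_range.1 hi
    omega
  have h2 : ∀ j ∈ (Finset.univ : Finset (Fin k)),
      ‖b j • ∑ i ∈ Finset.range (j : ℕ), w ^ i * x ^ ((j : ℕ) - 1 - i)‖ ≤ k * 2 ^ k := by
    intro j _
    rw [norm_smul]
    have h3 : ‖∑ i ∈ Finset.range (j : ℕ), w ^ i * x ^ ((j : ℕ) - 1 - i)‖ ≤ k * 2 ^ k := by
      refine (norm_sum_le_of_le _ (fun i hi => h0 i _ ?_)).trans ?_
      · have := Finset.mem_range.1 hi
        have := j.2
        omega
      · simp only [Finset.sum_const, Finset.card_range, nsmul_eq_mul]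
        gcongr
        exact j.2.le
    have h4 : ‖b j‖ ≤ 1 := (norm_le_pi_norm b j).trans hb
    calc _ ≤ 1 * ((k : ℝ) * 2 ^ k) := by gcongr
      _ = _ := one_mul _
  refine (norm_add_le _ _).trans ?_
  have h5 := norm_sum_le_of_le _ h2
  rw [Finset.sum_const, Finset.card_univ, Fintype.card_fin, nsmul_eq_mul] at h5
  have h6 : polyBound k = 4 * ((k + 1) ^ 2 * 2 ^ k) := by rw [polyBound, pow_add]; ring
  rw [h6]
  have h7 : (0 : ℝ) ≤ k := Nat.cast_nonneg k
  have h8 : (0 : ℝ) < 2 ^ k := by positivity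
  have h9 : ((k : ℝ) + 1) * 2 ^ k + k * (k * 2 ^ k) ≤ (k + 1) ^ 2 * 2 ^ k := by nlinarith
  have h10 : (0 : ℝ) ≤ (k + 1) ^ 2 * 2 ^ k := by positivity
  linarith

/-- Division with remainder of a holomorphic function by `nfPoly b`. -/
theorem exists_division {k : ℕ} {b : Fin k → ℂ} {f : ℂ → ℂ} {δ : ℝ} (hb : ‖b‖ ≤ 1)
    (hf : DifferentiableOn ℂ f (Metric.ball 0 2)) (hδ : ∀ z ∈ Metric.ball (0 : ℂ) 2, ‖f z‖ ≤ δ)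
    (hP : ∀ z : ℂ, ‖z‖ = 3 / 2 → 1 ≤ ‖nfPoly b z‖) :
    ∃ (u : Fin (k + 1) → ℂ) (v : ℂ → ℂ), ‖u‖ ≤ polyBound k * δ ∧
      DifferentiableOn ℂ v (Metric.ball 0 (3 / 2)) ∧ (∀ z : ℂ, ‖z‖ ≤ 5 / 4 → ‖v z‖ ≤ 6 * δ) ∧
      ∀ z ∈ Metric.ball (0 : ℂ) (3 / 2), z + f z = idPoly u z + nfPoly b z * v z := by
  have hδ0 : 0 ≤ δ := (norm_nonneg _).trans (hδ 0 (by simp))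
  -- Cauchy integrals over |ξ| = 3/2, where |P_b| ≥ 1, are written on the unit circle with ξ = 3ζ/2.
  let sc : CircleFun := (3 / 2 : ℂ) • circleId
  have hsc : ∀ ζ, sc ζ = 3 / 2 * (ζ : ℂ) := fun _ => rfl
  have hscn : ∀ ζ, ‖sc ζ‖ = 3 / 2 := by
    intro ζ; rw [hsc, norm_mul, norm_coe_circle]; norm_num
  have hscb : ∀ ζ, sc ζ ∈ Metric.ball (0 : ℂ) 2 := by
    intro ζ; rw [mem_ball_zero_iff, hscn]; norm_num
  have hP0 : ∀ ζ, nfPoly b (sc ζ) ≠ 0 := by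
    intro ζ h
    have := hP _ (hscn ζ)
    rw [h, norm_zero] at this
    linarith
  let h : CircleFun := ⟨fun ζ => f (sc ζ) / nfPoly b (sc ζ), by
    refine Continuous.div ?_ ((differentiable_nfPoly b).continuous.comp sc.continuous) hP0
    exact hf.continuousOn.comp_continuous sc.continuous hscb⟩
  have hh : ∀ ζ, h ζ * nfPoly b (sc ζ) = f (sc ζ) := fun ζ => div_mul_cancel₀ _ (hP0 ζ)
  have hhn : ‖h‖ ≤ δ := by
    refine (ContinuousMap.norm_le _ hδ0).2 fun ζ => ?_
    change ‖f (sc ζ) / nfPoly b (sc ζ)‖ ≤ δ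
    rw [norm_div]
    exact (div_le_self (norm_nonneg _) (hP _ (hscn ζ))).trans (hδ _ (hscb ζ))
  let e : ℕ → Fin (k + 1) → ℂ := fun m => Pi.single (Fin.ofNat (k + 1) m) 1
  let J : ℕ → ℂ := fun i => circleResidue (h * sc ^ i)
  have hJ : ∀ i, i ≤ k → ‖J i‖ ≤ δ * (3 / 2) ^ k := by
    intro i hi
    refine (norm_circleResidue_le _).trans ((norm_mul_le _ _).trans ?_)
    gcongr
    refine (ContinuousMap.norm_le _ (by positivity)).2 fun ζ => ?_
    rw [ContinuousMap.pow_apply, norm_pow, hscn]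
    exact pow_le_pow_right₀ (by norm_num) hi
  have hen : ∀ m, ‖e m‖ ≤ 1 := by
    intro m
    simp [e, Pi.norm_single]
  -- The remainder is (2πi)⁻¹ ∮ (f/P)(ξ) (P(ξ) - P(z))/(ξ - z) dξ. The divided difference is a
  -- polynomial of degree at most k in z with coefficients in ξ, so the coefficients of the
  -- remainder are combinations of the integrals `J i`. The factor 3/2 is dξ/dζ.
  let u : Fin (k + 1) → ℂ := (3 / 2 : ℂ) • (∑ i ∈ Finset.range (k + 1), J i • e (k - i) +
    ∑ j : Fin k, b j • ∑ i ∈ Finset.range (j : ℕ), J i • e ((j : ℕ) - 1 - i))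
  -- The quotient is the Cauchy integral of f/P. There is no factor 3/2 since dξ/(ξ - z) = dζ/(ζ -
  -- 2z/3).
  let v : ℂ → ℂ := fun z => cauchyTransform h (2 / 3 * z)
  have hnz : ∀ z : ℂ, ‖(2 / 3 : ℂ) * z‖ = 2 / 3 * ‖z‖ := by
    intro z; rw [norm_mul]; norm_num
  refine ⟨u, v, ?_, ?_, ?_, ?_⟩
  · have hJe : ∀ i m, i ≤ k → ‖J i • e m‖ ≤ δ * (3 / 2) ^ k := by
      intro i m hi
      rw [norm_smul]
      exact (mul_le_of_le_one_right (norm_nonneg _) (hen m)).trans (hJ i hi)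
    set c := δ * (3 / 2 : ℝ) ^ k with hc
    have hc0 : 0 ≤ c := by positivity
    have h1 : ‖∑ i ∈ Finset.range (k + 1), J i • e (k - i)‖ ≤ (k + 1) * c := by
      refine (norm_sum_le_of_le _ (fun i hi => hJe i (k - i) ?_)).trans (by simp)
      exact Nat.lt_succ_iff.1 (Finset.mem_range.1 hi)
    have h2 : ∀ j ∈ (Finset.univ : Finset (Fin k)),
        ‖b j • ∑ i ∈ Finset.range (j : ℕ), J i • e ((j : ℕ) - 1 - i)‖ ≤ k * c := by
      intro j _
      rw [norm_smul]
      have h3 : ‖∑ i ∈ Finset.range (j : ℕ), J i • e ((j : ℕ) - 1 - i)‖ ≤ k * c := by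
        refine (norm_sum_le_of_le _ (fun i hi => hJe i _ ?_)).trans ?_
        · have := Finset.mem_range.1 hi
          have := j.2
          omega
        · simp only [Finset.sum_const, Finset.card_range, nsmul_eq_mul]
          gcongr
          exact j.2.le
      have h4 : ‖b j‖ ≤ 1 := (norm_le_pi_norm b j).trans hb
      calc _ ≤ 1 * ((k : ℝ) * c) := by gcongr
        _ = _ := one_mul _
    have h5 := norm_sum_le_of_le _ h2
    rw [Finset.sum_const, Finset.card_univ, Fintype.card_fin, nsmul_eq_mul] at h5
    have h6 : ‖u‖ ≤ 3 / 2 * ((k + 1) * c + k * (k * c)) := by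
      simp only [u]
      rw [norm_smul]
      have h7 : ‖(3 / 2 : ℂ)‖ = 3 / 2 := by norm_num
      rw [h7]
      gcongr
      exact (norm_add_le _ _).trans (add_le_add h1 h5)
    refine h6.trans ?_
    have h8 : c ≤ 2 ^ k * δ := by
      rw [hc, mul_comm]
      gcongr
      norm_num
    have h9 : (0 : ℝ) ≤ k := Nat.cast_nonneg k
    have h10 : polyBound k * δ = 4 * ((k + 1) ^ 2 * (2 ^ k * δ)) := by
      rw [polyBound, pow_add]; ring
    rw [h10]
    have h11 : ((k : ℝ) + 1) * c + k * (k * c) ≤ (k + 1) ^ 2 * (2 ^ k * δ) := by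
      calc ((k : ℝ) + 1) * c + k * (k * c) ≤ (k + 1) ^ 2 * c := by nlinarith
        _ ≤ _ := by gcongr
    have h12 : (0 : ℝ) ≤ (k + 1) ^ 2 * (2 ^ k * δ) := by positivity
    linarith
  · intro z hz
    rw [mem_ball_zero_iff] at hz
    have h1 := analyticAt_cauchyTransform h (z := 2 / 3 * z) (by rw [hnz]; linarith)
    exact (AnalyticAt.comp_of_eq (f := fun z : ℂ => (h, 2 / 3 * z)) h1
      (analyticAt_const.prod (analyticAt_const.mul analyticAt_id))
      rfl).differentiableAt.differentiableWithinAt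
  · intro z hz
    -- Hence |ζ - 2z/3| ≥ 1/6, the origin of the constant 6.
    have hz1 : ‖(2 / 3 : ℂ) * z‖ ≤ 5 / 6 := by rw [hnz]; linarith
    refine (norm_circleResidue_le _).trans ((norm_mul_le _ _).trans ?_)
    rw [mul_comm]
    gcongr
    refine (ContinuousMap.norm_le _ (by norm_num)).2 fun ζ => ?_
    rw [circleFun_inverse_apply (circleId_sub_ne_zero (by linarith)), norm_inv]
    refine inv_le_of_inv_le₀ (by norm_num) ?_
    have h1 := norm_sub_norm_le (ζ : ℂ) (2 / 3 * z)
    rw [norm_coe_circle] at h1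
    refine le_trans ?_ h1
    linarith
  · intro z hz
    rw [mem_ball_zero_iff] at hz
    have hz1 : ‖(2 / 3 : ℂ) * z‖ < 1 := by rw [hnz]; linarith
    have hU : (3 / 2 : ℂ) * circleResidue (h * nfDivDiff b (constCLM _ ℂ z) sc)
        = ∑ j, u j • z ^ (j : ℕ) := by
      let ev : (Fin (k + 1) → ℂ) →ₗ[ℂ] ℂ :=
        { toFun := fun u => ∑ j, u j • z ^ (j : ℕ)
          map_add' := by intro a b; simp [add_mul, Finset.sum_add_distrib]
          map_smul' := by intro c a; simp [Finset.mul_sum, mul_assoc] }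
      have hev : ∀ m, m ≤ k → ev (e m) = z ^ m := by
        intro m hm
        have h1 : ((Fin.ofNat (k + 1) m : Fin (k + 1)) : ℕ) = m :=
          Nat.mod_eq_of_lt (Nat.lt_succ_of_le hm)
        change ∑ j, e m j • z ^ (j : ℕ) = _
        rw [Finset.sum_eq_single (Fin.ofNat (k + 1) m)]
        · simp only [e, Pi.single_eq_same, h1, one_smul]
        · intro j _ hj
          rw [show e m j = 0 from Pi.single_eq_of_ne hj _, zero_smul]
        · simp
      change _ = ev u
      have hres : ∀ i m, circleResidue (h * (sc ^ i * constCLM _ ℂ z ^ m)) = J i • z ^ m := by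
        intro i m
        have h2 : h * (sc ^ i * constCLM _ ℂ z ^ m) = z ^ m • (h * sc ^ i) := by
          ext ζ; simp; ring
        rw [h2, map_smul, smul_eq_mul, smul_eq_mul, mul_comm]
      simp only [u, map_smul, map_add, map_sum, smul_eq_mul]
      rw [nfDivDiff, mul_add, Finset.mul_sum, map_add, map_sum]
      congr 2
      · refine Finset.sum_congr rfl fun i hi => ?_
        rw [hres, hev _ (Nat.sub_le _ _), smul_eq_mul]
      · rw [Finset.mul_sum, map_sum]
        refine Finset.sum_congr rfl fun j _ => ?_
        rw [mul_smul_comm, map_smul, smul_eq_mul, Finset.mul_sum, map_sum]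
        congr 1
        refine Finset.sum_congr rfl fun i hi => ?_
        have := j.2
        rw [hres, hev _ (by omega), smul_eq_mul]
    have hfz : f z = nfPoly b z * v z
        + (3 / 2 : ℂ) * circleResidue (h * nfDivDiff b (constCLM _ ℂ z) sc) := by
      have h1 : circleResidue (nfPoly b z • (h * Ring.inverse (circleId - constCLM _ _ (2 / 3 * z)))
          + (3 / 2 : ℂ) • (h * nfDivDiff b (constCLM _ ℂ z) sc)) = f (3 / 2 * (2 / 3 * z)) := by
        refine circleResidue_cauchy (g := fun η => f (3 / 2 * η)) hz1 ?_ ?_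
        · intro ζ
          have h2 : (ζ : ℂ) - 2 / 3 * z ≠ 0 := circleId_sub_ne_zero hz1 ζ
          have h3 := congrArg (fun q : CircleFun => q ζ)
            (sub_mul_nfDivDiff b (constCLM (Metric.sphere (0 : ℂ) 1) ℂ z) sc)
          simp only [ContinuousMap.mul_apply, ContinuousMap.sub_apply, nfPolyAlg_apply,
            constCLM_apply] at h3
          simp only [ContinuousMap.add_apply, ContinuousMap.smul_apply, ContinuousMap.mul_apply,
            circleFun_inverse_apply (circleId_sub_ne_zero hz1), ContinuousMap.sub_apply,
            circleId_apply, constCLM_apply, smul_eq_mul]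
          rw [← hsc, ← hh]
          rw [hsc] at h3 ⊢
          have h4 : ((ζ : ℂ) - 2 / 3 * z)⁻¹ * ((ζ : ℂ) - 2 / 3 * z) = 1 := inv_mul_cancel₀ h2
          linear_combination (h ζ * ((ζ : ℂ) - 2 / 3 * z)⁻¹) * h3
            - (3 / 2 * (h ζ * nfDivDiff b (constCLM (Metric.sphere (0 : ℂ) 1) ℂ z) sc ζ)) * h4
        · refine DifferentiableOn.diffContOnCl_ball (U := Metric.ball 0 (4 / 3)) ?_
            (Metric.closedBall_subset_ball (by norm_num))
          refine hf.comp (by fun_prop) fun η hη => ?_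
          rw [mem_ball_zero_iff] at hη ⊢
          rw [norm_mul]
          norm_num
          linarith
      rw [map_add, map_smul, map_smul, smul_eq_mul, smul_eq_mul,
        show (3 / 2 : ℂ) * (2 / 3 * z) = z by ring] at h1
      exact h1.symm
    rw [hfz, hU, idPoly]
    ring

/-- The derivative of `nfPolyAlg b`. -/
noncomputable def nfPolyDeriv {R : Type*} [CommRing R] [Algebra ℂ R] {k : ℕ} (b : Fin k → ℂ)
    (x : R) : R :=
  ((k + 1 : ℕ) : R) * x ^ k + ∑ j : Fin k, b j • (((j : ℕ) : R) * x ^ ((j : ℕ) - 1))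

theorem HasDerivAt.nfPolyAlg {R : Type*} [NormedCommRing R] [NormedAlgebra ℂ R] {k : ℕ}
    (b : Fin k → ℂ) {x : ℂ → R} {x' : R} {t : ℂ} (hx : HasDerivAt x x' t) :
    HasDerivAt (fun t => nfPolyAlg b (x t)) (nfPolyDeriv b (x t) * x') t := by
  have h1 : ∀ j ∈ (Finset.univ : Finset (Fin k)), HasDerivAt (fun t => b j • x t ^ (j : ℕ))
      (b j • (((j : ℕ) : R) * x t ^ ((j : ℕ) - 1) * x')) t :=
    fun j _ => (hx.fun_pow (j : ℕ)).fun_const_smul (b j)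
  convert! (hx.fun_pow (k + 1)).fun_add (HasDerivAt.fun_sum h1) using 1
  simp only [nfPolyDeriv, add_mul, Finset.sum_mul, smul_mul_assoc, Nat.add_sub_cancel]

theorem nfPolyDeriv_apply {k : ℕ} (b : Fin k → ℂ) (f : CircleFun) (ζ : Metric.sphere (0 : ℂ) 1) :
    nfPolyDeriv b f ζ = nfPolyDeriv b (f ζ) := by
  simp [nfPolyDeriv]

/-! ### Invariance of the moments and uniqueness of (b, A) -/

/-- The moments of the pull-backs of `dz / X` are constant along a linear homotopy. -/
theorem circleResidue_eq_of_homotopy {k : ℕ} {β : Fin k → ℂ} {α : ℂ} {g w : ℂ → ℂ} {r : ℝ}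
    (hr : 1 < r) (hg : DifferentiableOn ℂ g (Metric.ball 0 r))
    (hw : DifferentiableOn ℂ w (Metric.ball 0 r))
    (hne : ∀ t ∈ Set.Icc (0 : ℝ) 1, ∀ ζ : Metric.sphere (0 : ℂ) 1, nfPoly β (g ζ + t * w ζ) ≠ 0)
    (hh : ∀ t ∈ Set.Icc (0 : ℝ) 1, ∃ h : ℂ → ℂ, DifferentiableOn ℂ h (Metric.ball 0 r) ∧
      ∀ z ∈ Metric.ball (0 : ℂ) r,
        h z * nfPoly β (g z + t * w z) = w z * (1 + α * (g z + t * w z) ^ k))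
    {f₀ f₁ : CircleFun}
    (hf₀ : ∀ ζ : Metric.sphere (0 : ℂ) 1,
      f₀ ζ * nfPoly β (g ζ) = deriv g ζ * (1 + α * g ζ ^ k))
    (hf₁ : ∀ ζ : Metric.sphere (0 : ℂ) 1,
      f₁ ζ * nfPoly β (g ζ + w ζ) = (deriv g ζ + deriv w ζ) * (1 + α * (g ζ + w ζ) ^ k)) (n : ℕ) :
    circleResidue (circleId ^ n * f₀) = circleResidue (circleId ^ n * f₁) := by
  have hS : ∀ ζ : Metric.sphere (0 : ℂ) 1, (ζ : ℂ) ∈ Metric.ball (0 : ℂ) r := fun ζ => by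
    rw [mem_ball_zero_iff, norm_coe_circle]; exact hr
  have hrestr : ∀ f : ℂ → ℂ, DifferentiableOn ℂ f (Metric.ball 0 r) →
      Continuous fun ζ : Metric.sphere (0 : ℂ) 1 => f ζ := fun f hf =>
    hf.continuousOn.comp_continuous continuous_subtype_val hS
  have hO : IsOpen (Metric.ball (0 : ℂ) r) := Metric.isOpen_ball
  let gC : CircleFun := ⟨fun ζ => g ζ, hrestr _ hg⟩
  let wC : CircleFun := ⟨fun ζ => w ζ, hrestr _ hw⟩
  let gC' : CircleFun := ⟨fun ζ => deriv g ζ, hrestr _ (hg.deriv hO)⟩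
  let wC' : CircleFun := ⟨fun ζ => deriv w ζ, hrestr _ (hw.deriv hO)⟩
  let x : ℂ → CircleFun := fun t => gC + t • wC
  let x' : ℂ → CircleFun := fun t => gC' + t • wC'
  have hx : ∀ t ζ, x t ζ = g ζ + t * w ζ := fun _ _ => rfl
  have hx' : ∀ t ζ, x' t ζ = deriv g ζ + t * deriv w ζ := fun _ _ => rfl
  let F : ℂ → CircleFun := fun t =>
    x' t * (1 + α • x t ^ k) * Ring.inverse (nfPolyAlg β (x t))
  have hPn : ∀ t ∈ Set.Icc (0 : ℝ) 1, ∀ ζ, nfPolyAlg β (x t) ζ ≠ 0 := by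
    intro t ht ζ
    rw [nfPolyAlg_apply, hx]
    exact hne t ht ζ
  have hFv : ∀ t ∈ Set.Icc (0 : ℝ) 1, ∀ ζ, F t ζ * nfPoly β (g ζ + t * w ζ)
      = (deriv g ζ + t * deriv w ζ) * (1 + α * (g ζ + t * w ζ) ^ k) := by
    intro t ht ζ
    have h1 := hne t ht ζ
    simp only [F, ContinuousMap.mul_apply, circleFun_inverse_apply (hPn t ht), nfPolyAlg_apply, hx,
      hx', ContinuousMap.add_apply, ContinuousMap.one_apply, ContinuousMap.smul_apply,
      ContinuousMap.pow_apply, smul_eq_mul]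
    rw [inv_mul_cancel_right₀ h1]
  have hderiv : ∀ t ∈ Set.Icc (0 : ℝ) 1,
      HasDerivAt (fun t : ℂ => circleResidue (circleId ^ n * F t)) 0 (t : ℂ) := by
    intro t ht
    have hxd : HasDerivAt x wC t := by
      convert! ((hasDerivAt_id (t : ℂ)).smul_const wC).const_add gC using 1
      rw [one_smul]
    have hxd' : HasDerivAt x' wC' t := by
      convert! ((hasDerivAt_id (t : ℂ)).smul_const wC').const_add gC' using 1
      rw [one_smul]
    obtain ⟨p, hp⟩ := circleFun_isUnit (hPn t ht)
    have hinv : HasDerivAt (fun t => Ring.inverse (nfPolyAlg β (x t)))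
        (-(Ring.inverse (nfPolyAlg β (x t)) * (nfPolyDeriv β (x t) * wC)
          * Ring.inverse (nfPolyAlg β (x t)))) (t : ℂ) := by
      have h1 := HasFDerivAt.comp_hasDerivAt_of_eq (t : ℂ) (hasFDerivAt_ringInverse (𝕜 := ℂ) p)
        (HasDerivAt.nfPolyAlg β hxd) hp
      rw [← hp, Ring.inverse_unit]
      convert! h1 using 1
    have hFd := (hxd'.fun_mul (((hxd.fun_pow k).fun_const_smul α).const_add 1)).fun_mul hinv
    have h2 := (circleResidue.hasFDerivAt.comp_hasDerivAt (t : ℂ) (hFd.const_mul (circleId ^ n)))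
    convert! h2 using 1
    -- The t-derivative of the pulled-back form is dh with h = w (1 + α x^k) / P_β(x). Exactness on
    -- the circle would not handle the weight ζ^n; the holomorphy of h in the disk does, since ζ^n
    -- h' then integrates to zero.
    obtain ⟨h, hhd, hhe⟩ := hh t ht
    symm
    refine circleResidue_eq_zero (g := fun z => z ^ n * deriv h z) ?_ ?_
    · intro ζ
      have e1 := hne t ht ζ
      have hnhds := hO.mem_nhds (hS ζ)
      have hgz := (hg.differentiableAt hnhds).hasDerivAt
      have hwz := (hw.differentiableAt hnhds).hasDerivAt
      have hhz := (hhd.differentiableAt hnhds).hasDerivAt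
      have hy := hgz.fun_add (hwz.const_mul (t : ℂ))
      have hl := hhz.fun_mul (HasDerivAt.nfPolyAlg β hy)
      have hr' := hwz.fun_mul (((hy.fun_pow k).const_mul α).const_add 1)
      have h3 := hl.unique (hr'.congr_of_eventuallyEq (by
        filter_upwards [hnhds] with z hz
        rw [nfPolyAlg_eq]
        exact hhe z hz))
      have h4 := hhe ζ (hS ζ)
      rw [nfPolyAlg_eq] at h3
      simp only [ContinuousMap.mul_apply, circleFun_inverse_apply (hPn t ht), nfPolyAlg_apply, hx,
        hx', ContinuousMap.add_apply, ContinuousMap.one_apply, ContinuousMap.smul_apply,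
        ContinuousMap.pow_apply, smul_eq_mul, nfPolyDeriv_apply, ContinuousMap.neg_apply,
        ContinuousMap.natCast_apply, circleId_apply]
      have h5 : wC ζ = w ζ := rfl
      have h6 : wC' ζ = deriv w ζ := rfl
      rw [h5, h6]
      congr 1
      set y := g ζ + t * w ζ with hyd
      set P := nfPoly β y with hPd
      set Q := nfPolyDeriv β y
      have h7 : h ζ = w ζ * (1 + α * y ^ k) * P⁻¹ := by
        rw [← h4, mul_inv_cancel_right₀ e1]
      have h8 : P⁻¹ * P = 1 := inv_mul_cancel₀ e1
      have h9 : deriv h ζ = P⁻¹ * (deriv h ζ * P) := by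
        rw [mul_comm (deriv h ζ), inv_mul_cancel_left₀ e1]
      rw [h9, eq_sub_of_add_eq h3, h7]
      ring
    · exact DifferentiableOn.diffContOnCl_ball
        (DifferentiableOn.mul (by fun_prop) (hhd.deriv hO)) (Metric.closedBall_subset_ball hr)
  have hconst := constant_of_has_deriv_right_zero
    (f := fun t : ℝ => circleResidue (circleId ^ n * F t)) (a := 0) (b := 1)
    (fun t ht => ((hderiv t ht).comp_ofReal).continuousAt.continuousWithinAt)
    (fun t ht => ((hderiv t ⟨ht.1, ht.2.le⟩).comp_ofReal).hasDerivWithinAt) 1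
    (Set.right_mem_Icc.2 zero_le_one)
  have h0 : F ((0 : ℝ) : ℂ) = f₀ := by
    ext ζ
    have h1 := hne 0 (by simp) ζ
    have h2 := hFv 0 (by simp) ζ
    simp only [Complex.ofReal_zero, zero_mul, add_zero] at h1 h2 ⊢
    rw [← hf₀] at h2
    exact mul_right_cancel₀ h1 h2
  have h1 : F ((1 : ℝ) : ℂ) = f₁ := by
    ext ζ
    have h1 := hne 1 (by simp) ζ
    have h2 := hFv 1 (by simp) ζ
    simp only [Complex.ofReal_one, one_mul] at h1 h2 ⊢
    rw [← hf₁] at h2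
    exact mul_right_cancel₀ h1 h2
  have h2 : circleResidue (circleId ^ n * F ((1 : ℝ) : ℂ))
    = circleResidue (circleId ^ n * F ((0 : ℝ) : ℂ)) := hconst
  rw [h0, h1] at h2
  exact h2.symm

theorem one_add_mul_pow_ne_zero {k : ℕ} {A z : ℂ} (hA : ‖A‖ * 2 ^ k < 1) (hz : ‖z‖ ≤ 2) :
    1 + A * z ^ k ≠ 0 := by
  intro h
  have h1 : ‖A * z ^ k‖ < 1 := by
    rw [norm_mul, norm_pow]
    refine lt_of_le_of_lt ?_ hA
    gcongr
  rw [eq_neg_of_add_eq_zero_right h, norm_neg, norm_one] at h1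
  exact lt_irrefl _ h1

theorem norm_deriv_sub_one_le {φ : ℂ → ℂ} {δ : ℝ} (hφ : DifferentiableOn ℂ φ (Metric.ball 0 2))
    (hδ : ∀ z ∈ Metric.ball (0 : ℂ) 2, ‖φ z - z‖ ≤ δ) {z : ℂ} (hz : ‖z‖ < 3 / 2) :
    ‖deriv φ z - 1‖ ≤ 2 * δ := by
  have hz2 : Metric.ball (0 : ℂ) 2 ∈ 𝓝 z :=
    Metric.isOpen_ball.mem_nhds (by rw [mem_ball_zero_iff]; linarith)
  have hsub : Metric.closedBall z (1 / 2) ⊆ Metric.ball 0 2 := by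
    intro w hw
    rw [mem_closedBall_iff_norm] at hw
    rw [mem_ball_zero_iff]
    have := norm_add_le (w - z) z
    rw [sub_add_cancel] at this
    linarith
  have h1 := Complex.norm_deriv_le_of_forall_mem_sphere_norm_le (f := fun z => φ z - z) (c := z)
    (R := 1 / 2) (C := δ) (by norm_num)
    (DifferentiableOn.diffContOnCl_ball (hφ.sub (by fun_prop)) hsub)
    (fun w hw => hδ w (hsub (Metric.sphere_subset_closedBall hw)))
  rw [((hφ.differentiableAt hz2).hasDerivAt.fun_sub (hasDerivAt_id' z)).deriv] at h1
  linarith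

set_option maxHeartbeats 800000 in
/-- The normal form is determined by the vector field, up to changes of coordinate close to the
identity. -/
theorem exists_eq_of_conj_near_id (k : ℕ) : ∃ δ > 0, ∀ (b β : Fin k → ℂ) (A α : ℂ) (φ : ℂ → ℂ),
    ‖b‖ ≤ δ → ‖β‖ ≤ δ → ‖A‖ ≤ δ → ‖α‖ ≤ δ → DifferentiableOn ℂ φ (Metric.ball 0 2) →
    (∀ z ∈ Metric.ball (0 : ℂ) 2, ‖φ z - z‖ ≤ δ) →
    (∀ z ∈ Metric.ball (0 : ℂ) 2, deriv φ z * nfVal b A z = nfVal β α (φ z)) →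
    b = β ∧ A = α := by
  obtain ⟨Θ, -, -, -, hΘ⟩ := exists_momentMap_inverse k
  obtain ⟨r, hr, hΘr⟩ := Metric.eventually_nhds_iff.1 hΘ
  set M := polyBound k with hM
  have hM4 : 4 ≤ M := four_le_polyBound k
  have hM2 : (2 : ℝ) ^ (k + 2) ≤ M := pow_le_polyBound k
  have hM2' : (2 : ℝ) ^ k * 4 ≤ M := by rw [pow_add] at hM2; linarith
  have hMpos : 0 < M := by linarith
  -- With M δ ≤ 1/100 all perturbation estimates have room to spare, and M δ < r puts (u, β, α),
  -- where ‖u‖ ≤ M δ, in the domain on which `Θ` inverts the moment map.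
  set δ := min (1 / 100) (r / 2) / M with hδ
  have hδM : M * δ = min (1 / 100) (r / 2) := by rw [hδ]; field_simp
  have hδ0 : 0 < δ := by positivity
  have hδM1 : M * δ ≤ 1 / 100 := hδM ▸ min_le_left _ _
  have hδMr : M * δ < r := by
    have := hδM ▸ min_le_right (1 / 100 : ℝ) (r / 2)
    linarith
  have hδ4 : 4 * δ ≤ M * δ := by gcongr
  have hδ2 : 4 * (2 ^ k * δ) ≤ M * δ := by
    calc _ = 2 ^ k * 4 * δ := by ring
      _ ≤ _ := by gcongr
  refine ⟨δ, hδ0, ?_⟩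
  intro b β A α φ hb hβ hA hα hφ hφδ hconj
  have hAk : ‖A‖ * 2 ^ k ≤ 1 / 100 := by
    calc _ ≤ δ * 2 ^ k := by gcongr
      _ ≤ _ := by linarith
  have hαk : ‖α‖ * 2 ^ k ≤ 1 / 100 := by
    calc _ ≤ δ * 2 ^ k := by gcongr
      _ ≤ _ := by linarith
  have hA0 : ∀ z : ℂ, ‖z‖ ≤ 2 → 1 + A * z ^ k ≠ 0 := fun z =>
    one_add_mul_pow_ne_zero (by linarith)
  have hα0 : ∀ z : ℂ, ‖z‖ ≤ 2 → 1 + α * z ^ k ≠ 0 := fun z =>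
    one_add_mul_pow_ne_zero (by linarith)
  have hP := fun (z : ℂ) (hz : ‖z‖ ≤ 2) => norm_nfPoly_sub_le hb hz
  have hPlow : ∀ z : ℂ, ‖z‖ ≤ 2 → ‖z‖ ^ (k + 1) - 1 / 100 ≤ ‖nfPoly b z‖ := by
    intro z hz
    have h1 := (hP z hz).trans hδM1
    have h2 := norm_sub_norm_le (z ^ (k + 1)) (nfPoly b z)
    rw [norm_sub_rev] at h2
    rw [norm_pow] at h2
    linarith
  -- The part of φ divisible by P_b moves points along a multiple of the field, so it should not
  -- affect the moments; what remains of φ is `idPoly u`.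
  obtain ⟨u, v, hu, hv, hvδ, hdiv⟩ := exists_division (f := fun z => φ z - z) (δ := δ) (b := b)
    (by linarith) (hφ.sub (by fun_prop)) hφδ (by
      intro z hz
      have h1 := hPlow z (by rw [hz]; norm_num)
      have h2 : (3 / 2 : ℝ) ≤ ‖z‖ ^ (k + 1) := by
        rw [hz]; exact le_self_pow₀ (by norm_num) (by omega)
      linarith)
  let w : ℂ → ℂ := fun z => nfPoly b z * v z
  have hφg : ∀ z ∈ Metric.ball (0 : ℂ) (3 / 2), φ z = idPoly u z + w z := by
    intro z hz
    have := hdiv z hz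
    rwa [add_sub_cancel] at this
  -- The radius 5/4 exceeds that of the unit circle, is below 3/2 where the division holds, and is
  -- where `v` is bounded by 6δ.
  obtain ⟨ρ, hρ⟩ : ∃ ρ : ℝ, ρ = 5 / 4 := ⟨_, rfl⟩
  have hb1 : Metric.ball (0 : ℂ) ρ ⊆ Metric.ball 0 (3 / 2) := Metric.ball_subset_ball (by linarith)
  have hb2 : Metric.ball (0 : ℂ) ρ ⊆ Metric.ball 0 2 := Metric.ball_subset_ball (by linarith)
  have hS : ∀ ζ : Metric.sphere (0 : ℂ) 1, (ζ : ℂ) ∈ Metric.ball (0 : ℂ) ρ := fun ζ => by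
    rw [mem_ball_zero_iff, norm_coe_circle, hρ]; norm_num
  have hg : Differentiable ℂ (idPoly u : ℂ → ℂ) :=
    fun z => (hasDerivAt_idPoly u z).differentiableAt
  have hw : DifferentiableOn ℂ w (Metric.ball 0 ρ) :=
    (differentiable_nfPoly b).differentiableOn.mul (hv.mono hb1)
  have hφn : ∀ z ∈ Metric.ball (0 : ℂ) ρ, ‖φ z‖ ≤ 3 / 2 := by
    intro z hz
    have h1 := hφδ z (hb2 hz)
    rw [mem_ball_zero_iff] at hz
    have h2 := norm_add_le (φ z - z) z
    rw [sub_add_cancel] at h2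
    linarith
  have hwn : ∀ z ∈ Metric.ball (0 : ℂ) ρ, ‖w z‖ ≤ 6 / 100 := by
    intro z hz
    rw [mem_ball_zero_iff] at hz
    have h1 := hP z (by linarith)
    have h2 : ‖nfPoly b z‖ ≤ M := by
      have h3 := norm_add_le (nfPoly b z - z ^ (k + 1)) (z ^ (k + 1))
      rw [sub_add_cancel, norm_pow] at h3
      have h4 : ‖z‖ ^ (k + 1) ≤ 2 ^ (k + 1) := by gcongr; linarith
      have h5 : (2 : ℝ) ^ (k + 2) = 2 * 2 ^ (k + 1) := by ring
      linarith
    rw [norm_mul]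
    calc ‖nfPoly b z‖ * ‖v z‖ ≤ M * (6 * δ) := by
          gcongr
          exact hvδ z (by linarith)
      _ ≤ _ := by linarith
  -- The conjugacy equation, solved for P_β(φ), reads P_β∘φ = P_b κ with κ a unit close to 1.
  let κ : ℂ → ℂ := fun z => deriv φ z * (1 + α * φ z ^ k) / (1 + A * z ^ k)
  have hκd : DifferentiableOn ℂ κ (Metric.ball 0 ρ) := by
    refine ((hφ.deriv Metric.isOpen_ball).mono hb2 |>.mul ?_).div (by fun_prop) ?_
    · exact ((hφ.mono hb2).pow k).const_mul α |>.const_add 1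
    · intro z hz
      exact hA0 z (by have := mem_ball_zero_iff.1 (hb2 hz); linarith)
  have hκP : ∀ z ∈ Metric.ball (0 : ℂ) ρ, nfPoly β (φ z) = nfPoly b z * κ z := by
    intro z hz
    have h1 := hA0 z (mem_ball_zero_iff.1 (hb2 hz)).le
    have h2 := hα0 (φ z) (by linarith [hφn z hz])
    have h3 := hconj z (hb2 hz)
    simp only [nfVal] at h3
    field_simp at h3
    simp only [κ]
    field_simp
    linear_combination -h3
  have hκ1 : ∀ z ∈ Metric.ball (0 : ℂ) ρ, ‖κ z - 1‖ ≤ 1 / 4 := by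
    intro z hz
    have hz1 := mem_ball_zero_iff.1 hz
    have h1 := hA0 z (mem_ball_zero_iff.1 (hb2 hz)).le
    have h2 : κ z - 1 = ((deriv φ z - 1) * (1 + α * φ z ^ k) + α * φ z ^ k - A * z ^ k)
        / (1 + A * z ^ k) := by
      simp only [κ]; field_simp; ring
    have h3 := norm_deriv_sub_one_le hφ hφδ (z := z) (by linarith)
    have h4 : ‖α * φ z ^ k‖ ≤ 1 / 100 := by
      rw [norm_mul, norm_pow]
      refine le_trans ?_ hαk
      gcongr
      linarith [hφn z hz]
    have h5 : ‖A * z ^ k‖ ≤ 1 / 100 := by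
      rw [norm_mul, norm_pow]
      refine le_trans ?_ hAk
      gcongr
      linarith
    have h6 : 99 / 100 ≤ ‖1 + A * z ^ k‖ := by
      have := norm_sub_norm_le (1 : ℂ) (-(A * z ^ k))
      rw [norm_one, norm_neg, sub_neg_eq_add] at this
      linarith
    have h7 : ‖1 + α * φ z ^ k‖ ≤ 101 / 100 := by
      have := norm_add_le (1 : ℂ) (α * φ z ^ k)
      rw [norm_one] at this
      linarith
    rw [h2, norm_div, div_le_iff₀ (by linarith)]
    have h8 : ‖(deriv φ z - 1) * (1 + α * φ z ^ k)‖ ≤ 2 * δ * (101 / 100) := by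
      rw [norm_mul]; gcongr
    have h9 := norm_sub_le ((deriv φ z - 1) * (1 + α * φ z ^ k) + α * φ z ^ k) (A * z ^ k)
    have h10 := norm_add_le ((deriv φ z - 1) * (1 + α * φ z ^ k)) (α * φ z ^ k)
    linarith
  -- the factor along the homotopy
  let κt : ℝ → ℂ → ℂ := fun t z =>
    κ z - (1 - t) * v z * nfDivDiff β (idPoly u z + t * w z) (φ z)
  have hgt : ∀ t ∈ Set.Icc (0 : ℝ) 1, ∀ z ∈ Metric.ball (0 : ℂ) ρ,
      idPoly u z + t * w z = φ z - (1 - t) * w z ∧ ‖idPoly u z + t * w z‖ ≤ 2 ∧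
      ‖(1 - t : ℂ)‖ ≤ 1 := by
    intro t ht z hz
    have h1 : idPoly u z + t * w z = φ z - (1 - t) * w z := by
      rw [hφg z (hb1 hz)]; ring
    have h2 : ‖(1 - t : ℂ)‖ ≤ 1 := by
      rw [← Complex.ofReal_one, ← Complex.ofReal_sub, Complex.norm_real, Real.norm_eq_abs, abs_le]
      constructor <;> linarith [ht.1, ht.2]
    refine ⟨h1, ?_, h2⟩
    rw [h1]
    refine (norm_sub_le _ _).trans ?_
    rw [norm_mul]
    have h3 : ‖(1 - t : ℂ)‖ * ‖w z‖ ≤ 1 * (6 / 100) := by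
      gcongr; exact hwn z hz
    linarith [hφn z hz]
  have hκt : ∀ t ∈ Set.Icc (0 : ℝ) 1, ∀ z ∈ Metric.ball (0 : ℂ) ρ,
      nfPoly β (idPoly u z + t * w z) = nfPoly b z * κt t z ∧ κt t z ≠ 0 := by
    intro t ht z hz
    obtain ⟨h1, h2, h3⟩ := hgt t ht z hz
    constructor
    · have h4 := sub_mul_nfDivDiff β (idPoly u z + t * w z) (φ z)
      rw [nfPolyAlg_eq, nfPolyAlg_eq, hκP z hz] at h4
      have h5 : φ z - (idPoly u z + t * w z) = (1 - t) * (nfPoly b z * v z) := by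
        rw [h1]; ring
      rw [h5] at h4
      simp only [κt]
      linear_combination h4
    -- κ is within 1/4 of 1 and the correction is at most 6 δ M ≤ 6/100, so the factor has no zero.
    -- P_β then keeps the same zeros as P_b along the homotopy, and w / P_β = v / κt is holomorphic.
    · intro h0
      have h4 : κ z - 1 = (1 - t) * v z * nfDivDiff β (idPoly u z + t * w z) (φ z) - 1 := by
        rw [sub_eq_zero.1 h0]
      have h5 : ‖(1 - t) * v z * nfDivDiff β (idPoly u z + t * w z) (φ z)‖ ≤ 1 * (6 * δ) * M := by
        rw [norm_mul, norm_mul]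
        gcongr
        · exact hvδ z (hρ ▸ mem_ball_zero_iff.1 hz).le
        · exact norm_nfDivDiff_le (by linarith) h2 (by linarith [hφn z hz])
      have h6 := hκ1 z hz
      have h7 := norm_sub_norm_le (1 : ℂ) ((1 - t) * v z * nfDivDiff β (idPoly u z + t * w z) (φ z))
      rw [norm_sub_rev, ← h4, norm_one] at h7
      linarith
  have hPS : ∀ ζ : Metric.sphere (0 : ℂ) 1, nfPoly b (ζ : ℂ) ≠ 0 := by
    intro ζ h
    have := hPlow ζ (by rw [norm_coe_circle]; norm_num)
    rw [h, norm_coe_circle, one_pow, norm_zero] at this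
    linarith
  have hne : ∀ t ∈ Set.Icc (0 : ℝ) 1, ∀ ζ : Metric.sphere (0 : ℂ) 1,
      nfPoly β (idPoly u (ζ : ℂ) + t * w ζ) ≠ 0 := by
    intro t ht ζ
    obtain ⟨h1, h2⟩ := hκt t ht ζ (hS ζ)
    rw [h1]
    exact mul_ne_zero (hPS ζ) h2
  have hne0 : ∀ ζ : Metric.sphere (0 : ℂ) 1, nfPoly β (idPoly u (ζ : ℂ)) ≠ 0 := by
    intro ζ
    simpa using hne 0 (by simp) ζ
  have hne1 : ∀ ζ : Metric.sphere (0 : ℂ) 1,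
      nfPoly ((0, b, A) : NFParam k).2.1 (idPoly ((0, b, A) : NFParam k).1 (ζ : ℂ)) ≠ 0 := by
    intro ζ
    simpa [idPoly_zero] using hPS ζ
  -- At t = 0 the form is the pull-back of the target's dual form by `idPoly u`; at t = 1 it is its
  -- pull-back by φ, which is the dual form of the source.
  have hmom : momentMap k (u, β, α) = momentMap k (0, b, A) := by
    funext i
    simp only [momentMap, moments_apply]
    refine circleResidue_eq_of_homotopy (β := β) (α := α) (g := idPoly u) (w := w) (r := ρ)
      (by rw [hρ]; norm_num) hg.differentiableOn hw hne ?_ ?_ ?_ _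
    · intro t ht
      refine ⟨fun z => v z * (1 + α * (idPoly u z + t * w z) ^ k) / κt t z, ?_, ?_⟩
      · have hgtd : DifferentiableOn ℂ (fun z => idPoly u z + t * w z) (Metric.ball 0 ρ) :=
          hg.differentiableOn.add (hw.const_mul _)
        refine DifferentiableOn.div ((hv.mono hb1).mul ((hgtd.pow k).const_mul α |>.const_add 1))
          ?_ (fun z hz => (hκt t ht z hz).2)
        refine hκd.sub (((hv.mono hb1).const_mul _).mul ?_)
        have hφ' := hφ.mono hb2
        simp only [nfDivDiff]
        refine DifferentiableOn.add (DifferentiableOn.fun_sum fun i _ =>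
          (hφ'.pow i).mul (hgtd.pow _)) (DifferentiableOn.fun_sum fun j _ =>
            DifferentiableOn.fun_const_smul (DifferentiableOn.fun_sum fun i _ =>
          (hφ'.pow i).mul (hgtd.pow _)) _)
      · intro z hz
        obtain ⟨h1, h2⟩ := hκt t ht z hz
        rw [h1]
        simp only [w]
        field_simp
    · intro ζ
      rw [pulledForm_apply (p := (u, β, α)) hne0, div_mul_cancel₀ _ (hne0 ζ), (hasDerivAt_idPoly u (ζ : ℂ)).deriv]
    · intro ζ
      rw [pulledForm_apply (p := (0, b, A)) hne1]
      have h1 : deriv (idPoly u) (ζ : ℂ) + deriv w ζ = deriv φ ζ := by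
        rw [← deriv_fun_add hg.differentiableAt
          (hw.differentiableAt (Metric.isOpen_ball.mem_nhds (hS ζ)))]
        refine (Filter.EventuallyEq.deriv_eq ?_).symm
        filter_upwards [Metric.isOpen_ball.mem_nhds (hb1 (hS ζ))] with z hz using hφg z hz
      rw [h1, ← hφg ζ (hb1 (hS ζ)), hκP ζ (hS ζ)]
      have h2 := hA0 ζ (by rw [norm_coe_circle]; norm_num)
      have h3 := hPS ζ
      simp only [idPoly_zero, idPolyDeriv_zero, κ]
      field_simp
  have hn1 : dist ((u, β, α) : NFParam k) 0 < r := by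
    rw [dist_zero_right, Prod.norm_def, Prod.norm_def]
    refine max_lt (hu.trans_lt hδMr) (max_lt ?_ ?_) <;> dsimp only <;> linarith
  have hn2 : dist ((0, b, A) : NFParam k) 0 < r := by
    rw [dist_zero_right, Prod.norm_def, Prod.norm_def]
    refine max_lt (by simpa using hr) (max_lt ?_ ?_) <;> dsimp only <;> linarith
  have h1 := (hΘr hn1).symm.trans ((congrArg Θ hmom).trans (hΘr hn2))
  simp only [Prod.mk.injEq] at h1
  exact ⟨h1.2.1.symm, h1.2.2.symm⟩

/-! ### Coordinates preserving a normal form are flow maps -/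

/-- Two solutions of `y' X(z) = X(y)` with a common value coincide. -/
theorem eventuallyEq_of_conj {X φ χ : ℂ → ℂ} {z₀ : ℂ} (hX : AnalyticAt ℂ X (φ z₀))
    (hXz : ContinuousAt X z₀) (h0 : X z₀ ≠ 0) (h1 : X (φ z₀) ≠ 0) (hφ : AnalyticAt ℂ φ z₀)
    (hχ : AnalyticAt ℂ χ z₀) (hφχ : φ z₀ = χ z₀)
    (hφX : ∀ᶠ z in 𝓝 z₀, deriv φ z * X z = X (φ z))
    (hχX : ∀ᶠ z in 𝓝 z₀, deriv χ z * X z = X (χ z)) : φ =ᶠ[𝓝 z₀] χ := by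
  set c := φ z₀ with hc
  obtain ⟨r, hr, hb⟩ := Metric.eventually_nhds_iff_ball.1
    (hX.eventually_analyticAt.and (hX.continuousAt.eventually_ne h1))
  have hd : DifferentiableOn ℂ (fun w => (X w)⁻¹) (Metric.ball c r) := fun w hw =>
    ((hb w hw).1.differentiableAt.inv (hb w hw).2).differentiableWithinAt
  -- `G` is the time coordinate, a primitive of 1/X. Both G∘φ and G∘χ have derivative 1/X and agree
  -- at z₀, and G is injective near the common value since G' ≠ 0 there.
  obtain ⟨G, hG⟩ := hd.isExactOn_ball
  have hGa : AnalyticAt ℂ G c := by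
    have : DifferentiableOn ℂ G (Metric.ball c r) := fun w hw =>
      (hG w hw).differentiableAt.differentiableWithinAt
    exact this.analyticAt (Metric.ball_mem_nhds c hr)
  have hGs : HasStrictDerivAt G (X c)⁻¹ c := by
    have := hGa.hasStrictDerivAt
    rwa [(hG c (Metric.mem_ball_self hr)).deriv] at this
  have hinj := hGs.eventually_left_inverse (inv_ne_zero h1)
  have hφt : Tendsto φ (𝓝 z₀) (𝓝 c) := hφ.continuousAt
  have hχt : Tendsto χ (𝓝 z₀) (𝓝 c) := by rw [hφχ]; exact hχ.continuousAt
  have hder : ∀ ψ : ℂ → ℂ, AnalyticAt ℂ ψ z₀ → Tendsto ψ (𝓝 z₀) (𝓝 c) →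
      (∀ᶠ z in 𝓝 z₀, deriv ψ z * X z = X (ψ z)) →
      ∀ᶠ z in 𝓝 z₀, HasDerivAt (fun z => G (ψ z)) (X z)⁻¹ z := by
    intro ψ hψ hψt hψX
    filter_upwards [hψ.eventually_analyticAt, hψt.eventually (Metric.ball_mem_nhds c hr), hψX,
      hXz.eventually_ne h0] with z h2 h3 h4 h5
    have h6 := (hG (ψ z) h3).comp z h2.differentiableAt.hasDerivAt
    convert! h6 using 1
    have h7 := (hb (ψ z) h3).2
    beta_reduce
    rw [← h4] at h7 ⊢
    have h8 := left_ne_zero_of_mul h7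
    field_simp
  obtain ⟨s, hs, hsb⟩ := Metric.eventually_nhds_iff_ball.1 ((hder φ hφ hφt hφX).and (hder χ hχ hχt hχX))
  have heq : ∀ z ∈ Metric.ball z₀ s, G (φ z) = G (χ z) := by
    intro z hz
    have h2 : DifferentiableOn ℂ (fun z => G (φ z) - G (χ z)) (Metric.ball z₀ s) := fun w hw =>
      ((hsb w hw).1.sub (hsb w hw).2).differentiableAt.differentiableWithinAt
    have h3 := (convex_ball z₀ s).is_const_of_fderivWithin_eq_zero (𝕜 := ℂ) h2 (fun w hw => by
      rw [fderivWithin_of_isOpen Metric.isOpen_ball hw]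
      have h4 := ((hsb w hw).1.fun_sub (hsb w hw).2).hasFDerivAt.fderiv
      rw [h4, sub_self]
      ext; simp) hz (Metric.mem_ball_self hs)
    simp only [← hφχ, ← hc, sub_self] at h3
    exact sub_eq_zero.1 h3
  filter_upwards [Metric.ball_mem_nhds z₀ hs, hφt.eventually hinj, hχt.eventually hinj]
    with z h2 h3 h4
  rw [← h3, ← h4, heq z h2]

/-- The changes of coordinate close to the identity that preserve a normal form are given by the
flow. -/
theorem exists_flowTime (k : ℕ) : ∃ (z₀ : ℂ) (𝒯 : ((Fin k → ℂ) × ℂ) × ℂ → ℂ),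
    ‖z₀‖ < 2 ∧ ∃ δ > 0, ∃ ρ > 0, (∀ (p : (Fin k → ℂ) × ℂ) (c : ℂ), ‖p‖ ≤ δ → ‖c - z₀‖ ≤ δ →
      AnalyticAt ℂ 𝒯 (p, c)) ∧
    ∀ (p : (Fin k → ℂ) × ℂ) (φ : ℂ → ℂ), ‖p‖ ≤ δ → DifferentiableOn ℂ φ (Metric.ball 0 2) →
      (∀ z ∈ Metric.ball (0 : ℂ) 2, ‖φ z - z‖ ≤ δ) →
      (∀ z ∈ Metric.ball (0 : ℂ) 2, deriv φ z * nfVal p.1 p.2 z = nfVal p.1 p.2 (φ z)) →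
      ∀ z, ‖z‖ < ρ → FlowsTo (nfVal p.1 p.2) (𝒯 (p, φ z₀)) z (φ z) := by
  obtain ⟨Φ, hΦ, hΦev⟩ := exists_nfFlow k
  have h1 : ∀ᶠ w in 𝓝 ((0 : ℂ), (0 : (Fin k → ℂ) × ℂ), (0 : ℂ)), 1 + w.2.1.2 * Φ w ^ k ≠ 0 := by
    have : ContinuousAt (fun w : ℂ × ((Fin k → ℂ) × ℂ) × ℂ => 1 + w.2.1.2 * Φ w ^ k) (0, 0, 0) :=
      continuousAt_const.add ((by fun_prop : ContinuousAt
        (fun w : ℂ × ((Fin k → ℂ) × ℂ) × ℂ => w.2.1.2) (0, 0, 0)).mul (hΦ.continuousAt.pow k))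
    exact this.eventually_ne (by simp)
  obtain ⟨r, hr, H⟩ := Metric.eventually_nhds_iff.1 ((hΦ.eventually_analyticAt.and hΦev).and h1)
  set r' := min r 1 with hr'
  have hr'0 : 0 < r' := lt_min hr one_pos
  have hr'1 : r' ≤ 1 := min_le_right _ _
  have hball : ∀ (τ : ℂ) (p : (Fin k → ℂ) × ℂ) (z : ℂ), ‖τ‖ < r' → ‖p‖ < r' → ‖z‖ < r' →
      dist (τ, p, z) ((0 : ℂ), (0 : (Fin k → ℂ) × ℂ), (0 : ℂ)) < r := by
    intro τ p z h2 h3 h4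
    rw [Prod.dist_eq, Prod.dist_eq]
    simp only [dist_zero_right]
    have := min_le_left r 1
    exact max_lt (by linarith) (max_lt (by linarith) (by linarith))
  -- A base point away from 0, hence nonsingular for all small parameters; the flow time can be
  -- measured there uniformly in `p`.
  set z₀ : ℂ := ((r' / 2 : ℝ) : ℂ) with hz₀
  have hz₀n : ‖z₀‖ = r' / 2 := by
    rw [hz₀, Complex.norm_real, Real.norm_of_nonneg (by linarith)]
  have hz₀0 : z₀ ≠ 0 := by rw [← norm_pos_iff, hz₀n]; linarith
  have hz₀r : ‖z₀‖ < r' := by linarith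
  have hd0 := hball 0 0 z₀ (by simpa using hr'0) (by simpa using hr'0) hz₀r
  obtain ⟨⟨hΦ0, hΦ00, hΦ0d, -⟩, -⟩ := H hd0
  simp only at hΦ00
  -- Inverting (T, p) ↦ (p, Φ(T, p, z₀)) solves Φ(T, p, z₀) = c for the time T, analytically in (p,
  -- c). The derivative in T at the origin is the value of the field at z₀, which is nonzero.
  let Ψ : ℂ × (Fin k → ℂ) × ℂ → ((Fin k → ℂ) × ℂ) × ℂ := fun w => (w.2, Φ (w.1, w.2, z₀))
  have hΦs : AnalyticAt ℂ (fun w : ℂ × (Fin k → ℂ) × ℂ => Φ (w.1, w.2, z₀)) (0, 0) :=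
    AnalyticAt.comp_of_eq (f := fun w : ℂ × (Fin k → ℂ) × ℂ => (w.1, w.2, z₀)) hΦ0
      (analyticAt_fst.prod (analyticAt_snd.prod analyticAt_const)) rfl
  have hΨ : AnalyticAt ℂ Ψ (0, 0) := analyticAt_snd.prod hΦs
  have hX0 : nfVal (0 : (Fin k → ℂ) × ℂ).1 (0 : (Fin k → ℂ) × ℂ).2 z₀ ≠ 0 := by
    simp [nfVal, nfPoly_zero, hz₀0]
  have hΨinj : Function.Injective (fderiv ℂ Ψ (0, 0)) := by
    rw [injective_iff_map_eq_zero]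
    rintro ⟨τ, p⟩ hp
    have h2 : HasFDerivAt Ψ ((ContinuousLinearMap.snd ℂ ℂ ((Fin k → ℂ) × ℂ)).prod
        (fderiv ℂ (fun w : ℂ × (Fin k → ℂ) × ℂ => Φ (w.1, w.2, z₀)) (0, 0))) (0, 0) :=
      hasFDerivAt_snd.prodMk hΦs.differentiableAt.hasFDerivAt
    rw [h2.fderiv] at hp
    simp only [ContinuousLinearMap.prod_apply, ContinuousLinearMap.coe_snd', Prod.mk_eq_zero] at hp
    obtain ⟨rfl, hp⟩ := hp
    have h3 : HasDerivAt (fun τ : ℂ => (τ, (0 : (Fin k → ℂ) × ℂ))) (1, 0) 0 :=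
      (hasDerivAt_id _).prodMk (hasDerivAt_const _ _)
    have h4' : HasDerivAt (fun τ : ℂ => Φ (τ, (0 : (Fin k → ℂ) × ℂ), z₀))
        (fderiv ℂ (fun w : ℂ × (Fin k → ℂ) × ℂ => Φ (w.1, w.2, z₀)) (0, 0) (1, 0)) 0 :=
      HasFDerivAt.comp_hasDerivAt (l := fun w : ℂ × (Fin k → ℂ) × ℂ => Φ (w.1, w.2, z₀)) (0 : ℂ)
        hΦs.differentiableAt.hasFDerivAt h3
    have h4 := h4'.unique hΦ0d
    have h5 : ((τ, 0) : ℂ × (Fin k → ℂ) × ℂ) = τ • (1, 0) := by simp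
    rw [h5, map_smul, h4, smul_eq_mul] at hp
    dsimp only at hp
    rw [hΦ00] at hp
    rw [(mul_eq_zero.1 hp).resolve_right hX0]
    rfl
  obtain ⟨Λ, hΛ, hΛ0, hΛr, -⟩ := exists_analyticAt_localInverse hΨ hΨinj
    (by simp [add_comm])
  have hΨ0 : Ψ (0, 0) = (0, z₀) := by simp only [Ψ, hΦ00]
  rw [hΨ0] at hΛ hΛ0 hΛr
  let 𝒯 : ((Fin k → ℂ) × ℂ) × ℂ → ℂ := fun w => (Λ w).1
  have h𝒯 : AnalyticAt ℂ 𝒯 (0, z₀) := analyticAt_fst.comp hΛ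
  have h𝒯0 : 𝒯 (0, z₀) = 0 := by simp [𝒯, hΛ0]
  have hXc : ∀ᶠ w in 𝓝 ((0 : (Fin k → ℂ) × ℂ), z₀), nfPoly w.1.1 w.2 ≠ 0 := by
    have : AnalyticAt ℂ (fun w : ((Fin k → ℂ) × ℂ) × ℂ => nfPoly w.1.1 w.2) (0, z₀) :=
      AnalyticAt.nfPoly (analyticAt_fst.comp analyticAt_fst) analyticAt_snd
    refine this.continuousAt.eventually_ne ?_
    simp [nfPoly_zero, hz₀0]
  have hXc' : ∀ᶠ w in 𝓝 ((0 : (Fin k → ℂ) × ℂ), z₀), 1 + w.1.2 * w.2 ^ k ≠ 0 := by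
    have : ContinuousAt (fun w : ((Fin k → ℂ) × ℂ) × ℂ => 1 + w.1.2 * w.2 ^ k) (0, z₀) := by fun_prop
    exact this.eventually_ne (by simp)
  have h𝒯s : ∀ᶠ w in 𝓝 ((0 : (Fin k → ℂ) × ℂ), z₀), ‖𝒯 w‖ < r' := by
    have := h𝒯.continuousAt.norm
    exact this.eventually_lt continuousAt_const (by simpa [h𝒯0] using hr'0)
  obtain ⟨δ, hδ, HT⟩ := Metric.eventually_nhds_iff.1
    (((h𝒯.eventually_analyticAt.and hΛr).and (hXc.and hXc')).and h𝒯s)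
  have hdist : ∀ (p : (Fin k → ℂ) × ℂ) (c : ℂ), ‖p‖ ≤ min (δ / 2) (r' / 2) → ‖c - z₀‖ ≤ min (δ / 2) (r' / 2) →
      dist (p, c) ((0 : (Fin k → ℂ) × ℂ), z₀) < δ := by
    intro p c h2 h3
    rw [Prod.dist_eq, dist_zero_right, dist_eq_norm]
    have := min_le_left (δ / 2) (r' / 2)
    exact max_lt (by linarith) (by linarith)
  refine ⟨z₀, 𝒯, by linarith, min (δ / 2) (r' / 2), by positivity, r', hr'0,
    fun p c hp hc => (HT (hdist p c hp hc)).1.1.1, ?_⟩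
  intro p φ hp hφ hφδ hconj
  have hz₀2 : z₀ ∈ Metric.ball (0 : ℂ) 2 := by rw [mem_ball_zero_iff]; linarith
  obtain ⟨⟨⟨-, hT⟩, hc1, hc2⟩, hTr⟩ := HT (hdist p (φ z₀) hp (hφδ z₀ hz₀2))
  obtain ⟨⟨-, hp1, hp2⟩, -⟩ := HT (hdist p z₀ hp (by rw [sub_self, norm_zero]; positivity))
  have hpr : ‖p‖ < r' := by
    have := min_le_right (δ / 2) (r' / 2)
    linarith
  set T := 𝒯 (p, φ z₀) with hTdef
  have hΦT : Φ (T, p, z₀) = φ z₀ := by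
    have h2 : (Λ (p, φ z₀)).2 = p := congrArg Prod.fst hT
    have h3 : Φ ((Λ (p, φ z₀)).1, (Λ (p, φ z₀)).2, z₀) = φ z₀ := congrArg Prod.snd hT
    rwa [h2] at h3
  let χ : ℂ → ℂ := fun z => Φ (T, p, z)
  have hχa : ∀ z ∈ Metric.ball (0 : ℂ) r', AnalyticAt ℂ χ z := fun z hz =>
    AnalyticAt.comp_of_eq (f := fun z : ℂ => (T, p, z))
      (H (hball T p z hTr hpr (mem_ball_zero_iff.1 hz))).1.1
      (analyticAt_const.prod (analyticAt_const.prod analyticAt_id)) rfl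
  have hφa : ∀ z ∈ Metric.ball (0 : ℂ) r', AnalyticAt ℂ φ z := fun z hz =>
    hφ.analyticAt (Metric.isOpen_ball.mem_nhds (Metric.ball_subset_ball (by linarith) hz))
  have hz₀r' : z₀ ∈ Metric.ball (0 : ℂ) r' := mem_ball_zero_iff.2 hz₀r
  -- φ and the flow map of time T agree at z₀ and both preserve the field, so they agree near z₀.
  -- The identity theorem carries this to a disk around the singular point 0.
  have hnear : φ =ᶠ[𝓝 z₀] χ := by
    refine eventuallyEq_of_conj (X := nfVal p.1 p.2) ?_ ?_ ?_ ?_ (hφa z₀ hz₀r') (hχa z₀ hz₀r')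
      hΦT.symm ?_ ?_
    · exact AnalyticAt.nfVal analyticAt_const analyticAt_const analyticAt_id hc2
    · exact (AnalyticAt.nfVal analyticAt_const analyticAt_const analyticAt_id hp2).continuousAt
    · exact div_ne_zero hp1 hp2
    · exact div_ne_zero hc1 hc2
    · filter_upwards [Metric.isOpen_ball.mem_nhds hz₀2] with z hz using hconj z hz
    · filter_upwards [Metric.isOpen_ball.mem_nhds hz₀r'] with z hz
      exact (H (hball T p z hTr hpr (mem_ball_zero_iff.1 hz))).1.2.2.2
  have heq : Set.EqOn φ χ (Metric.ball 0 r') :=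
    AnalyticOnNhd.eqOn_of_preconnected_of_eventuallyEq (fun z hz => hφa z hz)
      (fun z hz => hχa z hz) (convex_ball _ _).isPreconnected hz₀r' hnear
  intro z hz
  have hsT : ∀ s ∈ Set.Icc (0 : ℝ) 1, ‖(s : ℂ) * T‖ < r' := by
    intro s hs
    refine lt_of_le_of_lt ?_ hTr
    rw [norm_mul, Complex.norm_real, Real.norm_of_nonneg hs.1]
    exact mul_le_of_le_one_left (norm_nonneg _) hs.2
  refine ⟨fun s => Φ (s * T, p, z), ?_, ?_, ?_⟩
  · simpa using (H (hball 0 p z (by simpa using hr'0) hpr hz)).1.2.1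
  · simpa using (heq (mem_ball_zero_iff.2 hz)).symm
  · intro s hs
    obtain ⟨⟨-, -, h2, -⟩, h3⟩ := H (hball _ p z (hsT s hs) hpr hz)
    refine ⟨AnalyticAt.nfVal analyticAt_const analyticAt_const analyticAt_id h3, ?_⟩
    have h4 : HasDerivAt (fun s : ℂ => s * T) T (s : ℂ) := by
      simpa using (hasDerivAt_id (s : ℂ)).mul_const T
    have h5 := (HasDerivAt.comp (s : ℂ) h2 h4).comp_ofReal
    rw [mul_comm T]
    exact h5.hasDerivWithinAt

/-! ### Rescaling of normal forms -/

/-- The coefficients of a normal form after the change of variable `z ↦ c z`. -/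
noncomputable def scaleCoeff {k : ℕ} (c : ℂ) (b : Fin k → ℂ) : Fin k → ℂ :=
  fun j => (c ^ (k + 1 - (j : ℕ)))⁻¹ * b j

theorem scaleCoeff_injective {k : ℕ} {c : ℂ} (hc : c ≠ 0) :
    Function.Injective (scaleCoeff c : (Fin k → ℂ) → Fin k → ℂ) := fun _ _ h =>
  funext fun j => mul_left_cancel₀ (inv_ne_zero (pow_ne_zero _ hc)) (congrFun h j)

theorem scaleCoeff_zero {k : ℕ} (c : ℂ) : scaleCoeff c (0 : Fin k → ℂ) = 0 := by
  funext j; simp [scaleCoeff]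

theorem AnalyticAt.scaleCoeff {E : Type*} [NormedAddCommGroup E] [NormedSpace ℂ E] {k : ℕ}
    {b : E → Fin k → ℂ} {e : E} (c : ℂ) (hb : AnalyticAt ℂ b e) :
    AnalyticAt ℂ (fun e => scaleCoeff c (b e)) e := by
  rw [analyticAt_pi_iff] at hb ⊢
  exact fun j => analyticAt_const.mul (hb j)

theorem nfPoly_mul {k : ℕ} {c : ℂ} (hc : c ≠ 0) (b : Fin k → ℂ) (z : ℂ) :
    nfPoly b (c * z) = c ^ (k + 1) * nfPoly (scaleCoeff c b) z := by
  simp only [nfPoly, scaleCoeff, mul_add, Finset.mul_sum, mul_pow]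
  congr 1
  refine Finset.sum_congr rfl fun j _ => ?_
  have h1 : c ^ (k + 1) = c ^ (k + 1 - (j : ℕ)) * c ^ (j : ℕ) := by
    rw [← pow_add]; congr 1; have := j.2; omega
  have h2 : c ^ (k + 1 - (j : ℕ)) ≠ 0 := pow_ne_zero _ hc
  rw [h1]
  field_simp

/-- Under z ↦ cz a normal form goes to c^k times another normal form. The factor is a change of
time, invisible to conjugacies when source and target are rescaled alike, and equal to 1 when c^k =
1. Small c brings A and the domain into the range of the estimates on the disk of radius 2. -/
theorem nfVal_mul {k : ℕ} {c : ℂ} (hc : c ≠ 0) (b : Fin k → ℂ) (A z : ℂ) :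
    nfVal b A (c * z) = c ^ (k + 1) * nfVal (scaleCoeff c b) (c ^ k * A) z := by
  rw [nfVal, nfVal, nfPoly_mul hc, mul_pow, mul_div_assoc, mul_left_comm, mul_assoc]

theorem FlowsTo.scale {k : ℕ} {c : ℂ} (hc : c ≠ 0) {b : Fin k → ℂ} {A T z w : ℂ}
    (h : FlowsTo (nfVal (scaleCoeff c b) (c ^ k * A)) T z w) :
    FlowsTo (nfVal b A) (T / c ^ k) (c * z) (c * w) := by
  obtain ⟨γ, h0, h1, h2⟩ := h
  refine ⟨fun s => c * γ s, by simp [h0], by simp [h1], fun s hs => ?_⟩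
  obtain ⟨h3, h4⟩ := h2 s hs
  constructor
  · have h5 : nfVal b A = fun u => c ^ (k + 1) * nfVal (scaleCoeff c b) (c ^ k * A) (c⁻¹ * u) := by
      funext u
      rw [← nfVal_mul hc, mul_inv_cancel_left₀ hc]
    rw [h5]
    refine analyticAt_const.mul (AnalyticAt.comp_of_eq (f := fun u => c⁻¹ * u) h3
      (analyticAt_const.mul analyticAt_id) ?_)
    rw [inv_mul_cancel_left₀ hc]
  · have h5 := h4.const_mul c
    convert! h5 using 1
    rw [nfVal_mul hc]
    have := pow_ne_zero k hc
    field_simp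
    ring

/-! ### Conjugate families in normal form -/

section Families

variable {E : Type*} [NormedAddCommGroup E] [NormedSpace ℂ E] {k : ℕ}

/-- A family of changes of coordinate tangent to the identity at the origin, between two families
in normal form, preserves the families and is given by the flow. -/
theorem exists_flow_of_conj_tangent_id (hk : 1 ≤ k) {b β : E → Fin k → ℂ} {A α : E → ℂ}
    {φ : E → ℂ → ℂ} (hb : AnalyticAt ℂ b 0) (hb0 : b 0 = 0) (hβ : AnalyticAt ℂ β 0)
    (hβ0 : β 0 = 0) (hA : AnalyticAt ℂ A 0) (hα : AnalyticAt ℂ α 0)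
    (hφ : AnalyticAt ℂ (fun p : E × ℂ => φ p.1 p.2) (0, 0)) (hφ0 : φ 0 0 = 0)
    (hφ' : HasDerivAt (φ 0) 1 0)
    (hconj : ∀ᶠ p : E × ℂ in 𝓝 (0, 0), deriv (φ p.1) p.2 * nfVal (b p.1) (A p.1) p.2
      = nfVal (β p.1) (α p.1) (φ p.1 p.2)) :
    ∃ T : E → ℂ, AnalyticAt ℂ T 0 ∧ (∀ᶠ ε in 𝓝 (0 : E), b ε = β ε ∧ A ε = α ε) ∧
      ∀ᶠ p : E × ℂ in 𝓝 (0, 0),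
        FlowsTo (nfVal (β p.1) (α p.1)) (T p.1) p.2 (φ p.1 p.2) := by
  obtain ⟨δ₁, hδ₁, H₁⟩ := exists_eq_of_conj_near_id k
  obtain ⟨z₀, 𝒯, hz₀, δ₂, hδ₂, ρ, hρ, h𝒯, H₂⟩ := exists_flowTime k
  obtain ⟨R, hR, HR⟩ := Metric.eventually_nhds_iff.1 (hφ.eventually_analyticAt.and hconj)
  set δ := min δ₁ δ₂ with hδ
  have hδ0 : 0 < δ := lt_min hδ₁ hδ₂
  have hδle₁ : δ ≤ δ₁ := min_le_left _ _
  have hδle₂ : δ ≤ δ₂ := min_le_right _ _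
  have hlittle := hφ'.isLittleO
  rw [Asymptotics.isLittleO_iff] at hlittle
  obtain ⟨r, hr, Hr⟩ := Metric.eventually_nhds_iff.1 (hlittle (show 0 < δ / 4 by linarith))
  -- b and β are small for small ε, but A(0) and α(0) need not be. The scale `s` makes s^k A and s^k
  -- α small, using s^k ≤ s for k ≥ 1, and makes φ_0 relatively close to the identity on |z| < 2s.
  obtain ⟨s, hs0, hsr, hsR, hs1, hsδ⟩ : ∃ s : ℝ, 0 < s ∧ 2 * s < r ∧ 2 * s < R ∧ s ≤ 1 ∧
      s * (‖A 0‖ + ‖α 0‖ + 1) ≤ δ / 2 := by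
    have hC : 0 < ‖A 0‖ + ‖α 0‖ + 1 := by positivity
    refine ⟨min (min (r / 4) (R / 4)) (min 1 (δ / 2 / (‖A 0‖ + ‖α 0‖ + 1))), by positivity, ?_, ?_,
      (min_le_right _ _).trans (min_le_left _ _), ?_⟩
    · have := (min_le_left (min (r / 4) (R / 4)) (min 1 (δ / 2 / (‖A 0‖ + ‖α 0‖ + 1)))).trans
        (min_le_left _ _)
      linarith
    · have := (min_le_left (min (r / 4) (R / 4)) (min 1 (δ / 2 / (‖A 0‖ + ‖α 0‖ + 1)))).trans
        (min_le_right _ _)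
      linarith
    · exact (le_div_iff₀ hC).1 ((min_le_right _ _).trans (min_le_right _ _))
  set c : ℂ := (s : ℂ) with hc
  have hcn : ‖c‖ = s := by rw [hc, Complex.norm_real, Real.norm_of_nonneg hs0.le]
  have hc0 : c ≠ 0 := by rw [← norm_pos_iff, hcn]; exact hs0
  have hck : ‖c ^ k‖ ≤ s := by
    rw [norm_pow, hcn]
    exact pow_le_of_le_one hs0.le hs1 (by omega)
  -- estimates for small parameters
  have hcoef : ∀ a : E → Fin k → ℂ, AnalyticAt ℂ a 0 → a 0 = 0 →
      ∀ᶠ ε in 𝓝 (0 : E), ‖scaleCoeff c (a ε)‖ ≤ δ := by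
    intro a ha ha0
    have h1 := (AnalyticAt.scaleCoeff c ha).continuousAt.norm
    refine (h1.eventually_lt continuousAt_const ?_).mono fun ε h => le_of_lt h
    simpa [ha0, scaleCoeff_zero] using hδ0
  have hres : ∀ a : E → ℂ, AnalyticAt ℂ a 0 → ‖a 0‖ ≤ ‖A 0‖ + ‖α 0‖ →
      ∀ᶠ ε in 𝓝 (0 : E), ‖c ^ k * a ε‖ ≤ δ := by
    intro a ha ha0
    have h1 := ha.continuousAt.norm
    filter_upwards [h1.eventually_lt (continuousAt_const (y := ‖A 0‖ + ‖α 0‖ + 1))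
      (by linarith)] with ε hε
    rw [norm_mul]
    calc ‖c ^ k‖ * ‖a ε‖ ≤ s * (‖A 0‖ + ‖α 0‖ + 1) := by gcongr
      _ ≤ δ := by linarith
  have hφa : ∀ (ε : E) (z : ℂ), ‖ε‖ < R → ‖z‖ < R → AnalyticAt ℂ (φ ε) z := fun ε z hε hz =>
    AnalyticAt.comp_of_eq (f := fun z : ℂ => (ε, z)) (HR (y := (ε, z)) (by
      rw [Prod.dist_eq]; simpa using And.intro hε hz)).1 (analyticAt_const.prod analyticAt_id) rfl
  have hφclose : ∀ᶠ ε in 𝓝 (0 : E), ∀ z ∈ Metric.closedBall (0 : ℂ) (2 * s),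
      ‖φ ε z - φ 0 z‖ < s * δ / 2 := by
    refine eventually_forall_norm_lt (G := fun p : E × ℂ => φ p.1 p.2 - φ 0 p.2)
      (isCompact_closedBall _ _) ?_ (fun z _ => sub_self _) (by positivity)
    intro z hz
    have hzR : ‖z‖ < R := lt_of_le_of_lt (mem_closedBall_zero_iff.1 hz) hsR
    have h1 : AnalyticAt ℂ (fun p : E × ℂ => φ p.1 p.2) (0, z) :=
      (HR (y := (0, z)) (by rw [Prod.dist_eq]; simpa using hzR)).1
    refine h1.continuousAt.sub ?_
    exact ContinuousAt.comp (f := fun p : E × ℂ => p.2) (g := φ 0) (x := (0, z))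
      (hφa 0 z (by simpa using hR) hzR).continuousAt continuousAt_snd
  -- φ read in the rescaled coordinate; both fields get the same factor c^(k+1), so ψ still
  -- conjugates the rescaled normal forms.
  let ψ : E → ℂ → ℂ := fun ε w => c⁻¹ * φ ε (c * w)
  have hψ : ∀ᶠ ε in 𝓝 (0 : E), DifferentiableOn ℂ (ψ ε) (Metric.ball 0 2) ∧
      (∀ z ∈ Metric.ball (0 : ℂ) 2, ‖ψ ε z - z‖ ≤ δ) ∧
      ∀ z ∈ Metric.ball (0 : ℂ) 2,
        deriv (ψ ε) z * nfVal (scaleCoeff c (b ε)) (c ^ k * A ε) z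
          = nfVal (scaleCoeff c (β ε)) (c ^ k * α ε) (ψ ε z) := by
    filter_upwards [hφclose, Metric.ball_mem_nhds (0 : E) hR] with ε h1 h2
    have h2' : ‖ε‖ < R := mem_ball_zero_iff.1 h2
    have hcz : ∀ z ∈ Metric.ball (0 : ℂ) 2, ‖c * z‖ < 2 * s := by
      intro z hz
      rw [mem_ball_zero_iff] at hz
      rw [norm_mul, hcn]
      nlinarith
    have hd : ∀ z ∈ Metric.ball (0 : ℂ) 2, HasDerivAt (ψ ε) (deriv (φ ε) (c * z)) z := by
      intro z hz
      have h3 := (hφa ε (c * z) h2' ((hcz z hz).trans hsR)).differentiableAt.hasDerivAt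
      have h4 : HasDerivAt (fun w : ℂ => c * w) c z := by
        simpa using (hasDerivAt_id z).const_mul c
      have h5 := (h3.comp z h4).const_mul c⁻¹
      convert! h5 using 1
      field_simp
    refine ⟨fun z hz => (hd z hz).differentiableAt.differentiableWithinAt, fun z hz => ?_,
      fun z hz => ?_⟩
    · have h3 := h1 (c * z) (mem_closedBall_zero_iff.2 (hcz z hz).le)
      have h4 := Hr (y := c * z) (by rw [dist_zero_right]; exact (hcz z hz).trans hsr)
      simp only [hφ0, sub_zero, smul_eq_mul, mul_one] at h4
      have h5 : ψ ε z - z = c⁻¹ * ((φ ε (c * z) - φ 0 (c * z)) + (φ 0 (c * z) - c * z)) := by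
        simp only [ψ]; field_simp; ring
      rw [h5, norm_mul, norm_inv, hcn, inv_mul_le_iff₀ hs0]
      refine (norm_add_le _ _).trans ?_
      have h6 : δ / 4 * ‖c * z‖ ≤ δ / 4 * (2 * s) := by gcongr; exact (hcz z hz).le
      linarith
    · have h3 := (HR (y := (ε, c * z)) (by
        rw [Prod.dist_eq]; simpa using And.intro h2' ((hcz z hz).trans hsR))).2
      simp only at h3
      have h4 : φ ε (c * z) = c * ψ ε z := by simp only [ψ]; rw [mul_inv_cancel_left₀ hc0]
      rw [(hd z hz).deriv]
      rw [h4, nfVal_mul hc0, nfVal_mul hc0] at h3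
      have h5 := pow_ne_zero (k + 1) hc0
      refine mul_left_cancel₀ h5 ?_
      rw [← h3]; ring
  have hAle : ‖A 0‖ ≤ ‖A 0‖ + ‖α 0‖ := le_add_of_nonneg_right (norm_nonneg _)
  have hαle : ‖α 0‖ ≤ ‖A 0‖ + ‖α 0‖ := le_add_of_nonneg_left (norm_nonneg _)
  have hmain : ∀ᶠ ε in 𝓝 (0 : E), (b ε = β ε ∧ A ε = α ε) ∧
      (‖(scaleCoeff c (β ε), c ^ k * α ε)‖ ≤ δ ∧ ‖ψ ε z₀ - z₀‖ ≤ δ) ∧ ∀ w, ‖w‖ < ρ →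
      FlowsTo (nfVal (scaleCoeff c (β ε)) (c ^ k * α ε))
        (𝒯 ((scaleCoeff c (β ε), c ^ k * α ε), ψ ε z₀)) w (ψ ε w) := by
    filter_upwards [hcoef b hb hb0, hcoef β hβ hβ0, hres A hA hAle, hres α hα hαle, hψ]
      with ε h1 h2 h3 h4 ⟨h5, h6, h7⟩
    have h8 := H₁ _ _ _ _ (ψ ε) (h1.trans hδle₁) (h2.trans hδle₁) (h3.trans hδle₁)
      (h4.trans hδle₁) h5 (fun z hz => (h6 z hz).trans hδle₁) h7
    rw [h8.1, h8.2] at h7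
    have h9 : ‖(scaleCoeff c (β ε), c ^ k * α ε)‖ ≤ δ := by
      rw [Prod.norm_def]; exact max_le h2 h4
    refine ⟨⟨scaleCoeff_injective hc0 h8.1, mul_left_cancel₀ (pow_ne_zero k hc0) h8.2⟩,
      ⟨h9, h6 z₀ (mem_ball_zero_iff.2 hz₀)⟩, ?_⟩
    exact H₂ (scaleCoeff c (β ε), c ^ k * α ε) (ψ ε) (h9.trans hδle₂) h5
      (fun z hz => (h6 z hz).trans hδle₂) h7
  refine ⟨fun ε => 𝒯 ((scaleCoeff c (β ε), c ^ k * α ε), ψ ε z₀) / c ^ k, ?_,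
    hmain.mono fun ε h => h.1, ?_⟩
  · obtain ⟨-, ⟨h1, h2⟩, -⟩ := hmain.self_of_nhds
    have h3 := h𝒯 _ _ (h1.trans hδle₂) (h2.trans hδle₂)
    have hz₀R : ‖c * z₀‖ < R := by
      rw [norm_mul, hcn]
      nlinarith
    have h4 : AnalyticAt ℂ (fun ε => φ ε (c * z₀)) 0 :=
      AnalyticAt.comp_of_eq (f := fun ε : E => (ε, c * z₀)) (HR (y := (0, c * z₀)) (by
        rw [Prod.dist_eq]; rw [max_lt_iff]; simpa using And.intro hR hz₀R)).1
        (analyticAt_id.prod analyticAt_const) rfl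
    have h5 : AnalyticAt ℂ (fun ε => 𝒯 ((scaleCoeff c (β ε), c ^ k * α ε), ψ ε z₀)) 0 :=
      AnalyticAt.comp_of_eq (f := fun ε => ((scaleCoeff c (β ε), c ^ k * α ε), ψ ε z₀)) h3
        (((AnalyticAt.scaleCoeff c hβ).prod (analyticAt_const.mul hα)).prod
          (analyticAt_const.mul h4)) rfl
    exact h5.div analyticAt_const (pow_ne_zero k hc0)
  · have h1 : ∀ᶠ z in 𝓝 (0 : ℂ), ‖c⁻¹ * z‖ < ρ := by
      have : ContinuousAt (fun z : ℂ => ‖c⁻¹ * z‖) 0 := by fun_prop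
      exact this.eventually_lt continuousAt_const (by simpa using hρ)
    rw [nhds_prod_eq]
    filter_upwards [hmain.prod_mk h1] with p hp
    have h4 := FlowsTo.scale hc0 (hp.1.2.2 _ hp.2)
    simpa only [ψ, mul_inv_cancel_left₀ hc0] using h4

/-- Comparing leading terms with λ = φ'(0): λ z^(k+1) = (λz)^(k+1), so λ^k = 1. The denominators
tend to 1 because k ≥ 1. -/
theorem deriv_pow_eq_one_of_conj (hk : 1 ≤ k) {A α : ℂ} {φ : ℂ → ℂ} (hφ : AnalyticAt ℂ φ 0)
    (hφ0 : φ 0 = 0) (hφ' : deriv φ 0 ≠ 0)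
    (hconj : ∀ᶠ z in 𝓝 (0 : ℂ), deriv φ z * nfVal (0 : Fin k → ℂ) A z
      = nfVal (0 : Fin k → ℂ) α (φ z)) : deriv φ 0 ^ k = 1 := by
  have hq : Tendsto (dslope φ 0) (𝓝[≠] 0) (𝓝 (deriv φ 0)) := by
    have h1 : ContinuousAt (dslope φ 0) 0 := continuousAt_dslope_same.2 hφ.differentiableAt
    have h2 := h1.tendsto
    rw [dslope_same] at h2
    exact h2.mono_left nhdsWithin_le_nhds
  have hd : Tendsto (deriv φ) (𝓝[≠] 0) (𝓝 (deriv φ 0)) :=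
    hφ.deriv.continuousAt.tendsto.mono_left nhdsWithin_le_nhds
  have hz : Tendsto (fun z : ℂ => 1 + A * z ^ k) (𝓝[≠] 0) (𝓝 1) := by
    have h1 : ContinuousAt (fun z : ℂ => 1 + A * z ^ k) 0 := by fun_prop
    have h2 := h1.tendsto
    rw [zero_pow (by omega), mul_zero, add_zero] at h2
    exact h2.mono_left nhdsWithin_le_nhds
  have hφz : Tendsto (fun z : ℂ => 1 + α * φ z ^ k) (𝓝[≠] 0) (𝓝 1) := by
    have h1 : ContinuousAt (fun z : ℂ => 1 + α * φ z ^ k) 0 :=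
      continuousAt_const.add (continuousAt_const.mul (hφ.continuousAt.pow k))
    have h2 := h1.tendsto
    rw [hφ0, zero_pow (by omega), mul_zero, add_zero] at h2
    exact h2.mono_left nhdsWithin_le_nhds
  have h1 := hd.mul hφz
  have h2 := (hq.pow (k + 1)).mul hz
  rw [mul_one] at h1 h2
  have h3 : deriv φ 0 = deriv φ 0 ^ (k + 1) := by
    refine tendsto_nhds_unique (h1.congr' ?_) h2
    filter_upwards [hconj.filter_mono nhdsWithin_le_nhds, self_mem_nhdsWithin,
      hz.eventually_ne one_ne_zero, hφz.eventually_ne one_ne_zero] with z h4 h5 h6 h7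
    have h8 : φ z = z * dslope φ 0 z := by
      rw [dslope_of_ne _ h5, slope_def_field, hφ0, sub_zero, sub_zero]
      rw [mul_div_cancel₀ _ h5]
    simp only [nfVal, nfPoly_zero] at h4
    have h9 : z ^ (k + 1) ≠ 0 := pow_ne_zero _ h5
    rw [← mul_div_assoc, div_eq_div_iff h6 h7] at h4
    have h10 : φ z ^ (k + 1) = z ^ (k + 1) * dslope φ 0 z ^ (k + 1) := by
      rw [← mul_pow, ← h8]
    rw [h10] at h4
    refine mul_left_cancel₀ h9 ?_
    linear_combination h4
  rw [pow_succ] at h3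
  exact (mul_right_cancel₀ hφ' (by rw [one_mul]; exact h3)).symm

/-- Two conjugate families in normal form agree up to a rotation of order `k`, and the conjugacy
is the composition of this rotation and of the flow. -/
theorem exists_rotation_flow_of_conj (hk : 1 ≤ k) {b β : E → Fin k → ℂ} {A α : E → ℂ}
    {φ : E → ℂ → ℂ} (hb : AnalyticAt ℂ b 0) (hb0 : b 0 = 0) (hβ : AnalyticAt ℂ β 0)
    (hβ0 : β 0 = 0) (hA : AnalyticAt ℂ A 0) (hα : AnalyticAt ℂ α 0)
    (hφ : AnalyticAt ℂ (fun p : E × ℂ => φ p.1 p.2) (0, 0)) (hφ0 : φ 0 0 = 0)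
    (hφ' : deriv (φ 0) 0 ≠ 0)
    (hconj : ∀ᶠ p : E × ℂ in 𝓝 (0, 0), deriv (φ p.1) p.2 * nfVal (b p.1) (A p.1) p.2
      = nfVal (β p.1) (α p.1) (φ p.1 p.2)) :
    ∃ (μ : ℂ) (T : E → ℂ), μ ^ k = 1 ∧ AnalyticAt ℂ T 0 ∧
      (∀ᶠ ε in 𝓝 (0 : E), (∀ j, β ε j = μ ^ (1 - (j : ℤ)) * b ε j) ∧ A ε = α ε) ∧
      ∀ᶠ p : E × ℂ in 𝓝 (0, 0),
        FlowsTo (nfVal (β p.1) (α p.1)) (T p.1) (μ * p.2) (φ p.1 p.2) := by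
  have hφa0 : AnalyticAt ℂ (φ 0) 0 :=
    AnalyticAt.comp_of_eq (f := fun z : ℂ => ((0 : E), z)) hφ (analyticAt_const.prod analyticAt_id)
      rfl
  set μ := deriv (φ 0) 0 with hμ
  have hμk : μ ^ k = 1 := by
    refine deriv_pow_eq_one_of_conj hk (A := A 0) (α := α 0) hφa0 hφ0 hφ' ?_
    have h1 : Tendsto (fun z : ℂ => ((0 : E), z)) (𝓝 0) (𝓝 (0, 0)) := by
      have : Continuous (fun z : ℂ => ((0 : E), z)) := by fun_prop
      exact this.tendsto 0
    have h2 := h1.eventually hconj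
    simp only [hb0, hβ0] at h2
    exact h2
  have hμi : μ⁻¹ ≠ 0 := inv_ne_zero hφ'
  have hμik : (μ⁻¹) ^ k = 1 := by rw [inv_pow, hμk, inv_one]
  have ht : Tendsto (fun p : E × ℂ => (p.1, μ⁻¹ * p.2)) (𝓝 (0, 0)) (𝓝 (0, 0)) := by
    have : Continuous (fun p : E × ℂ => (p.1, μ⁻¹ * p.2)) := by fun_prop
    simpa using this.tendsto (0, 0)
  have hslice : ∀ᶠ p : E × ℂ in 𝓝 (0, 0), DifferentiableAt ℂ (φ p.1) p.2 := by
    filter_upwards [hφ.eventually_analyticAt] with p hp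
    exact (AnalyticAt.comp_of_eq (f := fun z : ℂ => (p.1, z)) hp
      (analyticAt_const.prod analyticAt_id) rfl).differentiableAt
  have hdψ : ∀ p : E × ℂ, DifferentiableAt ℂ (φ p.1) (μ⁻¹ * p.2) →
      HasDerivAt (fun w => φ p.1 (μ⁻¹ * w)) (deriv (φ p.1) (μ⁻¹ * p.2) * μ⁻¹) p.2 := by
    intro p hp
    have h4 : HasDerivAt (fun w : ℂ => μ⁻¹ * w) μ⁻¹ p.2 := by
      simpa using (hasDerivAt_id p.2).const_mul μ⁻¹
    exact hp.hasDerivAt.comp p.2 h4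
  -- Precomposing with z ↦ μ⁻¹ z makes φ_0 tangent to the identity. As μ^k = 1, this rotation
  -- changes neither A nor the time and only multiplies b_j by μ^(k+1-j) = μ^(1-j).
  obtain ⟨T, hT, h1, h2⟩ := exists_flow_of_conj_tangent_id hk (b := fun ε => scaleCoeff μ⁻¹ (b ε))
    (β := β) (A := A) (α := α) (φ := fun ε w => φ ε (μ⁻¹ * w)) (AnalyticAt.scaleCoeff _ hb)
    (by rw [hb0, scaleCoeff_zero]) hβ hβ0 hA hα
    (AnalyticAt.comp_of_eq (f := fun p : E × ℂ => (p.1, μ⁻¹ * p.2)) hφ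
      (analyticAt_fst.prod (analyticAt_const.mul analyticAt_snd)) (by simp)) (by simpa using hφ0)
    (by
      have h3 := hdψ (0, 0) (by simpa using hφa0.differentiableAt)
      simp only [mul_zero] at h3
      rwa [← hμ, mul_inv_cancel₀ hφ'] at h3)
    (by
      filter_upwards [ht.eventually hconj, ht.eventually hslice] with p h3 h4
      rw [(hdψ p h4).deriv, ← h3, nfVal_mul hμi, hμik, one_mul, pow_succ, hμik, one_mul, mul_assoc])
  refine ⟨μ, T, hμk, hT, ?_, ?_⟩
  · filter_upwards [h1] with ε h3
    refine ⟨fun j => ?_, h3.2⟩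
    rw [← h3.1, scaleCoeff]
    congr 1
    have h4 : μ ^ (1 - (j : ℤ)) = μ ^ (((k + 1 - (j : ℕ) : ℕ)) : ℤ) := by
      have h5 : (1 - (j : ℤ)) = ((k + 1 - (j : ℕ) : ℕ) : ℤ) - (k : ℤ) := by
        have := j.2
        omega
      rw [h5, zpow_sub₀ hφ', zpow_natCast, zpow_natCast, hμk, div_one]
    rw [h4, zpow_natCast, inv_pow, inv_inv]
  · have h3 : Tendsto (fun p : E × ℂ => (p.1, μ * p.2)) (𝓝 (0, 0)) (𝓝 (0, 0)) := by
      have : Continuous (fun p : E × ℂ => (p.1, μ * p.2)) := by fun_prop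
      simpa using this.tendsto (0, 0)
    filter_upwards [h3.eventually h2] with p h4
    simpa only [inv_mul_cancel_left₀ hφ'] using h4

end Families

section Families

variable {E : Type*} [NormedAddCommGroup E] [NormedSpace ℂ E]

theorem analyticAt_slice {φ : E → ℂ → ℂ} {p : E × ℂ}
    (hφ : AnalyticAt ℂ (fun p : E × ℂ => φ p.1 p.2) p) : AnalyticAt ℂ (φ p.1) p.2 :=
  AnalyticAt.comp_of_eq (f := fun z : ℂ => (p.1, z)) hφ (analyticAt_const.prod analyticAt_id) rfl

theorem fderiv_slice {φ : E → ℂ → ℂ} {p : E × ℂ}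
    (hφ : AnalyticAt ℂ (fun p : E × ℂ => φ p.1 p.2) p) :
    fderiv ℂ (fun p : E × ℂ => φ p.1 p.2) p (0, 1) = deriv (φ p.1) p.2 := by
  have h : HasDerivAt (fun z : ℂ => (p.1, z)) (0, 1) p.2 :=
    (hasDerivAt_const _ _).prodMk (hasDerivAt_id _)
  exact (HasFDerivAt.comp_hasDerivAt (l := fun p : E × ℂ => φ p.1 p.2) p.2
    hφ.differentiableAt.hasFDerivAt h).deriv.symm

/-- The inverse of a family of changes of coordinate. -/
theorem exists_coord_inverse [FiniteDimensional ℂ E] {φ : E → ℂ → ℂ}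
    (hφ : AnalyticAt ℂ (fun p : E × ℂ => φ p.1 p.2) (0, 0)) (hφ0 : φ 0 0 = 0)
    (hφ' : deriv (φ 0) 0 ≠ 0) :
    ∃ χ : E → ℂ → ℂ, AnalyticAt ℂ (fun p : E × ℂ => χ p.1 p.2) (0, 0) ∧ χ 0 0 = 0 ∧
      (∀ᶠ p : E × ℂ in 𝓝 (0, 0), φ p.1 (χ p.1 p.2) = p.2) ∧
      ∀ᶠ p : E × ℂ in 𝓝 (0, 0), χ p.1 (φ p.1 p.2) = p.2 := by
  let Ψ : E × ℂ → E × ℂ := fun p => (p.1, φ p.1 p.2)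
  have hΨ : AnalyticAt ℂ Ψ (0, 0) := analyticAt_fst.prod hφ
  have hinj : Function.Injective (fderiv ℂ Ψ (0, 0)) := by
    rw [injective_iff_map_eq_zero]
    rintro ⟨e, z⟩ hp
    have h2 : HasFDerivAt Ψ ((ContinuousLinearMap.fst ℂ E ℂ).prod
        (fderiv ℂ (fun p : E × ℂ => φ p.1 p.2) (0, 0))) (0, 0) :=
      hasFDerivAt_fst.prodMk hφ.differentiableAt.hasFDerivAt
    rw [h2.fderiv] at hp
    simp only [ContinuousLinearMap.prod_apply, ContinuousLinearMap.coe_fst', Prod.mk_eq_zero] at hp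
    obtain ⟨rfl, hp⟩ := hp
    have h5 : ((0, z) : E × ℂ) = z • (0, 1) := by simp
    rw [h5, map_smul, fderiv_slice hφ, smul_eq_mul] at hp
    rw [(mul_eq_zero.1 hp).resolve_right hφ']
    rfl
  obtain ⟨g, hg, hg0, hgr, hgl⟩ := exists_analyticAt_localInverse hΨ hinj rfl
  have hΨ0 : Ψ (0, 0) = (0, 0) := by simp only [Ψ, hφ0]
  rw [hΨ0] at hg hg0 hgr
  refine ⟨fun ε w => (g (ε, w)).2, analyticAt_snd.comp hg, by simp [hg0], ?_, ?_⟩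
  · filter_upwards [hgr] with y hy
    obtain ⟨h1, h2⟩ := Prod.ext_iff.1 hy
    simp only [Ψ] at h1 h2
    rwa [h1] at h2
  · filter_upwards [hgl] with x hx
    exact congrArg Prod.snd hx

theorem tendsto_family {φ : E → ℂ → ℂ} (hφ : AnalyticAt ℂ (fun p : E × ℂ => φ p.1 p.2) (0, 0))
    (hφ0 : φ 0 0 = 0) :
    Tendsto (fun p : E × ℂ => (p.1, φ p.1 p.2)) (𝓝 (0, 0)) (𝓝 (0, 0)) := by
  have h1 := (continuousAt_fst.prodMk hφ.continuousAt).tendsto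
  rwa [hφ0] at h1

/-- The derivatives of a family of changes of coordinate and of its inverse. -/
theorem eventually_deriv_mul_deriv_inverse {φ χ : E → ℂ → ℂ}
    (hφ : AnalyticAt ℂ (fun p : E × ℂ => φ p.1 p.2) (0, 0))
    (hχ : AnalyticAt ℂ (fun p : E × ℂ => χ p.1 p.2) (0, 0)) (hχ0 : χ 0 0 = 0)
    (h : ∀ᶠ p : E × ℂ in 𝓝 (0, 0), φ p.1 (χ p.1 p.2) = p.2) :
    ∀ᶠ p : E × ℂ in 𝓝 (0, 0), deriv (φ p.1) (χ p.1 p.2) * deriv (χ p.1) p.2 = 1 := by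
  filter_upwards [h.eventually_nhds, hχ.eventually_analyticAt,
    (tendsto_family hχ hχ0).eventually hφ.eventually_analyticAt] with p h1 h2 h3
  have h4 : ∀ᶠ z in 𝓝 p.2, φ p.1 (χ p.1 z) = z := by
    have : ContinuousAt (fun z : ℂ => (p.1, z)) p.2 := by fun_prop
    exact this.eventually h1
  have h5 := (analyticAt_slice h3).differentiableAt.hasDerivAt.comp p.2
    (analyticAt_slice h2).differentiableAt.hasDerivAt
  exact h5.unique ((hasDerivAt_id p.2).congr_of_eventuallyEq h4)

end Families

/-! ### Almost uniqueness of the normal form -/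

section NormalForms

variable {k ℓ : ℕ}

theorem IsNormalForm.analyticAt {b : (Fin ℓ → ℂ) → Fin k → ℂ} {A : (Fin ℓ → ℂ) → ℂ}
    (h : IsNormalForm b A) : AnalyticAt ℂ b 0 :=
  analyticAt_pi_iff.2 h.analytic_coeff

theorem IsNormalForm.apply_zero {b : (Fin ℓ → ℂ) → Fin k → ℂ} {A : (Fin ℓ → ℂ) → ℂ}
    (h : IsNormalForm b A) : b 0 = 0 :=
  funext h.coeff_zero

theorem IsNormalForm.eventually_coeff_eq (hℓk : ℓ ≤ k) {b : (Fin ℓ → ℂ) → Fin k → ℂ}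
    {A : (Fin ℓ → ℂ) → ℂ} (h : IsNormalForm b A) :
    ∀ᶠ ε in 𝓝 (0 : Fin ℓ → ℂ), ∀ j : Fin ℓ, b ε (Fin.castLE hℓk j) = ε j :=
  eventually_all.2 fun j => h.coeff_eq (Fin.castLE hℓk j) j rfl

theorem tendsto_param {X Y : (Fin ℓ → ℂ) → ℂ → ℂ} {φ : (Fin ℓ → ℂ) → ℂ → ℂ}
    {h : (Fin ℓ → ℂ) → (Fin ℓ → ℂ)} (H : IsConjugacy X Y φ h) : Tendsto h (𝓝 0) (𝓝 0) := by
  have h1 := H.analytic_param.continuousAt.tendsto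
  rwa [H.param_zero] at h1

/-- The normal form of a generic unfolding is almost unique. -/
theorem normalForm_almost_unique (hℓ : 1 ≤ ℓ) (hℓk : ℓ ≤ k)
    {b b' : (Fin ℓ → ℂ) → Fin k → ℂ} {A A' : (Fin ℓ → ℂ) → ℂ} {φ : (Fin ℓ → ℂ) → ℂ → ℂ}
    {h : (Fin ℓ → ℂ) → (Fin ℓ → ℂ)} (hb : IsNormalForm b A) (hb' : IsNormalForm b' A')
    (H : IsConjugacy (nfField b A) (nfField b' A') φ h) :
    ∃ (μ : ℂ) (T : (Fin ℓ → ℂ) → ℂ), μ ^ k = 1 ∧ AnalyticAt ℂ T 0 ∧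
      (∀ᶠ ε in 𝓝 (0 : Fin ℓ → ℂ), ∀ j : Fin ℓ, h ε j = μ ^ (1 - (j : ℤ)) * ε j) ∧
      (∀ᶠ p : (Fin ℓ → ℂ) × ℂ in 𝓝 (0, 0),
        FlowsTo (nfField b' A' (h p.1)) (T p.1) (μ * p.2) (φ p.1 p.2)) ∧
      (∀ᶠ ε in 𝓝 (0 : Fin ℓ → ℂ), A ε = A' (h ε)) ∧
      (∀ᶠ ε in 𝓝 (0 : Fin ℓ → ℂ), ∀ z : ℂ,
        nfPoly (b' (h ε)) (μ * z) = μ * nfPoly (b ε) z) := by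
  have hk : 1 ≤ k := hℓ.trans hℓk
  -- The target is pulled back by `h`, so that both families depend on the same parameter; the first
  -- ℓ coefficients then read off `h` itself.
  obtain ⟨μ, T, hμ, hT, h1, h2⟩ := exists_rotation_flow_of_conj hk (b := b)
    (β := fun ε => b' (h ε)) (A := A) (α := fun ε => A' (h ε)) (φ := φ) hb.analyticAt hb.apply_zero
    (AnalyticAt.comp_of_eq hb'.analyticAt H.analytic_param H.param_zero)
    (by rw [H.param_zero, hb'.apply_zero]) hb.analytic_A
    (AnalyticAt.comp_of_eq hb'.analytic_A H.analytic_param H.param_zero) H.analytic_coord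
    H.coord_zero H.deriv_coord_ne H.conj
  have hμ0 : μ ≠ 0 := by
    rintro rfl
    rw [zero_pow (by omega)] at hμ
    exact zero_ne_one hμ
  refine ⟨μ, T, hμ, hT, ?_, h2, h1.mono fun ε h3 => h3.2, ?_⟩
  · filter_upwards [h1, hb.eventually_coeff_eq hℓk,
      (tendsto_param H).eventually (hb'.eventually_coeff_eq hℓk)] with ε h3 h4 h5 j
    rw [← h5 j, h3.1, h4 j]
    rfl
  · filter_upwards [h1] with ε h3 z
    rw [nfPoly_mul hμ0, pow_succ, hμ, one_mul]
    congr 2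
    funext j
    rw [scaleCoeff, h3.1]
    have h5 : (1 - ((j : ℕ) : ℤ)) = ((k + 1 - (j : ℕ) : ℕ) : ℤ) - (k : ℤ) := by
      have := j.2
      omega
    rw [h5, zpow_sub₀ hμ0, zpow_natCast, zpow_natCast, hμ, div_one,
      inv_mul_cancel_left₀ (pow_ne_zero _ hμ0)]

/-- The parameters of the normal form are canonical. -/
theorem normalForm_param_canonical (hℓ : 1 ≤ ℓ) (hℓk : ℓ ≤ k) {ω : (Fin ℓ → ℂ) → ℂ → ℂ}
    {b₁ b₂ : (Fin ℓ → ℂ) → Fin k → ℂ} {A₁ A₂ : (Fin ℓ → ℂ) → ℂ}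
    {φ₁ φ₂ : (Fin ℓ → ℂ) → ℂ → ℂ} {h₁ h₂ : (Fin ℓ → ℂ) → (Fin ℓ → ℂ)}
    (hb₁ : IsNormalForm b₁ A₁) (hb₂ : IsNormalForm b₂ A₂)
    (H₁ : IsConjugacy ω (nfField b₁ A₁) φ₁ h₁) (H₂ : IsConjugacy ω (nfField b₂ A₂) φ₂ h₂) :
    ∃ μ : ℂ, μ ^ k = 1 ∧
      ∀ᶠ ε in 𝓝 (0 : Fin ℓ → ℂ), ∀ j : Fin ℓ, h₂ ε j = μ ^ (1 - (j : ℤ)) * h₁ ε j := by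
  -- φ₂∘φ₁⁻¹, taken fibrewise over the original ε, conjugates the families b₁∘h₁ and b₂∘h₂. No
  -- inversion of h₁ is needed, as the result on conjugate families allows arbitrary analytic
  -- coefficients vanishing at 0.
  obtain ⟨χ, hχ, hχ0, hχr, -⟩ :=
    exists_coord_inverse H₁.analytic_coord H₁.coord_zero H₁.deriv_coord_ne
  have hd := eventually_deriv_mul_deriv_inverse H₁.analytic_coord hχ hχ0 hχr
  have ht := tendsto_family hχ hχ0
  have hφ : AnalyticAt ℂ (fun p : (Fin ℓ → ℂ) × ℂ => φ₂ p.1 (χ p.1 p.2)) (0, 0) :=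
    AnalyticAt.comp_of_eq (f := fun p : (Fin ℓ → ℂ) × ℂ => (p.1, χ p.1 p.2)) H₂.analytic_coord
      (analyticAt_fst.prod hχ) (by rw [hχ0])
  have hder : ∀ᶠ p : (Fin ℓ → ℂ) × ℂ in 𝓝 (0, 0), deriv (fun z => φ₂ p.1 (χ p.1 z)) p.2
      = deriv (φ₂ p.1) (χ p.1 p.2) * deriv (χ p.1) p.2 := by
    filter_upwards [hχ.eventually_analyticAt,
      ht.eventually H₂.analytic_coord.eventually_analyticAt] with p h1 h2
    exact ((analyticAt_slice h2).differentiableAt.hasDerivAt.comp p.2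
      (analyticAt_slice h1).differentiableAt.hasDerivAt).deriv
  obtain ⟨μ, T, hμ, -, h1, -⟩ := exists_rotation_flow_of_conj (hℓ.trans hℓk)
    (b := fun ε => b₁ (h₁ ε)) (β := fun ε => b₂ (h₂ ε)) (A := fun ε => A₁ (h₁ ε))
    (α := fun ε => A₂ (h₂ ε)) (φ := fun ε z => φ₂ ε (χ ε z))
    (AnalyticAt.comp_of_eq hb₁.analyticAt H₁.analytic_param H₁.param_zero)
    (by rw [H₁.param_zero, hb₁.apply_zero])
    (AnalyticAt.comp_of_eq hb₂.analyticAt H₂.analytic_param H₂.param_zero)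
    (by rw [H₂.param_zero, hb₂.apply_zero])
    (AnalyticAt.comp_of_eq hb₁.analytic_A H₁.analytic_param H₁.param_zero)
    (AnalyticAt.comp_of_eq hb₂.analytic_A H₂.analytic_param H₂.param_zero)
    hφ (by rw [hχ0, H₂.coord_zero])
    (by
      have h1 := hder.self_of_nhds
      have h2 := hd.self_of_nhds
      simp only [hχ0] at h1 h2
      rw [h1]
      exact mul_ne_zero H₂.deriv_coord_ne (right_ne_zero_of_mul_eq_one h2))
    (by
      filter_upwards [hder, hd, ht.eventually H₁.conj, ht.eventually H₂.conj, hχr]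
        with p h1 h2 h3 h4 h5
      rw [h1]
      simp only [nfField_eq] at h3 h4
      rw [h5] at h3
      rw [← h3, ← h4]
      linear_combination (deriv (φ₂ p.1) (χ p.1 p.2) * ω p.1 (χ p.1 p.2)) * h2)
  refine ⟨μ, hμ, ?_⟩
  filter_upwards [h1, (tendsto_param H₁).eventually (hb₁.eventually_coeff_eq hℓk),
    (tendsto_param H₂).eventually (hb₂.eventually_coeff_eq hℓk)] with ε h3 h4 h5 j
  rw [← h4 j, ← h5 j, h3.1]
  rfl

end NormalForms

/-! ### Normalization of analytic families -/

/-- The error term has one more order than z^(k+1), so in the coordinate z/s it is smaller by a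
factor of order s. This is the closeness needed on the disk of radius 2. -/
theorem exists_scale_of_isBigO {f : ℂ → ℂ} {k : ℕ}
    (hf : (fun z : ℂ => f z - z ^ (k + 1)) =O[𝓝 0] (fun z : ℂ => z ^ (k + 2))) {δ R : ℝ}
    (hδ : 0 < δ) (hR : 0 < R) : ∃ s : ℝ, 0 < s ∧ 2 * s < R ∧
      ∀ z : ℂ, ‖z‖ ≤ 2 * s → ‖f z - z ^ (k + 1)‖ ≤ s ^ (k + 1) * δ := by
  obtain ⟨C, hC, h⟩ := hf.exists_pos
  obtain ⟨r, hr, H⟩ := Metric.eventually_nhds_iff.1 h.bound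
  have hC2 : 0 < C * 2 ^ (k + 2) := by positivity
  set s := min (min (r / 4) (R / 4)) (δ / (C * 2 ^ (k + 2))) with hs
  have h1 : s ≤ r / 4 := (min_le_left _ _).trans (min_le_left _ _)
  have h2 : s ≤ R / 4 := (min_le_left _ _).trans (min_le_right _ _)
  have h3 : s * (C * 2 ^ (k + 2)) ≤ δ := (le_div_iff₀ hC2).1 (min_le_right _ _)
  have hs0 : 0 < s := by positivity
  refine ⟨s, hs0, by linarith, fun z hz => ?_⟩
  have h4 := H (y := z) (by rw [dist_zero_right]; linarith)
  refine h4.trans ?_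
  rw [norm_pow]
  calc C * ‖z‖ ^ (k + 2) ≤ C * (2 * s) ^ (k + 2) := by gcongr
    _ = s ^ (k + 1) * (s * (C * 2 ^ (k + 2))) := by ring
    _ ≤ _ := by gcongr

/-- The restrictions of an analytic family to a small circle depend analytically on the
parameter. -/
theorem exists_analyticAt_circleFamily {E : Type*} [NormedAddCommGroup E] [NormedSpace ℂ E]
    {ω : E → ℂ → ℂ} (hω : AnalyticAt ℂ (fun p : E × ℂ => ω p.1 p.2) (0, 0)) :
    ∃ r > 0, ∀ c : ℂ, ‖c‖ < r → ∃ f : E → CircleFun, AnalyticAt ℂ f 0 ∧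
      ∀ ε, ‖ε‖ < r → ∀ ζ : Metric.sphere (0 : ℂ) 1, f ε ζ = ω ε (c * ζ) := by
  obtain ⟨r, hr, hsup⟩ := exists_analyticAt_superposition (K := Metric.sphere (0 : ℂ) 1) hω
  refine ⟨r, hr, fun c hc => ?_⟩
  let g : E → C(Metric.sphere (0 : ℂ) 1, E × ℂ) := fun ε =>
    pairCLM _ _ _ (constCLM _ _ ε, c • circleId)
  have hg : ∀ ε, ‖ε‖ < r → ∀ ζ, dist (g ε ζ) ((0 : E), (0 : ℂ)) < r := by
    intro ε hε ζ
    change dist (ε, c * (ζ : ℂ)) ((0 : E), (0 : ℂ)) < r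
    rw [Prod.dist_eq, dist_zero_right, dist_zero_right, norm_mul, norm_coe_circle, mul_one]
    exact max_lt hε hc
  have hga : AnalyticAt ℂ g 0 :=
    ((pairCLM (Metric.sphere (0 : ℂ) 1) E ℂ).analyticAt _).comp
      (((constCLM (Metric.sphere (0 : ℂ) 1) E).analyticAt 0).prod analyticAt_const)
  refine ⟨fun ε => superposition _ (fun p : E × ℂ => ω p.1 p.2) (g ε), ?_, fun ε hε ζ =>
    (hsup (g ε) (hg ε hε)).2 ζ⟩
  exact AnalyticAt.comp_of_eq (hsup (g 0) (hg 0 (by simpa using hr))).1 hga rfl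

/-- A family of vector fields close to `z ^ (k + 1)` is conjugate to a family in normal form. -/
theorem exists_normalization {E : Type*} [NormedAddCommGroup E] [NormedSpace ℂ E] {k : ℕ}
    {ω : E → ℂ → ℂ} (hω : AnalyticAt ℂ (fun p : E × ℂ => ω p.1 p.2) (0, 0))
    (hω0 : (fun z : ℂ => ω 0 z - z ^ (k + 1)) =O[𝓝 0] (fun z : ℂ => z ^ (k + 2))) :
    ∃ (φ : E → ℂ → ℂ) (b : E → Fin k → ℂ) (A : E → ℂ),
      AnalyticAt ℂ (fun p : E × ℂ => φ p.1 p.2) (0, 0) ∧ AnalyticAt ℂ b 0 ∧ AnalyticAt ℂ A 0 ∧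
      ∀ᶠ p : E × ℂ in 𝓝 (0, 0), deriv (φ p.1) p.2 ≠ 0 ∧ 1 + A p.1 * φ p.1 p.2 ^ k ≠ 0 ∧
        deriv (φ p.1) p.2 * ω p.1 p.2 = nfVal (b p.1) (A p.1) (φ p.1 p.2) := by
  obtain ⟨Φ, B, 𝒜, -, -, -, δ, hδ, ρ, hρ, H⟩ := exists_universal_normalization k
  obtain ⟨r, hr, hcirc⟩ := exists_analyticAt_circleFamily hω
  obtain ⟨R, hR, HR⟩ := Metric.eventually_nhds_iff.1 hω.eventually_analyticAt
  obtain ⟨s, hs0, hsR, hs⟩ := exists_scale_of_isBigO hω0 (half_pos hδ) (lt_min hr hR)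
  have hsr' : 2 * s < r := hsR.trans_le (min_le_left _ _)
  have hsR' : 2 * s < R := hsR.trans_le (min_le_right _ _)
  set c : ℂ := (s : ℂ) with hc
  have hcn : ‖c‖ = s := by rw [hc, Complex.norm_real, Real.norm_of_nonneg hs0.le]
  have hc0 : c ≠ 0 := by rw [← norm_pos_iff, hcn]; exact hs0
  have hck : c ^ (k + 1) ≠ 0 := pow_ne_zero _ hc0
  obtain ⟨f', hf', hf'v⟩ := hcirc c (by linarith)
  let f : E → CircleFun := fun ε => (c ^ (k + 1))⁻¹ • f' ε
  have hf : AnalyticAt ℂ f 0 := hf'.const_smul (c := (c ^ (k + 1))⁻¹)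
  -- Rescaled field, normalized so that its leading term is w^(k+1); division by c^(k+1) instead of
  -- c only changes the time and is undone by `nfVal_mul`.
  let F : E → ℂ → ℂ := fun ε w => (c ^ (k + 1))⁻¹ * ω ε (c * w)
  have hωclose : ∀ᶠ ε in 𝓝 (0 : E), ∀ z ∈ Metric.closedBall (0 : ℂ) (2 * s),
      ‖ω ε z - ω 0 z‖ < s ^ (k + 1) * (δ / 2) := by
    refine eventually_forall_norm_lt (G := fun p : E × ℂ => ω p.1 p.2 - ω 0 p.2)
      (isCompact_closedBall _ _) ?_ (fun z _ => sub_self _) (by positivity)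
    intro z hz
    have hzR : ‖z‖ < R := lt_of_le_of_lt (mem_closedBall_zero_iff.1 hz) hsR'
    have h1 : AnalyticAt ℂ (fun p : E × ℂ => ω p.1 p.2) (0, z) :=
      HR (y := (0, z)) (by rw [Prod.dist_eq]; simpa using hzR)
    refine h1.continuousAt.sub ?_
    exact ContinuousAt.comp (f := fun p : E × ℂ => p.2) (g := ω 0) (x := (0, z))
      (analyticAt_slice h1).continuousAt continuousAt_snd
  have hgood : ∀ᶠ ε in 𝓝 (0 : E), AnalyticAt ℂ Φ (f ε, 0) ∧ AnalyticAt ℂ B (f ε) ∧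
      AnalyticAt ℂ 𝒜 (f ε) ∧ ∀ z, ‖z‖ < ρ → deriv (fun z => Φ (f ε, z)) z ≠ 0 ∧
        1 + 𝒜 (f ε) * Φ (f ε, z) ^ k ≠ 0 ∧
        deriv (fun z => Φ (f ε, z)) z * F ε z = nfVal (B (f ε)) (𝒜 (f ε)) (Φ (f ε, z)) := by
    filter_upwards [hωclose, Metric.ball_mem_nhds (0 : E) hR, Metric.ball_mem_nhds (0 : E) hr]
      with ε h1 h2 h3
    rw [mem_ball_zero_iff] at h2 h3
    have hcz : ∀ z ∈ Metric.ball (0 : ℂ) 2, ‖c * z‖ < 2 * s := by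
      intro z hz
      rw [mem_ball_zero_iff] at hz
      rw [norm_mul, hcn]
      nlinarith
    refine H (F ε) (f ε) ?_ ?_ ?_
    · intro z hz
      have h4 : AnalyticAt ℂ (fun p : E × ℂ => ω p.1 p.2) (ε, c * z) :=
        HR (y := (ε, c * z)) (by
          rw [Prod.dist_eq]; simpa only [dist_zero_right] using max_lt h2 ((hcz z hz).trans hsR'))
      have h5 : AnalyticAt ℂ (F ε) z := analyticAt_const.mul (AnalyticAt.comp_of_eq
        (analyticAt_slice h4) (f := fun w => c * w) (analyticAt_const.mul analyticAt_id) rfl)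
      exact h5.differentiableAt.differentiableWithinAt
    · intro ζ
      change (c ^ (k + 1))⁻¹ * f' ε ζ = _
      rw [hf'v ε h3]
    · intro z hz
      have h4 := h1 (c * z) (mem_closedBall_zero_iff.2 (hcz z hz).le)
      have h5 := hs (c * z) (hcz z hz).le
      have h6 : F ε z - z ^ (k + 1) = (c ^ (k + 1))⁻¹ *
          ((ω ε (c * z) - ω 0 (c * z)) + (ω 0 (c * z) - (c * z) ^ (k + 1))) := by
        simp only [F]; field_simp; ring
      rw [h6, norm_mul, norm_inv, norm_pow, hcn, inv_mul_le_iff₀ (by positivity)]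
      refine (norm_add_le _ _).trans ?_
      linarith
  obtain ⟨hΦ, hB, h𝒜, -⟩ := hgood.self_of_nhds
  have hci : c⁻¹ ≠ 0 := inv_ne_zero hc0
  refine ⟨fun ε z => c * Φ (f ε, c⁻¹ * z), fun ε => scaleCoeff c⁻¹ (B (f ε)),
    fun ε => c⁻¹ ^ k * 𝒜 (f ε), ?_, AnalyticAt.scaleCoeff _ (AnalyticAt.comp_of_eq hB hf rfl),
    analyticAt_const.mul (AnalyticAt.comp_of_eq h𝒜 hf rfl), ?_⟩
  · refine analyticAt_const.mul (AnalyticAt.comp_of_eq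
      (f := fun p : E × ℂ => (f p.1, c⁻¹ * p.2)) hΦ ?_ (by simp))
    exact (AnalyticAt.comp_of_eq (f := fun p : E × ℂ => p.1) hf analyticAt_fst rfl).prod
      (analyticAt_const.mul analyticAt_snd)
  · have h1 : ∀ᶠ z in 𝓝 (0 : ℂ), ‖c⁻¹ * z‖ < ρ := by
      have : ContinuousAt (fun z : ℂ => ‖c⁻¹ * z‖) 0 := by fun_prop
      exact this.eventually_lt continuousAt_const (by simpa using hρ)
    rw [nhds_prod_eq]
    filter_upwards [hgood.prod_mk h1] with p hp
    obtain ⟨⟨-, -, -, h2⟩, h3⟩ := hp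
    obtain ⟨h4, h5, h6⟩ := h2 _ h3
    have hd : deriv (fun z => c * Φ (f p.1, c⁻¹ * z)) p.2
        = deriv (fun z => Φ (f p.1, z)) (c⁻¹ * p.2) := by
      have h7 := (differentiableAt_of_deriv_ne_zero h4).hasDerivAt
      have h8 : HasDerivAt (fun w : ℂ => c⁻¹ * w) c⁻¹ p.2 := by
        simpa using (hasDerivAt_id p.2).const_mul c⁻¹
      have h9 := (h7.comp p.2 h8).const_mul c
      have h10 := h9.deriv
      refine h10.trans ?_
      field_simp
    rw [hd]
    refine ⟨h4, ?_, ?_⟩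
    · have h7 : c⁻¹ ^ k * 𝒜 (f p.1) * (c * Φ (f p.1, c⁻¹ * p.2)) ^ k
          = 𝒜 (f p.1) * Φ (f p.1, c⁻¹ * p.2) ^ k := by
        rw [mul_pow, inv_pow]
        have := pow_ne_zero k hc0
        field_simp
      rwa [h7]
    · have h7 := nfVal_mul hci (B (f p.1)) (𝒜 (f p.1)) (c * Φ (f p.1, c⁻¹ * p.2))
      rw [inv_mul_cancel_left₀ hc0, ← h6] at h7
      simp only [F, mul_inv_cancel_left₀ hc0] at h7
      have h8 : c⁻¹ ^ (k + 1) ≠ 0 := pow_ne_zero _ hci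
      refine mul_left_cancel₀ h8 ?_
      rw [← h7, inv_pow]
      ring

/-! ### The normal form at parameter zero -/

/-- The order of vanishing of an analytic function is bounded below by its growth. -/
theorem le_analyticOrderAt_of_isBigO {f : ℂ → ℂ} {n : ℕ} (hf : AnalyticAt ℂ f 0)
    (h : f =O[𝓝 0] fun z : ℂ => z ^ n) : (n : ℕ∞) ≤ analyticOrderAt f 0 := by
  by_contra hlt
  rw [not_le] at hlt
  obtain ⟨m, hm⟩ := ENat.ne_top_iff_exists.1 hlt.ne_top
  rw [← hm, Nat.cast_lt] at hlt
  obtain ⟨g, hg, hg0, hfg⟩ := (hf.analyticOrderAt_eq_natCast).1 hm.symm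
  obtain ⟨C, hC⟩ := h.bound
  have h1 : ∀ᶠ z in 𝓝[≠] (0 : ℂ), ‖g z‖ ≤ C * ‖z‖ ^ (n - m) := by
    filter_upwards [hC.filter_mono nhdsWithin_le_nhds, hfg.filter_mono nhdsWithin_le_nhds,
      self_mem_nhdsWithin] with z h2 h3 h4
    have hz : 0 < ‖z‖ := norm_pos_iff.2 h4
    rw [h3, sub_zero, smul_eq_mul, norm_mul, norm_pow, norm_pow,
      show n = m + (n - m) by omega, pow_add] at h2
    have h5 : 0 < ‖z‖ ^ m := by positivity
    refine le_of_mul_le_mul_left ?_ h5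
    linarith
  have h2 : Tendsto (fun z : ℂ => C * ‖z‖ ^ (n - m)) (𝓝[≠] 0) (𝓝 0) := by
    have : ContinuousAt (fun z : ℂ => C * ‖z‖ ^ (n - m)) 0 := by fun_prop
    have h3 := this.tendsto
    rw [norm_zero, zero_pow (by omega), mul_zero] at h3
    exact h3.mono_left nhdsWithin_le_nhds
  have h3 : Tendsto g (𝓝[≠] 0) (𝓝 0) := squeeze_zero_norm' h1 h2
  exact hg0 (tendsto_nhds_unique (hg.continuousAt.tendsto.mono_left nhdsWithin_le_nhds) h3)

/-- The polynomial with values `nfPoly b`. -/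
noncomputable def nfPolynomial {k : ℕ} (b : Fin k → ℂ) : Polynomial ℂ :=
  Polynomial.X ^ (k + 1) + ∑ j : Fin k, Polynomial.C (b j) * Polynomial.X ^ (j : ℕ)

theorem eval_nfPolynomial {k : ℕ} (b : Fin k → ℂ) (z : ℂ) :
    (nfPolynomial b).eval z = nfPoly b z := by
  simp [nfPolynomial, nfPoly, Polynomial.eval_finsetSum]

theorem degree_nfPolynomial_tail_lt {k : ℕ} (b : Fin k → ℂ) :
    (∑ j : Fin k, Polynomial.C (b j) * Polynomial.X ^ (j : ℕ)).degree < (k : WithBot ℕ) := by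
  refine (Polynomial.degree_sum_le _ _).trans_lt ?_
  rw [Finset.sup_lt_iff (WithBot.bot_lt_coe _)]
  intro j _
  refine (Polynomial.degree_C_mul_X_pow_le _ _).trans_lt ?_
  exact_mod_cast j.2

theorem nfPolynomial_monic {k : ℕ} (b : Fin k → ℂ) : (nfPolynomial b).Monic :=
  Polynomial.monic_X_pow_add ((degree_nfPolynomial_tail_lt b).trans (by exact_mod_cast Nat.lt_succ_self k))

theorem natDegree_nfPolynomial {k : ℕ} (b : Fin k → ℂ) : (nfPolynomial b).natDegree = k + 1 := by
  rw [nfPolynomial, Polynomial.natDegree_add_eq_left_of_degree_lt, Polynomial.natDegree_X_pow]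
  rw [Polynomial.degree_X_pow]
  exact (degree_nfPolynomial_tail_lt b).trans (by exact_mod_cast Nat.lt_succ_self k)

theorem coeff_nfPolynomial_self {k : ℕ} (b : Fin k → ℂ) : (nfPolynomial b).coeff k = 0 := by
  rw [nfPolynomial, Polynomial.coeff_add, Polynomial.coeff_X_pow, if_neg (by omega), zero_add]
  exact Polynomial.coeff_eq_zero_of_degree_lt (degree_nfPolynomial_tail_lt b)

theorem coeff_nfPolynomial {k : ℕ} (b : Fin k → ℂ) (j : Fin k) :
    (nfPolynomial b).coeff j = b j := by
  have h1 : (j : ℕ) ≠ k + 1 := by have := j.2; omega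
  rw [nfPolynomial, Polynomial.coeff_add, Polynomial.coeff_X_pow, if_neg h1, zero_add,
    Polynomial.finsetSum_coeff, Finset.sum_eq_single j]
  · simp
  · intro i _ hi
    have : (j : ℕ) ≠ i := fun h => hi (Fin.ext h.symm)
    simp [Polynomial.coeff_X_pow, this]
  · simp

/-- A normal form vanishing to the order `k + 1` is `z ^ (k + 1)`. -/
theorem eq_zero_of_le_analyticOrderAt {k : ℕ} {b : Fin k → ℂ} {w : ℂ}
    (h : ((k + 1 : ℕ) : ℕ∞) ≤ analyticOrderAt (nfPoly b) w) : w = 0 ∧ b = 0 := by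
  set P := nfPolynomial b with hP
  have hmon := nfPolynomial_monic b
  obtain ⟨Q, hQ, hQd⟩ :=
    Polynomial.exists_eq_pow_rootMultiplicity_mul_and_not_dvd P hmon.ne_zero w
  set m := P.rootMultiplicity w
  have hQw : Q.eval w ≠ 0 := fun h0 => hQd (Polynomial.dvd_iff_isRoot.2 h0)
  have hQa : AnalyticAt ℂ (fun z => Q.eval z) w := Q.differentiable.analyticAt w
  have hPa : AnalyticAt ℂ (nfPoly b) w := (differentiable_nfPoly b).analyticAt w
  have hord : analyticOrderAt (nfPoly b) w = (m : ℕ∞) := by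
    refine hPa.analyticOrderAt_eq_natCast.2 ⟨fun z => Q.eval z, hQa, hQw, ?_⟩
    refine Eventually.of_forall fun z => ?_
    rw [← eval_nfPolynomial, ← hP, hQ]
    simp
  rw [hord, Nat.cast_le] at h
  have hdvd : (Polynomial.X - Polynomial.C w) ^ (k + 1) ∣ P :=
    (pow_dvd_pow _ h).trans ⟨Q, hQ⟩
  -- A zero of order k + 1 exhausts the degree, so P = (X - w)^(k+1). Its coefficient of X^k is -(k
  -- + 1) w and must be zero: the missing term in z^k is what centres the normal form.
  have heq : P = (Polynomial.X - Polynomial.C w) ^ (k + 1) := by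
    refine (Polynomial.eq_of_monic_of_dvd_of_natDegree_le
      ((Polynomial.monic_X_sub_C w).pow (k + 1)) hmon hdvd ?_)
    rw [natDegree_nfPolynomial, Polynomial.natDegree_pow, Polynomial.natDegree_X_sub_C, mul_one]
  have hw : w = 0 := by
    have h1 := coeff_nfPolynomial_self b
    rw [← hP, heq, sub_eq_add_neg, ← Polynomial.C_neg, Polynomial.coeff_X_add_C_pow, show k + 1 - k = 1 by omega, pow_one] at h1
    have h2 : ((k + 1).choose k : ℂ) ≠ 0 := by
      rw [Nat.choose_succ_self_right]
      exact_mod_cast Nat.succ_ne_zero k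
    exact neg_eq_zero.1 ((mul_eq_zero.1 h1).resolve_right h2)
  refine ⟨hw, funext fun j => ?_⟩
  rw [← coeff_nfPolynomial b j, ← hP, heq, hw, Polynomial.C_0, sub_zero, Polynomial.coeff_X_pow,
    if_neg (by have := j.2; omega)]
  rfl

/-! ### Genericity and the choice of parameters -/

theorem mul_circleResidue_eq {f : CircleFun} {g : ℂ → ℂ} {s : ℝ}
    (h : ∀ ζ, f ζ = g (s * ζ)) :
    s * circleResidue f = (2 * Real.pi * Complex.I)⁻¹ * ∮ z in C(0, s), g z := by
  change (s : ℂ) * ((2 * Real.pi : ℂ)⁻¹ * _) = _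
  have h0 : ∀ θ : ℝ, circleMap 0 s θ = s * circleMap 0 1 θ := by
    intro θ; simp [circleMap]
  have h1 : ∀ θ : ℝ, deriv (circleMap 0 s) θ • g (circleMap 0 s θ)
      = (Complex.I * s) * (circleMap 0 1 θ * f (circlePoint θ)) := by
    intro θ
    rw [h, deriv_circleMap, h0]
    simp only [circlePoint, smul_eq_mul]
    ring
  rw [circleIntegral]
  simp_rw [h1]
  rw [intervalIntegral.integral_const_mul, mul_inv]
  field_simp

theorem norm_inverse_circleId_pow_le (n : ℕ) : ‖Ring.inverse circleId ^ n‖ ≤ 1 := by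
  refine (ContinuousMap.norm_le _ zero_le_one).2 fun ζ => ?_
  rw [ContinuousMap.pow_apply, circleFun_inverse_apply (f := circleId) coe_circle_ne_zero, circleId_apply, norm_pow,
    norm_inv, norm_coe_circle, inv_one, one_pow]

/-- Cauchy's estimate for the derivatives of the Taylor coefficients with respect to the
parameter. -/
theorem exists_norm_fderiv_coeffFn_le {ℓ : ℕ} {ω : (Fin ℓ → ℂ) → ℂ → ℂ}
    (hω : AnalyticAt ℂ (fun p : (Fin ℓ → ℂ) × ℂ => ω p.1 p.2) (0, 0)) :
    ∃ r > 0, ∀ (s C : ℝ) (i : ℕ) (e : Fin ℓ → ℂ), 0 < s → s < r →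
      (∀ z : ℂ, ‖z‖ = s →
        ‖fderiv ℂ (fun p : (Fin ℓ → ℂ) × ℂ => ω p.1 p.2) (0, z) (e, 0)‖ ≤ C) →
      s ^ i * ‖fderiv ℂ (coeffFn ω i) 0 e‖ ≤ C := by
  obtain ⟨r, hr, hcirc⟩ := exists_analyticAt_circleFamily hω
  obtain ⟨R, hR, HR⟩ := Metric.eventually_nhds_iff.1 hω.eventually_analyticAt
  refine ⟨min r R, lt_min hr hR, fun s C i e hs0 hs hC => ?_⟩
  have hsr : s < r := hs.trans_le (min_le_left _ _)
  have hsR : s < R := hs.trans_le (min_le_right _ _)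
  have hcn : ‖(s : ℂ)‖ = s := by rw [Complex.norm_real, Real.norm_of_nonneg hs0.le]
  have hc0 : (s : ℂ) ≠ 0 := by rw [← norm_pos_iff, hcn]; exact hs0
  obtain ⟨f, hf, hfv⟩ := hcirc s (by rw [hcn]; exact hsr)
  -- By Cauchy's formula the coefficient is a fixed continuous linear functional of the restriction
  -- of ω_ε to the circle of radius s, so its ε-derivative is estimated by that of the restriction.
  have hcoeff : ∀ᶠ ε in 𝓝 (0 : Fin ℓ → ℂ), coeffFn ω i ε
      = ((s : ℂ) ^ i)⁻¹ * circleResidue (Ring.inverse circleId ^ (i + 1) * f ε) := by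
    filter_upwards [Metric.ball_mem_nhds (0 : Fin ℓ → ℂ) hr, Metric.ball_mem_nhds (0 : Fin ℓ → ℂ) hR]
      with ε h1 h2
    rw [mem_ball_zero_iff] at h1 h2
    have hd : DifferentiableOn ℂ (ω ε) (Metric.closedBall 0 s) := by
      intro z hz
      have hz' := (mem_closedBall_zero_iff.1 hz).trans_lt hsR
      exact (analyticAt_slice (HR (y := (ε, z)) (by
        rw [Prod.dist_eq]
        simpa only [dist_zero_right] using
          max_lt h2 hz'))).differentiableAt.differentiableWithinAt
    have h3 := hd.circleIntegral_one_div_sub_center_pow_smul hs0 i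
    have h4 := mul_circleResidue_eq (s := s) (f := Ring.inverse circleId ^ (i + 1) * f ε)
      (g := fun z => (s : ℂ) ^ (i + 1) * ((1 / (z - 0) ^ (i + 1)) • ω ε z)) (by
        intro ζ
        have h5 := coe_circle_ne_zero ζ
        rw [ContinuousMap.mul_apply, ContinuousMap.pow_apply,
          circleFun_inverse_apply (f := circleId) coe_circle_ne_zero, circleId_apply, hfv ε h1]
        rw [sub_zero, smul_eq_mul, mul_pow, inv_pow]
        field_simp)
    rw [circleIntegral.integral_const_mul, h3] at h4
    have h6 : circleResidue (Ring.inverse circleId ^ (i + 1) * f ε)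
        = (s : ℂ) ^ i * coeffFn ω i ε := by
      refine mul_left_cancel₀ hc0 (h4.trans ?_)
      have h7 := Complex.two_pi_I_ne_zero
      rw [coeffFn, smul_eq_mul, pow_succ]
      field_simp
    rw [h6, inv_mul_cancel_left₀ (pow_ne_zero _ hc0)]
  have hline : HasDerivAt (fun t : ℂ => t • e) e 0 := by
    simpa using (hasDerivAt_id (0 : ℂ)).smul_const e
  have hfd : HasFDerivAt f (fderiv ℂ f 0) 0 := hf.differentiableAt.hasFDerivAt
  have hfe : HasDerivAt (fun t : ℂ => f (t • e)) (fderiv ℂ f 0 e) 0 :=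
    HasFDerivAt.comp_hasDerivAt_of_eq (0 : ℂ) hfd hline (by simp)
  have hval : ∀ ζ, ‖fderiv ℂ f 0 e ζ‖ ≤ C := by
    intro ζ
    have hz : ‖(s : ℂ) * ζ‖ = s := by rw [norm_mul, hcn, norm_coe_circle, mul_one]
    have h1 : HasDerivAt (fun t : ℂ => f (t • e) ζ) (fderiv ℂ f 0 e ζ) 0 :=
      (ContinuousMap.evalCLM ℂ ζ : CircleFun →L[ℂ] ℂ).hasFDerivAt.comp_hasDerivAt (0 : ℂ) hfe
    have h2 : AnalyticAt ℂ (fun p : (Fin ℓ → ℂ) × ℂ => ω p.1 p.2) (0, s * ζ) :=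
      HR (y := (0, s * ζ)) (by
        rw [Prod.dist_eq]
        simpa only [dist_self, dist_zero_right, hz] using max_lt hR hsR)
    have h3 : HasDerivAt (fun t : ℂ => (t • e, (s : ℂ) * ζ)) (e, 0) 0 :=
      hline.prodMk (hasDerivAt_const _ _)
    have h4 : HasDerivAt (fun t : ℂ => ω (t • e) (s * ζ))
        (fderiv ℂ (fun p : (Fin ℓ → ℂ) × ℂ => ω p.1 p.2) (0, s * ζ) (e, 0)) 0 :=
      HasFDerivAt.comp_hasDerivAt_of_eq (l := fun p : (Fin ℓ → ℂ) × ℂ => ω p.1 p.2) (0 : ℂ)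
        h2.differentiableAt.hasFDerivAt h3 (by simp)
    have h5 : (fun t : ℂ => f (t • e) ζ) =ᶠ[𝓝 0] fun t : ℂ => ω (t • e) (s * ζ) := by
      have h6 : Tendsto (fun t : ℂ => t • e) (𝓝 0) (𝓝 0) := by
        have : Continuous (fun t : ℂ => t • e) := by fun_prop
        simpa using this.tendsto 0
      filter_upwards [h6.eventually (Metric.ball_mem_nhds (0 : Fin ℓ → ℂ) hr)] with t ht
      exact hfv _ (mem_ball_zero_iff.1 ht) ζ
    rw [h1.unique (h4.congr_of_eventuallyEq h5)]
    exact hC _ hz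
  have hC0 : 0 ≤ C := (norm_nonneg _).trans (hC s hcn)
  have hmul : HasFDerivAt (fun ε => ((s : ℂ) ^ i)⁻¹ * circleResidue
      (Ring.inverse circleId ^ (i + 1) * f ε)) (((s : ℂ) ^ i)⁻¹ • (circleResidue.comp
      (Ring.inverse circleId ^ (i + 1) • fderiv ℂ f 0))) 0 :=
    (circleResidue.hasFDerivAt.comp (0 : Fin ℓ → ℂ) (hfd.const_mul _)).const_mul _
  rw [(hmul.congr_of_eventuallyEq hcoeff).fderiv]
  simp only [smul_apply, ContinuousLinearMap.comp_apply, smul_eq_mul]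
  rw [norm_mul, norm_inv, norm_pow, hcn, mul_inv_cancel_left₀ (by positivity)]
  refine (norm_circleResidue_le _).trans ((norm_mul_le _ _).trans ?_)
  calc _ ≤ 1 * C := by
        gcongr
        · exact norm_inverse_circleId_pow_le _
        · exact (ContinuousMap.norm_le _ hC0).2 hval
    _ = C := one_mul C

theorem isBigO_pow_pow {m n : ℕ} (h : m ≤ n) :
    (fun z : ℂ => z ^ n) =O[𝓝 0] fun z : ℂ => z ^ m := by
  refine Asymptotics.IsBigO.of_bound 1 ?_
  filter_upwards [Metric.ball_mem_nhds (0 : ℂ) one_pos] with z hz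
  rw [mem_ball_zero_iff] at hz
  rw [one_mul, norm_pow, norm_pow]
  exact pow_le_pow_of_le_one (norm_nonneg z) hz.le h

theorem isBigO_of_parabolic {f : ℂ → ℂ} {k : ℕ}
    (hf : (fun z : ℂ => f z - z ^ (k + 1)) =O[𝓝 0] (fun z : ℂ => z ^ (k + 2))) :
    f =O[𝓝 0] fun z : ℂ => z ^ (k + 1) := by
  have h := (hf.trans (isBigO_pow_pow (Nat.le_succ (k + 1)))).add
    (Asymptotics.isBigO_refl (fun z : ℂ => z ^ (k + 1)) (𝓝 0))
  simpa using h

/-- A conjugacy of a parabolic germ with a normal form fixes the origin, and the normal form is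
`z ^ (k + 1) / (1 + A z ^ k)`. -/
theorem eq_zero_of_conj_parabolic {k : ℕ} {b : Fin k → ℂ} {A : ℂ} {f φ : ℂ → ℂ}
    (hf : (fun z : ℂ => f z - z ^ (k + 1)) =O[𝓝 0] (fun z : ℂ => z ^ (k + 2)))
    (hφ : AnalyticAt ℂ φ 0) (hφ' : deriv φ 0 ≠ 0)
    (hconj : ∀ᶠ z in 𝓝 (0 : ℂ), 1 + A * φ z ^ k ≠ 0 ∧ deriv φ z * f z = nfVal b A (φ z)) :
    φ 0 = 0 ∧ b = 0 := by
  -- P_b∘φ is an analytic factor times f, hence O(z^(k+1)). As φ is a local diffeomorphism, P_b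
  -- vanishes to order k + 1 at φ(0).
  have h1 : (fun z => nfPoly b (φ z)) =ᶠ[𝓝 0] fun z => deriv φ z * (1 + A * φ z ^ k) * f z := by
    filter_upwards [hconj] with z ⟨h2, h3⟩
    rw [mul_right_comm, h3, nfVal, div_mul_cancel₀ _ h2]
  have h2 : (fun z => deriv φ z * (1 + A * φ z ^ k)) =O[𝓝 0] fun _ => (1 : ℂ) := by
    refine (ContinuousAt.tendsto ?_).isBigO_one ℂ
    exact hφ.deriv.continuousAt.mul
      (continuousAt_const.add (continuousAt_const.mul (hφ.continuousAt.pow k)))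
  have h3 : (fun z => nfPoly b (φ z)) =O[𝓝 0] fun z : ℂ => z ^ (k + 1) := by
    refine h1.trans_isBigO ?_
    simpa using h2.mul (isBigO_of_parabolic hf)
  have h4 := le_analyticOrderAt_of_isBigO
    (((differentiable_nfPoly b).analyticAt (φ 0)).comp hφ) h3
  rw [analyticOrderAt_comp_of_deriv_ne_zero hφ hφ'] at h4
  exact eq_zero_of_le_analyticOrderAt h4

/-- The low order coefficients of the normal form of a generic unfolding are parameters. -/
theorem fderiv_coeff_injective {k ℓ : ℕ} (hℓk : ℓ ≤ k) {ω φ : (Fin ℓ → ℂ) → ℂ → ℂ}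
    {b : (Fin ℓ → ℂ) → Fin k → ℂ} {A : (Fin ℓ → ℂ) → ℂ} (hω : IsGenericUnfolding k ℓ ω)
    (hφ : AnalyticAt ℂ (fun p : (Fin ℓ → ℂ) × ℂ => φ p.1 p.2) (0, 0)) (hφ0 : φ 0 0 = 0)
    (hφ' : deriv (φ 0) 0 ≠ 0) (hb : AnalyticAt ℂ b 0) (hb0 : b 0 = 0) (hA : AnalyticAt ℂ A 0)
    (hconj : ∀ᶠ p : (Fin ℓ → ℂ) × ℂ in 𝓝 (0, 0), 1 + A p.1 * φ p.1 p.2 ^ k ≠ 0 ∧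
      deriv (φ p.1) p.2 * ω p.1 p.2 = nfVal (b p.1) (A p.1) (φ p.1 p.2)) :
    Function.Injective (fderiv ℂ (fun ε (j : Fin ℓ) => b ε (Fin.castLE hℓk j)) 0) := by
  rw [injective_iff_map_eq_zero]
  intro e he
  have hbd : HasFDerivAt b (fderiv ℂ b 0) 0 := hb.differentiableAt.hasFDerivAt
  set b' := fderiv ℂ b 0 e with hb'
  have hbj : ∀ j : Fin k, (j : ℕ) < ℓ → b' j = 0 := by
    intro j hj
    have h1 : HasFDerivAt (fun ε (j : Fin ℓ) => b ε (Fin.castLE hℓk j))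
        (ContinuousLinearMap.pi fun j : Fin ℓ =>
          (ContinuousLinearMap.proj (Fin.castLE hℓk j)).comp (fderiv ℂ b 0)) 0 :=
      hasFDerivAt_pi.2 fun j => (hasFDerivAt_pi'.1 hbd) (Fin.castLE hℓk j)
    rw [h1.fderiv] at he
    exact congrFun he ⟨j, hj⟩
  have hline : HasDerivAt (fun t : ℂ => t • e) e 0 := by
    simpa using (hasDerivAt_id (0 : ℂ)).smul_const e
  -- The conjugacy without denominators reads K ω = P_b(φ), with K analytic and nonzero at the
  -- origin.
  let K : (Fin ℓ → ℂ) × ℂ → ℂ := fun p =>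
    fderiv ℂ (fun p : (Fin ℓ → ℂ) × ℂ => φ p.1 p.2) p (0, 1) * (1 + A p.1 * φ p.1 p.2 ^ k)
  have hK : AnalyticAt ℂ K (0, 0) :=
    ((ContinuousLinearMap.apply ℂ ℂ ((0 : Fin ℓ → ℂ), (1 : ℂ))).analyticAt _ |>.comp hφ.fderiv).mul
      (analyticAt_const.add ((AnalyticAt.comp_of_eq (f := fun p : (Fin ℓ → ℂ) × ℂ => p.1) hA
        analyticAt_fst rfl).mul (hφ.pow k)))
  have hK0 : K (0, 0) ≠ 0 := by
    have h1 := hconj.self_of_nhds.1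
    simp only [K]
    rw [fderiv_slice hφ]
    exact mul_ne_zero hφ' h1
  have hKω : ∀ᶠ p : (Fin ℓ → ℂ) × ℂ in 𝓝 (0, 0),
      K p * ω p.1 p.2 = nfPoly (b p.1) (φ p.1 p.2) := by
    filter_upwards [hconj, hφ.eventually_analyticAt] with p ⟨h1, h2⟩ h3
    simp only [K]
    rw [fderiv_slice h3, mul_right_comm, h2, nfVal, div_mul_cancel₀ _ h1]
  have hz : Tendsto (fun z : ℂ => ((0 : Fin ℓ → ℂ), z)) (𝓝 0) (𝓝 (0, 0)) := by
    have : Continuous (fun z : ℂ => ((0 : Fin ℓ → ℂ), z)) := by fun_prop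
    exact this.tendsto 0
  let D : ((Fin ℓ → ℂ) × ℂ → ℂ) → ℂ → ℂ := fun F z => fderiv ℂ F (0, z) (e, 0)
  have hDbound : ∀ F, AnalyticAt ℂ F (0, 0) → D F =O[𝓝 0] fun _ => (1 : ℂ) := by
    intro F hF
    have h1 : ContinuousAt (fun p => fderiv ℂ F p (e, 0)) (0, 0) :=
      hF.fderiv.continuousAt.clm_apply continuousAt_const
    exact (h1.tendsto.comp hz).isBigO_one ℂ
  have hDd : ∀ F z, AnalyticAt ℂ F (0, z) → HasDerivAt (fun t : ℂ => F (t • e, z)) (D F z) 0 := by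
    intro F z hF
    have h3 : HasDerivAt (fun t : ℂ => (t • e, z)) (e, 0) 0 := hline.prodMk (hasDerivAt_const _ _)
    exact HasFDerivAt.comp_hasDerivAt_of_eq (l := F) (0 : ℂ) hF.differentiableAt.hasFDerivAt h3
      (by simp)
  set Ω : (Fin ℓ → ℂ) × ℂ → ℂ := fun p => ω p.1 p.2 with hΩ
  set Φ : (Fin ℓ → ℂ) × ℂ → ℂ := fun p => φ p.1 p.2 with hΦ
  have hbe : HasDerivAt (fun t : ℂ => b (t • e)) b' 0 :=
    HasFDerivAt.comp_hasDerivAt_of_eq (0 : ℂ) hbd hline (by simp)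
  -- Derivative of K ω = P_b(φ) at ε = 0 in a direction `e` killing the first ℓ coefficients of b.
  -- Every term other than K ∂ω is O(z^ℓ): φ_0^k since k ≥ ℓ, b'_j φ_0^j since only j ≥ ℓ remain,
  -- and ω_0 since it is O(z^(k+1)). Hence ∂ω = O(z^ℓ).
  have hder : ∀ᶠ z in 𝓝 (0 : ℂ), D K z * ω 0 z + K (0, z) * D Ω z
      = (k + 1 : ℂ) * φ 0 z ^ k * D Φ z + ∑ j, b' j * φ 0 z ^ (j : ℕ) := by
    filter_upwards [hz.eventually hKω.eventually_nhds, hz.eventually hK.eventually_analyticAt,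
      hz.eventually hφ.eventually_analyticAt, hz.eventually hω.analytic.eventually_analyticAt]
      with z h1 h2 h3 h4
    have h5 := (hDd K z h2).fun_mul (hDd Ω z h4)
    have h6 := hDd Φ z h3
    have h7 : ∀ j ∈ (Finset.univ : Finset (Fin k)), HasDerivAt
        (fun t : ℂ => b (t • e) j * Φ (t • e, z) ^ (j : ℕ)) (b' j * φ 0 z ^ (j : ℕ)) 0 := by
      intro j _
      have h8 := ((hasDerivAt_pi.1 hbe) j).fun_mul (h6.fun_pow (j : ℕ))
      simpa [hb0, hΦ] using h8
    have h8 := (h6.fun_pow (k + 1)).fun_add (HasDerivAt.fun_sum h7)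
    have h9 : (fun t : ℂ => K (t • e, z) * Ω (t • e, z)) =ᶠ[𝓝 0] fun t : ℂ =>
        Φ (t • e, z) ^ (k + 1) + ∑ j, b (t • e) j * Φ (t • e, z) ^ (j : ℕ) := by
      have h10 : Tendsto (fun t : ℂ => (t • e, z)) (𝓝 0) (𝓝 (0, z)) := by
        have : Continuous (fun t : ℂ => (t • e, z)) := by fun_prop
        simpa using this.tendsto 0
      exact h10.eventually h1
    have h10 := h5.unique (h8.congr_of_eventuallyEq h9)
    simpa [hΩ, hΦ] using h10
  have hφz : φ 0 =O[𝓝 0] fun z : ℂ => z := by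
    have h1 := (analyticAt_slice hφ).differentiableAt.isBigO_sub
    simpa [hφ0] using h1
  have hφn : ∀ n, ℓ ≤ n → (fun z => φ 0 z ^ n) =O[𝓝 0] fun z : ℂ => z ^ ℓ := fun n hn =>
    (hφz.pow n).trans (isBigO_pow_pow hn)
  have hR : (fun z => (k + 1 : ℂ) * φ 0 z ^ k * D Φ z + ∑ j, b' j * φ 0 z ^ (j : ℕ)
      - D K z * ω 0 z) =O[𝓝 0] fun z : ℂ => z ^ ℓ := by
    refine (Asymptotics.IsBigO.add ?_ (Asymptotics.IsBigO.fun_sum fun j _ => ?_)).sub ?_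
    · simpa using ((hφn k hℓk).const_mul_left (k + 1 : ℂ)).mul (hDbound Φ hφ)
    · rcases lt_or_ge (j : ℕ) ℓ with h | h
      · simpa [hbj j h] using Asymptotics.isBigO_zero (fun z : ℂ => z ^ ℓ) (𝓝 (0 : ℂ))
      · exact (hφn j h).const_mul_left _
    · have h1 := (hDbound K hK).mul (isBigO_of_parabolic hω.parabolic)
      simp only [one_mul] at h1
      exact h1.trans (isBigO_pow_pow (by omega))
  have hDΩ : D Ω =O[𝓝 0] fun z : ℂ => z ^ ℓ := by
    have h1 : ContinuousAt (fun z => K (0, z)) 0 := hK.continuousAt.tendsto.comp hz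
    have h2 : (fun z => (K (0, z))⁻¹) =O[𝓝 0] fun _ => (1 : ℂ) :=
      ((h1.inv₀ hK0).tendsto).isBigO_one ℂ
    have h3 := h2.mul hR
    simp only [one_mul] at h3
    refine Asymptotics.IsBigO.congr' h3 ?_ EventuallyEq.rfl
    filter_upwards [hder, h1.eventually_ne hK0] with z h4 h5
    rw [← h4, add_sub_cancel_left, inv_mul_cancel_left₀ h5]
  obtain ⟨r, hr, hcauchy⟩ := exists_norm_fderiv_coeffFn_le hω.analytic
  obtain ⟨C, hC⟩ := hDΩ.bound
  obtain ⟨r', hr', hC'⟩ := Metric.eventually_nhds_iff.1 hC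
  -- Cauchy's estimate on |z| = s bounds ∂c_i by C s^(ℓ-i), which tends to 0 with s for i < ℓ. A
  -- nonzero `e` would then lie in the kernel of the Jacobian matrix.
  have hzero : ∀ i : Fin ℓ, fderiv ℂ (coeffFn ω i) 0 e = 0 := by
    intro i
    have h1 : ∀ᶠ s in 𝓝[>] (0 : ℝ), ‖fderiv ℂ (coeffFn ω i) 0 e‖ ≤ C * s ^ (ℓ - (i : ℕ)) := by
      filter_upwards [Ioo_mem_nhdsGT (lt_min hr hr')] with s hs
      have hs0 : 0 < s := hs.1
      have h2 := hcauchy s (C * s ^ ℓ) i e hs0 (hs.2.trans_le (min_le_left _ _)) (by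
        intro z hzs
        have h3 := hC' (y := z) (by
          rw [dist_zero_right, hzs]; exact hs.2.trans_le (min_le_right _ _))
        rwa [norm_pow, hzs] at h3)
      have h4 : s ^ ℓ = s ^ (i : ℕ) * s ^ (ℓ - (i : ℕ)) := by
        rw [← pow_add]; congr 1; have := i.2; omega
      refine le_of_mul_le_mul_left ?_ (pow_pos hs0 (i : ℕ))
      rw [h4] at h2
      linarith
    have h2 : Tendsto (fun s : ℝ => C * s ^ (ℓ - (i : ℕ))) (𝓝[>] 0) (𝓝 0) := by
      have : Continuous (fun s : ℝ => C * s ^ (ℓ - (i : ℕ))) := by fun_prop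
      have h3 := this.tendsto 0
      rw [zero_pow (by have := i.2; omega), mul_zero] at h3
      exact h3.mono_left nhdsWithin_le_nhds
    exact norm_le_zero_iff.1 (ge_of_tendsto h2 h1)
  refine Matrix.eq_zero_of_mulVec_eq_zero hω.generic (funext fun i => ?_)
  rw [Matrix.mulVec, dotProduct, Pi.zero_apply, ← hzero i]
  conv_rhs => rw [← Finset.univ_sum_single e, map_sum]
  refine Finset.sum_congr rfl fun j _ => ?_
  rw [Matrix.of_apply, mul_comm, ← smul_eq_mul, ← map_smul, ← Pi.single_smul, smul_eq_mul, mul_one]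

/-! ### A as the sum of the inverse eigenvalues -/

theorem hasDerivAt_nfPoly {k : ℕ} (b : Fin k → ℂ) (z : ℂ) :
    HasDerivAt (nfPoly b) ((nfPolynomial b).derivative.eval z) z := by
  have h : nfPoly b = fun z => (nfPolynomial b).eval z := funext fun z =>
    (eval_nfPolynomial b z).symm
  rw [h]
  exact (nfPolynomial b).hasDerivAt z

/-- The residue theorem for `(1 + A z ^ k) / P` on the Riemann sphere, when the roots of `P` are
simple. -/
theorem sum_roots_eq {k : ℕ} (hk : 1 ≤ k) (b : Fin k → ℂ) (A : ℂ)
    (h : ∀ c ∈ (nfPolynomial b).roots, (nfPolynomial b).derivative.eval c ≠ 0) :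
    ∑ c ∈ (nfPolynomial b).roots.toFinset,
      (1 + A * c ^ k) / (nfPolynomial b).derivative.eval c = A := by
  classical
  set P := nfPolynomial b with hP
  have hmon : P.Monic := nfPolynomial_monic b
  have hnodup : P.roots.Nodup := by
    rw [Multiset.nodup_iff_count_le_one]
    intro c
    rw [Polynomial.count_roots]
    by_contra hlt
    rw [not_le] at hlt
    have h1 := (Polynomial.one_lt_rootMultiplicity_iff_isRoot hmon.ne_zero).1 hlt
    exact h c ((Polynomial.mem_roots hmon.ne_zero).2 h1.1) h1.2
  have hcard : P.roots.card = k + 1 := by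
    rw [← natDegree_nfPolynomial b]
    exact (IsAlgClosed.splits P).natDegree_eq_card_roots.symm
  set s := P.roots.toFinset with hs
  have hscard : s.card = k + 1 := by
    rw [hs, Multiset.toFinset_card_of_nodup hnodup, hcard]
  have hnodal : Lagrange.nodal s id = P := by
    rw [Lagrange.nodal_eq, Finset.prod_eq_multiset_prod, hs, Multiset.toFinset_val,
      Multiset.dedup_eq_self.2 hnodup]
    exact Polynomial.prod_multiset_X_sub_C_of_monic_of_roots_card_eq hmon
      (by rw [hcard, natDegree_nfPolynomial])
  -- 1 + A X^k has degree below the number k + 1 of nodes, so it is its own Lagrange interpolant.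
  -- Comparing coefficients of X^k gives Σ f(c)/P'(c) = A; k ≥ 1 keeps the constant 1 out of that
  -- coefficient.
  set f : Polynomial ℂ := Polynomial.C A * Polynomial.X ^ k + 1 with hf
  have hfdeg : f.degree < s.card := by
    rw [hscard, Polynomial.degree_lt_iff_coeff_zero]
    intro m hm
    have h1 : m ≠ k := by omega
    have h2 : m ≠ 0 := by omega
    simp [hf, Polynomial.coeff_X_pow, Polynomial.coeff_one, h1, h2]
  have hfc : f.coeff (s.card - 1) = A := by
    rw [hscard, Nat.add_sub_cancel]
    have h2 : k ≠ 0 := by omega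
    simp [hf, Polynomial.coeff_one, h2]
  refine Eq.trans ?_ ((Lagrange.coeff_eq_sum (v := id) (Set.injOn_id _) hfdeg).symm.trans hfc)
  refine Finset.sum_congr rfl fun c hc => ?_
  have h1 := Lagrange.eval_nodal_derivative_eval_node_eq (v := id) hc
  rw [hnodal, Lagrange.eval_nodal] at h1
  simp only [id_eq] at h1
  rw [h1]
  simp [hf, add_comm]

/-- All roots of P_b, and not only some, tend to 0 with b. The zeros of ω_ε in a small disk
therefore account for every root, and the global sum of residues applies. -/
theorem norm_root_lt {k : ℕ} {b : Fin k → ℂ} {η : ℝ} (hη : 0 < η) (hη1 : η ≤ 1)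
    (hb : ‖b‖ * k < η ^ (k + 1)) {c : ℂ} (hc : nfPoly b c = 0) : ‖c‖ < η := by
  by_contra hlt
  rw [not_lt] at hlt
  have hc0 : 0 < ‖c‖ := hη.trans_le hlt
  have h1 : ‖c‖ ^ (k + 1) ≤ ‖b‖ * k * max 1 (‖c‖ ^ k) := by
    have h2 : c ^ (k + 1) = -∑ j : Fin k, b j * c ^ (j : ℕ) := eq_neg_of_add_eq_zero_left hc
    rw [← norm_pow, h2, norm_neg]
    have h3 : ∀ j ∈ (Finset.univ : Finset (Fin k)),
        ‖b j * c ^ (j : ℕ)‖ ≤ ‖b‖ * max 1 (‖c‖ ^ k) := by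
      intro j _
      rw [norm_mul, norm_pow]
      gcongr
      · exact norm_le_pi_norm b j
      · rcases le_total ‖c‖ 1 with h | h
        · exact (pow_le_one₀ hc0.le h).trans (le_max_left _ _)
        · exact (pow_le_pow_right₀ h j.2.le).trans (le_max_right _ _)
    refine (norm_sum_le_of_le _ h3).trans (le_of_eq ?_)
    rw [Finset.sum_const, Finset.card_univ, Fintype.card_fin, nsmul_eq_mul]
    ring
  have h4 : η ^ (k + 1) ≤ 1 := pow_le_one₀ hη.le hη1
  rcases le_total ‖c‖ 1 with h | h
  · rw [max_eq_left (pow_le_one₀ hc0.le h), mul_one] at h1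
    have h5 : η ^ (k + 1) ≤ ‖c‖ ^ (k + 1) := by gcongr
    linarith
  · rw [max_eq_right (one_le_pow₀ h), pow_succ] at h1
    have h5 : 0 < ‖c‖ ^ k := by positivity
    have h6 : ‖b‖ * k * ‖c‖ ^ k < 1 * ‖c‖ ^ k := by gcongr; linarith
    nlinarith

/-- The eigenvalue of a vector field at a zero is preserved by changes of coordinate. -/
theorem deriv_eq_of_conj {k : ℕ} {b : Fin k → ℂ} {A z : ℂ} {f φ : ℂ → ℂ} (hf : AnalyticAt ℂ f z)
    (hφ : AnalyticAt ℂ φ z) (hφ' : deriv φ z ≠ 0) (hfz : f z = 0)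
    (hA : 1 + A * φ z ^ k ≠ 0) (hP : nfPoly b (φ z) = 0)
    (hconj : ∀ᶠ w in 𝓝 z, deriv φ w * f w = nfVal b A (φ w)) :
    deriv f z = (nfPolynomial b).derivative.eval (φ z) / (1 + A * φ z ^ k) := by
  have h1 := hφ.deriv.differentiableAt.hasDerivAt.fun_mul hf.differentiableAt.hasDerivAt
  have h2 := (hasDerivAt_nfPoly b (φ z)).comp z hφ.differentiableAt.hasDerivAt
  have h3 := ((hφ.differentiableAt.hasDerivAt.fun_pow k).const_mul A).const_add 1
  have h4 : HasDerivAt (fun w => deriv φ w * f w) _ z :=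
    (h2.fun_div h3 hA).congr_of_eventuallyEq hconj
  have h5 := h1.unique h4
  simp only [Function.comp_apply, hP, hfz, mul_zero, zero_mul, sub_zero, zero_add] at h5
  refine mul_left_cancel₀ hφ' (h5.trans ?_)
  field_simp

/-- The residue at infinity of the dual form is the sum of the inverses of the eigenvalues. -/
theorem isSumInvEigenvalues_of_conj {k ℓ : ℕ} (hk : 1 ≤ k) {ω φ : (Fin ℓ → ℂ) → ℂ → ℂ}
    {b : (Fin ℓ → ℂ) → Fin k → ℂ} {A A' : (Fin ℓ → ℂ) → ℂ} {h : (Fin ℓ → ℂ) → (Fin ℓ → ℂ)}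
    (hω : AnalyticAt ℂ (fun p : (Fin ℓ → ℂ) × ℂ => ω p.1 p.2) (0, 0))
    (hφ : AnalyticAt ℂ (fun p : (Fin ℓ → ℂ) × ℂ => φ p.1 p.2) (0, 0)) (hφ0 : φ 0 0 = 0)
    (hφ' : deriv (φ 0) 0 ≠ 0) (hb : AnalyticAt ℂ b 0) (hb0 : b 0 = 0)
    (hA : ∀ᶠ ε in 𝓝 (0 : Fin ℓ → ℂ), A' (h ε) = A ε)
    (hconj : ∀ᶠ p : (Fin ℓ → ℂ) × ℂ in 𝓝 (0, 0), deriv (φ p.1) p.2 ≠ 0 ∧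
      1 + A p.1 * φ p.1 p.2 ^ k ≠ 0 ∧
      deriv (φ p.1) p.2 * ω p.1 p.2 = nfVal (b p.1) (A p.1) (φ p.1 p.2)) :
    IsSumInvEigenvalues ω h A' := by
  obtain ⟨χ, hχ, hχ0, hχr, hχl⟩ := exists_coord_inverse hφ hφ0 hφ'
  have hgood : ∀ᶠ p : (Fin ℓ → ℂ) × ℂ in 𝓝 (0, 0), (χ p.1 (φ p.1 p.2) = p.2 ∧
      AnalyticAt ℂ (φ p.1) p.2 ∧ AnalyticAt ℂ (ω p.1) p.2) ∧ deriv (φ p.1) p.2 ≠ 0 ∧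
      1 + A p.1 * φ p.1 p.2 ^ k ≠ 0 ∧
      ∀ᶠ z in 𝓝 p.2, deriv (φ p.1) z * ω p.1 z = nfVal (b p.1) (A p.1) (φ p.1 z) := by
    filter_upwards [hχl, hφ.eventually_analyticAt, hω.eventually_analyticAt,
      hconj.eventually_nhds] with p h1 h2 h3 h4
    have h5 : ContinuousAt (fun z : ℂ => (p.1, z)) p.2 := by fun_prop
    exact ⟨⟨h1, analyticAt_slice h2, analyticAt_slice h3⟩, h4.self_of_nhds.1, h4.self_of_nhds.2.1,
      (h5.eventually h4).mono fun z hz => hz.2.2⟩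
  obtain ⟨R, hR, HR⟩ := Metric.eventually_nhds_iff.1 hgood
  refine ⟨R, hR, fun r hr0 hrR => ?_⟩
  have hχsmall : ∀ᶠ p : (Fin ℓ → ℂ) × ℂ in 𝓝 (0, 0), ‖χ p.1 p.2‖ < r := by
    refine hχ.continuousAt.norm.eventually_lt continuousAt_const ?_
    simpa [hχ0] using hr0
  obtain ⟨η, hη, Hη⟩ := Metric.eventually_nhds_iff.1 (hχsmall.and hχr)
  set η' := min η 1 with hη'
  have hη'0 : 0 < η' := lt_min hη one_pos
  have hbsmall : ∀ᶠ ε in 𝓝 (0 : Fin ℓ → ℂ), ‖b ε‖ * k < η' ^ (k + 1) := by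
    have h1 : ContinuousAt (fun ε => ‖b ε‖ * k) 0 := hb.continuousAt.norm.mul continuousAt_const
    refine h1.eventually_lt continuousAt_const ?_
    simpa [hb0] using pow_pos hη'0 (k + 1)
  filter_upwards [hbsmall, hA, Metric.ball_mem_nhds (0 : Fin ℓ → ℂ) hR,
    Metric.ball_mem_nhds (0 : Fin ℓ → ℂ) hη] with ε h1 h2 h3 h4 hsimple
  rw [mem_ball_zero_iff] at h3 h4
  have hgoodε : ∀ z : ℂ, ‖z‖ < r → _ := fun z hz => HR (y := (ε, z)) (by
    rw [Prod.dist_eq]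
    simpa only [dist_zero_right] using max_lt h3 (hz.trans hrR))
  have hroots : ∀ c : ℂ, nfPoly (b ε) c = 0 → ‖χ ε c‖ < r ∧ φ ε (χ ε c) = c := by
    intro c hc
    have h5 := (norm_root_lt hη'0 (min_le_right _ _) h1 hc).trans_le (min_le_left _ _)
    exact Hη (y := (ε, c)) (by
      rw [Prod.dist_eq]
      simpa only [dist_zero_right] using max_lt h4 h5)
  set P := nfPolynomial (b ε) with hP
  have hPmem : ∀ c, c ∈ P.roots ↔ nfPoly (b ε) c = 0 := by
    intro c
    rw [Polynomial.mem_roots (nfPolynomial_monic _).ne_zero, Polynomial.IsRoot, eval_nfPolynomial]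
  have hzero : ∀ z : ℂ, ‖z‖ < r → (ω ε z = 0 ↔ nfPoly (b ε) (φ ε z) = 0) := by
    intro z hz
    obtain ⟨-, h6, h7, h8⟩ := hgoodε z hz
    have h9 := h8.self_of_nhds
    simp only [nfVal] at h9
    constructor
    · intro h10
      rw [h10, mul_zero, eq_comm, div_eq_zero_iff] at h9
      exact h9.resolve_right h7
    · intro h10
      rw [h10, zero_div] at h9
      exact (mul_eq_zero.1 h9).resolve_left h6
  have hder : ∀ c : ℂ, nfPoly (b ε) c = 0 →
      deriv (ω ε) (χ ε c) = P.derivative.eval c / (1 + A ε * c ^ k) ∧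
        deriv (ω ε) (χ ε c) ≠ 0 := by
    intro c hc
    obtain ⟨h5, h6⟩ := hroots c hc
    obtain ⟨⟨-, h7, h8⟩, h9, h10, h11⟩ := hgoodε _ h5
    have h12 := (hzero _ h5).2 (by rw [h6]; exact hc)
    have h13 := deriv_eq_of_conj h8 h7 h9 h12 h10 (by simp only [h6]; exact hc) h11
    simp only [h6] at h13
    exact ⟨h13, hsimple _ h5 h12⟩
  classical
  -- The inverse coordinate is a bijection from the roots of P onto the zeros of ω_ε in the disk and
  -- respects eigenvalues. Simplicity of these zeros makes all roots of P simple.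
  refine ⟨P.roots.toFinset.image (χ ε), fun z => ?_, ?_⟩
  · rw [Finset.mem_image]
    constructor
    · rintro ⟨c, hc, rfl⟩
      have hc' := (hPmem c).1 (Multiset.mem_toFinset.1 hc)
      obtain ⟨h5, h6⟩ := hroots c hc'
      exact ⟨h5, (hzero _ h5).2 (by rw [h6]; exact hc')⟩
    · rintro ⟨h5, h6⟩
      exact ⟨φ ε z, Multiset.mem_toFinset.2 ((hPmem _).2 ((hzero z h5).1 h6)), (hgoodε z h5).1.1⟩
  · rw [Finset.sum_image, h2, ← sum_roots_eq hk (b ε) (A ε)]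
    · refine Finset.sum_congr rfl fun c hc => ?_
      rw [(hder c ((hPmem c).1 (Multiset.mem_toFinset.1 hc))).1, inv_div]
    · intro c hc h0
      obtain ⟨h5, h6⟩ := hder c ((hPmem c).1 hc)
      rw [hP, h0, zero_div] at h5
      exact h6 h5
    · intro c hc d hd hcd
      rw [← (hroots c ((hPmem c).1 (Multiset.mem_toFinset.1 hc))).2,
        ← (hroots d ((hPmem d).1 (Multiset.mem_toFinset.1 hd))).2, hcd]

/-! ### Existence theorem -/

/-- Every generic unfolding is conjugate to a normal form. -/
theorem exists_normalForm {k ℓ : ℕ} (hℓ : 1 ≤ ℓ) (hℓk : ℓ ≤ k) {ω : (Fin ℓ → ℂ) → ℂ → ℂ}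
    (hω : IsGenericUnfolding k ℓ ω) :
    ∃ (φ : (Fin ℓ → ℂ) → ℂ → ℂ) (h : (Fin ℓ → ℂ) → (Fin ℓ → ℂ))
      (b : (Fin ℓ → ℂ) → Fin k → ℂ) (A : (Fin ℓ → ℂ) → ℂ),
      IsNormalForm b A ∧ IsConjugacy ω (nfField b A) φ h ∧ IsSumInvEigenvalues ω h A := by
  obtain ⟨φ, b, A, hφ, hb, hA, hconj⟩ := exists_normalization hω.analytic hω.parabolic
  have hz : Tendsto (fun z : ℂ => ((0 : Fin ℓ → ℂ), z)) (𝓝 0) (𝓝 (0, 0)) := by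
    have : Continuous (fun z : ℂ => ((0 : Fin ℓ → ℂ), z)) := by fun_prop
    exact this.tendsto 0
  have hφ' : deriv (φ 0) 0 ≠ 0 := hconj.self_of_nhds.1
  have hconj₀ : ∀ᶠ z in 𝓝 (0 : ℂ), 1 + A 0 * φ 0 z ^ k ≠ 0 ∧
      deriv (φ 0) z * ω 0 z = nfVal (b 0) (A 0) (φ 0 z) :=
    (hz.eventually hconj).mono fun z h => h.2
  obtain ⟨hφ0, hb0⟩ := eq_zero_of_conj_parabolic hω.parabolic (analyticAt_slice hφ) hφ' hconj₀
  let h : (Fin ℓ → ℂ) → (Fin ℓ → ℂ) := fun ε j => b ε (Fin.castLE hℓk j)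
  have hh : AnalyticAt ℂ h 0 :=
    analyticAt_pi_iff.2 fun j => (analyticAt_pi_iff.1 hb) (Fin.castLE hℓk j)
  have hh0 : h 0 = 0 := funext fun j => congrFun hb0 _
  have hinj : Function.Injective (fderiv ℂ h 0) := fderiv_coeff_injective hℓk hω hφ hφ0 hφ' hb hb0
    hA (hconj.mono fun p h => h.2)
  -- The first ℓ coefficients form a local diffeomorphism h in ε. Composing b and A with its inverse
  -- g turns these coefficients into the parameters and leaves φ unchanged.
  obtain ⟨g, hg, hg0, hgr, hgl⟩ := exists_analyticAt_localInverse hh hinj rfl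
  rw [hh0] at hg hg0 hgr
  refine ⟨φ, h, fun ε => b (g ε), fun ε => A (g ε), ⟨?_, ?_, ?_, ?_⟩,
    ⟨hφ, hφ0, hφ', hh, hh0, ⟨hinj, ?_⟩, ?_⟩, ?_⟩
  · exact fun i => (analyticAt_pi_iff.1 (AnalyticAt.comp_of_eq hb hg hg0)) i
  · intro i
    rw [hg0, hb0]
    rfl
  · exact AnalyticAt.comp_of_eq hA hg hg0
  · intro i j hij
    filter_upwards [hgr] with ε hε
    have h1 : Fin.castLE hℓk j = i := Fin.ext hij.symm
    rw [← h1]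
    exact congrFun hε j
  · exact (LinearMap.injective_iff_surjective (f := (fderiv ℂ h 0).toLinearMap)).1 hinj
  · have h1 : ∀ᶠ p : (Fin ℓ → ℂ) × ℂ in 𝓝 (0, 0), g (h p.1) = p.1 := by
      rw [nhds_prod_eq]
      exact (hgl.prod_inl _)
    filter_upwards [hconj, h1] with p h2 h3
    rw [nfField_eq, h3]
    exact h2.2.2
  · exact isSumInvEigenvalues_of_conj (hℓ.trans hℓk) hω.analytic hφ hφ0 hφ' hb hb0
      (hgl.mono fun ε hε => by rw [hε]) hconj

end ParabolicUnfolding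

theorem mainTheorem2 (k ℓ : ℕ) (hℓ : 1 ≤ ℓ) (hℓk : ℓ ≤ k) :
    -- existence of the normal form
    (∀ ω : (Fin ℓ → ℂ) → ℂ → ℂ, ParabolicUnfolding.IsGenericUnfolding k ℓ ω →
      ∃ (φ : (Fin ℓ → ℂ) → ℂ → ℂ) (h : (Fin ℓ → ℂ) → (Fin ℓ → ℂ))
        (b : (Fin ℓ → ℂ) → Fin k → ℂ) (A : (Fin ℓ → ℂ) → ℂ),
        ParabolicUnfolding.IsNormalForm b A ∧
        ParabolicUnfolding.IsConjugacy ω (ParabolicUnfolding.nfField b A) φ h ∧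
        ParabolicUnfolding.IsSumInvEigenvalues ω h A) ∧
    -- almost uniqueness of the normal form
    (∀ (b b' : (Fin ℓ → ℂ) → Fin k → ℂ) (A A' : (Fin ℓ → ℂ) → ℂ)
        (φ : (Fin ℓ → ℂ) → ℂ → ℂ) (h : (Fin ℓ → ℂ) → (Fin ℓ → ℂ)),
      ParabolicUnfolding.IsNormalForm b A → ParabolicUnfolding.IsNormalForm b' A' →
      ParabolicUnfolding.IsConjugacy (ParabolicUnfolding.nfField b A)
        (ParabolicUnfolding.nfField b' A') φ h →
      ∃ (μ : ℂ) (T : (Fin ℓ → ℂ) → ℂ), μ ^ k = 1 ∧ AnalyticAt ℂ T 0 ∧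
        (∀ᶠ ε in 𝓝 (0 : Fin ℓ → ℂ), ∀ j : Fin ℓ, h ε j = μ ^ (1 - (j : ℤ)) * ε j) ∧
        (∀ᶠ p : (Fin ℓ → ℂ) × ℂ in 𝓝 (0, 0),
          ParabolicUnfolding.FlowsTo (ParabolicUnfolding.nfField b' A' (h p.1)) (T p.1)
            (μ * p.2) (φ p.1 p.2)) ∧
        (∀ᶠ ε in 𝓝 (0 : Fin ℓ → ℂ), A ε = A' (h ε)) ∧
        (∀ᶠ ε in 𝓝 (0 : Fin ℓ → ℂ), ∀ z : ℂ,
          ParabolicUnfolding.nfPoly (b' (h ε)) (μ * z)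
            = μ * ParabolicUnfolding.nfPoly (b ε) z)) ∧
    -- the parameters are canonical
    (∀ ω : (Fin ℓ → ℂ) → ℂ → ℂ, ParabolicUnfolding.IsGenericUnfolding k ℓ ω →
      ∀ (b₁ b₂ : (Fin ℓ → ℂ) → Fin k → ℂ) (A₁ A₂ : (Fin ℓ → ℂ) → ℂ)
        (φ₁ φ₂ : (Fin ℓ → ℂ) → ℂ → ℂ) (h₁ h₂ : (Fin ℓ → ℂ) → (Fin ℓ → ℂ)),
      ParabolicUnfolding.IsNormalForm b₁ A₁ → ParabolicUnfolding.IsNormalForm b₂ A₂ →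
      ParabolicUnfolding.IsConjugacy ω (ParabolicUnfolding.nfField b₁ A₁) φ₁ h₁ →
      ParabolicUnfolding.IsConjugacy ω (ParabolicUnfolding.nfField b₂ A₂) φ₂ h₂ →
      ∃ μ : ℂ, μ ^ k = 1 ∧
        ∀ᶠ ε in 𝓝 (0 : Fin ℓ → ℂ), ∀ j : Fin ℓ, h₂ ε j = μ ^ (1 - (j : ℤ)) * h₁ ε j) :=
  ⟨fun _ hω => ParabolicUnfolding.exists_normalForm hℓ hℓk hω,
    fun _ _ _ _ _ _ hb hb' H => ParabolicUnfolding.normalForm_almost_unique hℓ hℓk hb hb' H,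
    fun _ _ _ _ _ _ _ _ _ _ hb₁ hb₂ H₁ H₂ =>
      ParabolicUnfolding.normalForm_param_canonical hℓ hℓk hb₁ hb₂ H₁ H₂⟩
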